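/- Let $\mathbf k$ be an algebraically closed field, $R=\mathbf k[[X_1,\dots,X_N]]$, $M=(X_1,\dots,X_N)$, $R_n=R/M^n$. A curve singularity is a closed subscheme $C=\operatorname{Spec}(R/I)$ with $R/I$ one-dimensional and Cohen--Macaulay; it has Hilbert polynomial $p$ if $\dim_{\mathbf k} R/(I+M^{t+1})=p(t)$ for $t\gg0$. Fix $p(T)=e_0(T+1)-e_1$ which is the Hilbert polynomial of at least one curve singularity in $\operatorname{Spec} R$, and fix $s=e_0(N-1)+1$ linear forms $L_1,\dots,L_s$ any $N$ of which are linearly independent. A family of curve singularities with Hilbert polynomial $p$ over an affine $\mathbf k$-scheme of finite type $S=\operatorname{Spec}A$ is a closed subscheme $Z\subset\operatorname{Spec}A[[X_1,\dots,X_N]]$, flat over $S$, such that for all $n\ge e_0+1$ the truncation $Z_n$ defined by $I(Z)+(X_1,\dots,X_N)^n$ is flat over $S$ with fibres of length $p(n-1)$, and such that for every closed point $s\in S$ the fibre $Z_s\subset\operatorname{Spec}R$ is a curve singularity with Hilbert polynomial $p$. For $n\ge e_0+1$ let $Hilb_n$ be the Hilbert scheme of closed subschemes of $\operatorname{Spec}R_n$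 of length $p(n-1)$, with universal family $T_n\subset Hilb_n\times\operatorname{Spec}R_n$. Let $W'(n)\subset Hilb_n$ be the subscheme representing those families in $\operatorname{Spec} R_n$ whose truncations modulo $M^t$ are flat with fibres of length $p(t-1)$ for all $e_0+1\le t\le n$. Let $\Xi_n\subset W'(n)$ be the open subscheme whose closed points are the $[R/E]$ for which there are an index $q$, a set $i$ of $p(e_0-1)$ monomials of degree $<e_0$ and a set $j$ of $e_0$ monomials of degree $e_0$ such that $\dim_{\mathbf k}R/(E+M^{e_0+1}+(L_q))\le e_0$ and such that the linear span of the monomials $m\in i$ and of the products $L_q^r m$, $m\in j$, $0\le r\le n-e_0-1$, maps isomorphically onto $R/E$. Put $U_n=T_n\times_{Hilb_n}\Xi_n\subset \Xi_n\times\operatorname{Spec}R_n$, with projection $\rho_n:U_n\to\Xi_n$. Then all these schemes exist; truncation modulo $M^n$ defines morphisms $a_n:\Xi_{n+1}\to\Xi_n$ (the pullback of $U_n$ along $a_n$ is the truncation of $U_{n+1}$ modulo $M^n$); and the inverse system $\{\Xi_n,a_n\}_{n\ge e_0+1}$ has a limit $\mathbf H_{N,p}$ in the category of $\mathbf k$-schemes,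 with projections $\pi_n:\mathbf H_{N,p}\to\Xi_n$. Moreover: (1) There are morphisms of $\mathbf k$-schemes $\alpha_n:U_{n+1}\to U_n$ with $\rho_n\alpha_n=a_n\rho_{n+1}$ for all $n\ge e_0+1$; and for every choice of such morphisms the inverse system $\{U_n,\alpha_n\}_{n\ge e_0+1}$ has a limit $\mathbf Z_{N,p}$ in the category of $\mathbf k$-schemes, with a morphism $\varphi:\mathbf Z_{N,p}\to\mathbf H_{N,p}$ induced by the $\rho_n$. (2) For every family of curve singularities $Z\to S$ with Hilbert polynomial $p$ there is a unique morphism of $\mathbf k$-schemes $\sigma:S\to\mathbf H_{N,p}$ such that, for all $n\ge e_0+1$, $Z_n\cong S\times_{\Xi_n}U_n$ as closed subschemes of $S\times\operatorname{Spec}R_n$, where $S\to\Xi_n$ is $\pi_n\sigma$. -/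

import Mathlib

open CategoryTheory CategoryTheory.Limits AlgebraicGeometry Opposite

universe u

namespace CurveModuli

noncomputable section

/-! ### Power series, curve singularities, Hilbert polynomials -/

/-- The ring `A[[X₁, …, X_N]]`. -/
abbrev PS (N : ℕ) (A : Type u) [CommRing A] : Type u := MvPowerSeries (Fin N) A

/-- The ideal `(X₁, …, X_N)` of `A[[X₁, …, X_N]]`. -/
def varIdeal (N : ℕ) (A : Type u) [CommRing A] : Ideal (PS N A) :=
  Ideal.span (Set.range fun i : Fin N => (MvPowerSeries.X i : PS N A))

/-- The integer `p(t)` for the polynomial `p(T) = e₀ (T + 1) - e₁`. -/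
def hilbPoly (e₀ : ℕ) (e₁ t : ℤ) : ℤ := e₀ * (t + 1) - e₁

/-- `Spec (k[[X]] / I)` is a curve singularity: a one-dimensional Cohen-Macaulay scheme.
A one-dimensional Noetherian local ring is Cohen-Macaulay iff its maximal ideal contains a
non-zero-divisor. -/
def IsCurveSingularity {k : Type u} [Field k] {N : ℕ} (I : Ideal (PS N k)) : Prop :=
  ringKrullDim (PS N k ⧸ I) = 1 ∧
    ∃ x ∈ varIdeal N k, Ideal.Quotient.mk I x ∈ nonZeroDivisors (PS N k ⧸ I)

/-- `dim_k k[[X]] / (I + M ^ (t + 1)) = p(t)` for all large `t`. -/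
def HasHilbertPolynomial {k : Type u} [Field k] {N : ℕ} (I : Ideal (PS N k)) (e₀ : ℕ) (e₁ : ℤ) :
    Prop :=
  ∀ᶠ t : ℕ in Filter.atTop,
    (Module.finrank k (PS N k ⧸ (I ⊔ varIdeal N k ^ (t + 1))) : ℤ) = hilbPoly e₀ e₁ t

/-! ### Schemes over `k` with a morphism to `Spec (k[[X]] / M ^ n)` -/

/-- `Spec A` as a `k`-scheme. -/
def specOver (k : Type u) [Field k] (A : Type u) [CommRing A] [Algebra k A] :
    Over (Spec (CommRingCat.of k)) :=
  Over.mk (Spec.map (CommRingCat.ofHom (algebraMap k A)))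

/-- The morphism of `k`-schemes attached to a homomorphism of `k`-algebras. -/
def specOverMap {k : Type u} [Field k] {A B : Type u} [CommRing A] [Algebra k A]
    [CommRing B] [Algebra k B] (f : A →ₐ[k] B) : specOver k B ⟶ specOver k A :=
  Over.homMk (Spec.map (CommRingCat.ofHom f.toRingHom)) (by
    simp only [specOver, Over.mk_hom, ← Spec.map_comp, ← CommRingCat.ofHom_comp]
    congr 2
    exact f.comp_algebraMap)

/-- `R_n = k[[X]] / M ^ n`. -/
abbrev TruncRing (k : Type u) [Field k] (N n : ℕ) : Type u := PS N k ⧸ varIdeal N k ^ n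

/-- The closed immersion `Spec R_t ⟶ Spec R_n` for `t ≤ n`. -/
def truncMap (k : Type u) [Field k] (N : ℕ) {t n : ℕ} (h : t ≤ n) :
    specOver k (TruncRing k N t) ⟶ specOver k (TruncRing k N n) :=
  specOverMap (Ideal.Quotient.factorₐ k (Ideal.pow_le_pow_right h))

/-- A `k`-scheme `Z` with morphisms to `S` and to `Spec R_n`, that is, with a morphism to
`S × Spec R_n`. -/
structure RelScheme (k : Type u) [Field k] (N n : ℕ) (S : Over (Spec (CommRingCat.of k))) where
  Z : Over (Spec (CommRingCat.of k))
  toBase : Z ⟶ S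
  toTrunc : Z ⟶ specOver k (TruncRing k N n)

namespace RelScheme

variable {k : Type u} [Field k] {N n : ℕ} {S S' : Over (Spec (CommRingCat.of k))}

/-- `Z` is a closed subscheme of `S × Spec R_n`. -/
def IsClosedSubscheme (Z : RelScheme k N n S) : Prop :=
  IsClosedImmersion (pullback.lift Z.toBase.left Z.toTrunc.left (by simp) :
    Z.Z.left ⟶ pullback S.hom (specOver k (TruncRing k N n)).hom)

/-- `Z ⟶ S` is (finite and) flat with fibres of length `d`. For a finite flat morphism the length
of the fibre at `s` is the rank at `s`. -/
def IsFlatOfLength (Z : RelScheme k N n S) (d : ℤ) : Prop :=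
  IsFinite Z.toBase.left ∧ Flat Z.toBase.left ∧ ∀ s : S.left, (Z.toBase.left.finrank s : ℤ) = d

/-- `Z' ≅ S' ×_S Z`, compatibly with the morphisms to `S'` and to `Spec R_n`. For closed subschemes
`Z ⊆ S × Spec R_n` and `Z' ⊆ S' × Spec R_n` this says that `Z'` is the pullback of `Z`
along `f`. -/
def IsPullbackAlong (Z' : RelScheme k N n S') (Z : RelScheme k N n S) (f : S' ⟶ S) : Prop :=
  ∃ g : Z'.Z ⟶ Z.Z, IsPullback g Z'.toBase Z.toBase f ∧ g ≫ Z.toTrunc = Z'.toTrunc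

/-- The truncation `Z ×_{Spec R_n} Spec R_t` for `t ≤ n`. -/
def trunc (Z : RelScheme k N n S) (t : ℕ) (h : t ≤ n) : RelScheme k N t S where
  Z := pullback Z.toTrunc (truncMap k N h)
  toBase := pullback.fst _ _ ≫ Z.toBase
  toTrunc := pullback.snd _ _

end RelScheme

/-! ### Families of curve singularities over an affine base -/

section Families

variable {k : Type u} [Field k] {N : ℕ} {A : Type u} [CommRing A] [Algebra k A]

theorem varIdeal_pow_le_comap (J : Ideal (PS N A)) (n : ℕ) :
    varIdeal N k ^ n ≤ (J ⊔ varIdeal N A ^ n).comap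
      (MvPowerSeries.mapAlgHom (σ := Fin N) (Algebra.ofId k A)) := by
  rw [← Ideal.map_le_iff_le_comap, Ideal.map_pow]
  refine le_trans (Ideal.pow_right_mono ?_ n) le_sup_right
  rw [varIdeal, varIdeal, Ideal.map_span, Ideal.span_le]
  rintro _ ⟨_, ⟨i, rfl⟩, rfl⟩
  refine Ideal.subset_span ⟨i, ?_⟩
  simp [MvPowerSeries.mapAlgHom_apply, MvPowerSeries.map_X]

/-- For the closed subscheme `Z ⊆ Spec A[[X]]` of ideal `J`, the truncation `Z_n` of ideal
`J + (X) ^ n`, with its morphisms to `Spec A` and to `Spec R_n`. -/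
def truncation (k : Type u) [Field k] [Algebra k A] (J : Ideal (PS N A)) (n : ℕ) :
    RelScheme k N n (specOver k A) where
  Z := specOver k (PS N A ⧸ (J ⊔ varIdeal N A ^ n))
  toBase := specOverMap (IsScalarTower.toAlgHom k A _)
  toTrunc := specOverMap (Ideal.quotientMapₐ (J ⊔ varIdeal N A ^ n)
    (MvPowerSeries.mapAlgHom (Algebra.ofId k A)) (varIdeal_pow_le_comap J n))

/-- The closed subscheme of `Spec A[[X]]` of ideal `J` is a family of curve singularities over
`Spec A` with Hilbert polynomial `p(T) = e₀ (T + 1) - e₁`. The closed points of `Spec A` are the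
`k`-algebra homomorphisms `s : A → k` (`k` is algebraically closed and `A` of finite type), and the
fibre at `s` is the closed subscheme of `Spec k[[X]]` whose ideal is generated by the image
of `J`. -/
structure IsFamily (k : Type u) [Field k] [Algebra k A] (e₀ : ℕ) (e₁ : ℤ) (J : Ideal (PS N A)) :
    Prop where
  flat : Module.Flat A (PS N A ⧸ J)
  flat_trunc : ∀ n : ℕ, e₀ + 1 ≤ n →
    (truncation k J n).IsFlatOfLength (hilbPoly e₀ e₁ ((n : ℤ) - 1))
  fiber : ∀ s : A →ₐ[k] k,
    IsCurveSingularity (J.map (MvPowerSeries.map (s : A →+* k))) ∧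
      HasHilbertPolynomial (J.map (MvPowerSeries.map (s : A →+* k))) e₀ e₁

end Families

/-! ### The schemes `Hilb_n`, `W'(n)`, `Ξ_n` -/

section Moduli

variable {k : Type u} [Field k] {N : ℕ}

/-- `Hilb` is the Hilbert scheme of closed subschemes of `Spec R_n` of length `d`, and `T` is its
universal family. -/
def IsHilbertScheme {n : ℕ} (d : ℤ) {Hilb : Over (Spec (CommRingCat.of k))}
    (T : RelScheme k N n Hilb) : Prop :=
  T.IsClosedSubscheme ∧ T.IsFlatOfLength d ∧
    ∀ (S : Over (Spec (CommRingCat.of k))) (Z : RelScheme k N n S),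
      Z.IsClosedSubscheme → Z.IsFlatOfLength d → ∃! f : S ⟶ Hilb, Z.IsPullbackAlong T f

/-- `w : W ⟶ Hilb` is the subscheme of the Hilbert scheme representing the families `Z ⟶ S` in
`Spec R_n` all of whose truncations `Z ×_{Spec R_n} Spec R_t`, `e₀ + 1 ≤ t ≤ n`, are flat over `S`
with fibres of length `p(t - 1)`. -/
def IsTruncationStratum (e₀ : ℕ) (e₁ : ℤ) {n : ℕ} {Hilb W : Over (Spec (CommRingCat.of k))}
    (T : RelScheme k N n Hilb) (w : W ⟶ Hilb) : Prop :=
  Mono w ∧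
    ∀ (S : Over (Spec (CommRingCat.of k))) (Z : RelScheme k N n S) (f : S ⟶ Hilb),
      Z.IsPullbackAlong T f →
        ((∃ g : S ⟶ W, g ≫ w = f) ↔
          ∀ (t : ℕ) (_ : e₀ + 1 ≤ t) (h : t ≤ n),
            (Z.trunc t h).IsFlatOfLength (hilbPoly e₀ e₁ ((t : ℤ) - 1)))

/-- The linear form `∑ cᵢ Xᵢ` as a power series. -/
def linearForm (c : Fin N → k) : PS N k := ∑ i, MvPowerSeries.C (c i) * MvPowerSeries.X i

/-- The linear span `D_n` of the monomials `X ^ a`, `a ∈ i`, and of the products `ℓ ^ r X ^ b`,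
`b ∈ j`, `0 ≤ r ≤ n - e₀ - 1`. -/
def cellSpan (e₀ n : ℕ) (i j : Finset (Fin N →₀ ℕ)) (ℓ : PS N k) : Submodule k (PS N k) :=
  Submodule.span k
    ({m | ∃ a ∈ i, m = MvPowerSeries.monomial a 1} ∪
      {m | ∃ b ∈ j, ∃ r : ℕ, r + e₀ + 1 ≤ n ∧ m = ℓ ^ r * MvPowerSeries.monomial b 1})

/-- For an ideal `E ⊇ M ^ n` of `k[[X]]`, the point `[k[[X]] / E]` lies in the union over `i, j, q`
of the open sets `B_n(i, j, q) ∩ U_n(L_q)`: there are a set `i` of `p(e₀ - 1)` monomials of degree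
less than `e₀`, a set `j` of `e₀` monomials of degree `e₀`, and an index `q` such that
`D_n(i, j, q) ⟶ k[[X]] / E` is an isomorphism and `dim_k k[[X]] / (E + M ^ (e₀ + 1) + (L_q)) ≤ e₀`. -/
def InCells (e₀ : ℕ) (e₁ : ℤ) {s : ℕ} (L : Fin s → Fin N → k) (n : ℕ) (E : Ideal (PS N k)) :
    Prop :=
  ∃ (i j : Finset (Fin N →₀ ℕ)) (q : Fin s),
    ((i.card : ℤ) = hilbPoly e₀ e₁ ((e₀ : ℤ) - 1) ∧ ∀ a ∈ i, a.degree < e₀) ∧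
    (j.card = e₀ ∧ ∀ b ∈ j, b.degree = e₀) ∧
    Function.Bijective (fun x : cellSpan e₀ n i j (linearForm (L q)) =>
      Ideal.Quotient.mk E (x : PS N k)) ∧
    Module.finrank k
      (PS N k ⧸ (E ⊔ varIdeal N k ^ (e₀ + 1) ⊔ Ideal.span {linearForm (L q)})) ≤ e₀

/-- `j : Ξ ⟶ W` is the open subscheme of `W` whose closed points (equivalently, `k`-points) are the
points `[k[[X]] / E]` of `W` that satisfy `InCells`. -/
def IsCellSubscheme (e₀ : ℕ) (e₁ : ℤ) {s : ℕ} (L : Fin s → Fin N → k) {n : ℕ}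
    {Hilb W Ξ : Over (Spec (CommRingCat.of k))} (T : RelScheme k N n Hilb) (w : W ⟶ Hilb)
    (j : Ξ ⟶ W) : Prop :=
  IsOpenImmersion j.left ∧
    ∀ (E : Ideal (PS N k)), varIdeal N k ^ n ≤ E → ∀ x : specOver k k ⟶ W,
      (truncation k E n).IsPullbackAlong T (x ≫ w) →
        ((∃ y : specOver k k ⟶ Ξ, y ≫ j = x) ↔ InCells e₀ e₁ L n E)

end Moduli

end

end CurveModuli

open CurveModuli

/-! Over an affine base `B`, a closed subscheme of Spec B × Spec R_n is a `B`-algebra `Q` with a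
homomorphism R_n → Q whose image spans `Q` over `B`. If a fixed set of power series, as many as the
length, spans a flat `Q`, then it is a basis, and the family is recorded by the coordinates of the
elements of R_n. The identities between such coordinates are polynomial, so an affine scheme
represents the families with a given basis (`Cell.exists_represents`). If the basis is adapted to
the powers of M, then the requirement that truncations be flat of given length becomes the vanishing
of certain coordinates. Every fibre has an adapted basis, so these affine charts glue
(`RelScheme.exists_represents_of_cells`). Imposing the truncation condition only for t = n gives
Hilb_n; imposing it for all t ≥ e₀ + 1 gives W'(n).

Ξ_n is the open part of W'(n) where, for some i, j, q, the monomials in i and j span modulo M^(e₀+1)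
and L_q has colength at most e₀ there. Both conditions see only the truncation modulo M^(e₀+1).
Together with the Hilbert function they force multiplication by L_q to be injective from Q/𝔪^s to
Q/𝔪^(s+1) for the relevant s ≥ e₀ (`mem_pow_of_mul_mem`), so the monomials in i and the products
L_q^r m, m in j, form a basis for every n (`span_cellFam_eq_top`). Hence each cell of Ξ_{n+1} is the
preimage of a cell of Ξ_n, and on it a_n is a base change of a morphism of affine schemes. So a_n is
affine (`isAffineHom_of_isPullbackAlong_trunc`), and inverse sequences with affine transition
morphisms have limits (`hasLimit_ofOpSequence_of_isAffineHom`). A morphism to the limit is a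
compatible sequence of classifying morphisms; thus (2) follows once families of curve singularities
are known to lie in the cells.

Cells being open, this is checked at closed points. For a curve singularity the graded pieces of
degree at least e₀ + 1 have dimension e₀. An argument of Eakin–Sathaye type
(`exists_linForm_le_sup`) yields a linear form y that acts bijectively between them. The operators
y⁻¹L commute; peeling off common eigenvectors one at a time gives e₀ nonzero characters, each
vanishing on at most N - 1 of the L_q, so one of the e₀(N - 1) + 1 forms is invertible. That form is
a nonzerodivisor of colength e₀, and a comparison of lengths shows that the Hilbert function agrees
with p already at e₀ - 1 (`exists_superficial`), which makes the choice of i and j possible.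

For (1), truncation supplies no morphism U_{n+1} → U_n, but ρ_n has a section: the basis contains an
element of 𝔪^(n-1), which 𝔪 kills, so B → Q/𝔪Q is bijective and the origin is a section z_n
(`IsCellFamily.exists_section`). Then α_n = z_n a_n ρ_{n+1} works. Any choice of α_n is affine,
because ρ_n α_n = a_n ρ_{n+1} is affine and ρ_n is finite. -/

namespace CurveModuli

noncomputable section

/-! ### Affine k-schemes and algebra homomorphisms. -/

section SpecOver

variable {k : Type u} [Field k] {A B C : Type u} [CommRing A] [Algebra k A]
  [CommRing B] [Algebra k B] [CommRing C] [Algebra k C]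

theorem specOverMap_comp (f : A →ₐ[k] B) (g : B →ₐ[k] C) :
    specOverMap g ≫ specOverMap f = specOverMap (g.comp f) :=
  Over.OverMorphism.ext (Spec.map_comp (CommRingCat.ofHom f.toRingHom)
    (CommRingCat.ofHom g.toRingHom)).symm

theorem specOverMap_id : specOverMap (AlgHom.id k A) = 𝟙 (specOver k A) :=
  Over.OverMorphism.ext (Spec.map_id (CommRingCat.of A))

theorem specOverMap_injective : Function.Injective (specOverMap (k := k) (A := A) (B := B)) := by
  intro f g h
  have := Spec.map_injective congr($(h).left)
  ext x
  exact congr($(this).hom x)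

theorem specOverMap_surjective :
    Function.Surjective (specOverMap (k := k) (A := A) (B := B)) := by
  intro f
  obtain ⟨g, hg⟩ := Spec.map_surjective (R := CommRingCat.of A) (S := CommRingCat.of B) f.left
  have h : CommRingCat.ofHom (algebraMap k A) ≫ g = CommRingCat.ofHom (algebraMap k B) := by
    apply Spec.map_injective
    rw [Spec.map_comp, hg]
    exact Over.w f
  refine ⟨⟨g.hom, fun r => congr($(h).hom r)⟩, Over.OverMorphism.ext ?_⟩
  rw [← hg]
  rfl

end SpecOver

/-! ### Pullback and truncation of relative schemes. -/

namespace RelScheme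

variable {k : Type u} [Field k] {N n : ℕ} {S S' S'' : Over (Spec (CommRingCat.of k))}

theorem IsPullbackAlong.refl (Z : RelScheme k N n S) : Z.IsPullbackAlong Z (𝟙 S) :=
  ⟨𝟙 _, IsPullback.of_vert_isIso ⟨by simp⟩ |>.flip, by simp⟩

theorem IsPullbackAlong.comp {Z'' : RelScheme k N n S''} {Z' : RelScheme k N n S'}
    {Z : RelScheme k N n S} {g : S'' ⟶ S'} {f : S' ⟶ S}
    (h₁ : Z''.IsPullbackAlong Z' g) (h₂ : Z'.IsPullbackAlong Z f) :
    Z''.IsPullbackAlong Z (g ≫ f) := by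
  obtain ⟨a, ha, ha'⟩ := h₁
  obtain ⟨b, hb, hb'⟩ := h₂
  exact ⟨a ≫ b, ha.paste_horiz hb, by simp [ha', hb']⟩

/-- The comparison morphism comes from the universal property of the square of `h₂`, and the pasting
law does the rest. This is how a classifying morphism that factors through a subscheme of the base
is recognized as classifying there. -/
theorem IsPullbackAlong.of_comp {Z'' : RelScheme k N n S''} {Z' : RelScheme k N n S'}
    {Z : RelScheme k N n S} {g : S'' ⟶ S'} {f : S' ⟶ S}
    (h : Z''.IsPullbackAlong Z (g ≫ f)) (h₂ : Z'.IsPullbackAlong Z f) :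
    Z''.IsPullbackAlong Z' g := by
  obtain ⟨a, ha, ha'⟩ := h
  obtain ⟨b, hb, hb'⟩ := h₂
  have e : hb.lift a (Z''.toBase ≫ g) (by simpa using ha.w) ≫ b = a := hb.lift_fst _ _ _
  refine ⟨hb.lift a (Z''.toBase ≫ g) (by simpa using ha.w), ?_, ?_⟩
  · refine IsPullback.of_right ?_ (hb.lift_snd _ _ _) hb
    rw [e]; exact ha
  · rw [← hb', ← Category.assoc, e, ha']

/-- The pullback of a relative scheme along a morphism of base schemes. -/
def pb (Z : RelScheme k N n S) (f : S' ⟶ S) : RelScheme k N n S' where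
  Z := pullback Z.toBase f
  toBase := pullback.snd _ _
  toTrunc := pullback.fst _ _ ≫ Z.toTrunc

/-- The projection of the pullback to the original relative scheme. -/
def pbFst (Z : RelScheme k N n S) (f : S' ⟶ S) : (Z.pb f).Z ⟶ Z.Z := pullback.fst _ _

theorem isPullback_pb (Z : RelScheme k N n S) (f : S' ⟶ S) :
    IsPullback (Z.pbFst f) (Z.pb f).toBase Z.toBase f :=
  IsPullback.of_hasPullback _ _

theorem pbFst_toTrunc (Z : RelScheme k N n S) (f : S' ⟶ S) :
    Z.pbFst f ≫ Z.toTrunc = (Z.pb f).toTrunc := rfl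

theorem isPullbackAlong_pb (Z : RelScheme k N n S) (f : S' ⟶ S) :
    (Z.pb f).IsPullbackAlong Z f :=
  ⟨Z.pbFst f, Z.isPullback_pb f, rfl⟩

/-- Two pullbacks along the same morphism are isomorphic. -/
theorem IsPullbackAlong.unique {Z₁ Z₂ : RelScheme k N n S'} {Z : RelScheme k N n S} {f : S' ⟶ S}
    (h₁ : Z₁.IsPullbackAlong Z f) (h₂ : Z₂.IsPullbackAlong Z f) : Z₁.IsPullbackAlong Z₂ (𝟙 S') :=
  IsPullbackAlong.of_comp (by simpa using h₁) h₂

theorem IsPullbackAlong.symm {Z₁ Z₂ : RelScheme k N n S} (h : Z₁.IsPullbackAlong Z₂ (𝟙 S)) :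
    Z₂.IsPullbackAlong Z₁ (𝟙 S) :=
  IsPullbackAlong.unique (IsPullbackAlong.refl _) h

/-- The morphism to `S ×ₖ Spec R_n`. -/
def toProd (Z : RelScheme k N n S) :
    Z.Z.left ⟶ pullback S.hom (specOver k (TruncRing k N n)).hom :=
  pullback.lift Z.toBase.left Z.toTrunc.left (by simp)

theorem toProd_fst (Z : RelScheme k N n S) : Z.toProd ≫ pullback.fst _ _ = Z.toBase.left :=
  pullback.lift_fst _ _ _

theorem toProd_fst_assoc (Z : RelScheme k N n S) {Y : Scheme.{u}} (f : S.left ⟶ Y) :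
    Z.toProd ≫ pullback.fst _ _ ≫ f = Z.toBase.left ≫ f := by
  rw [← Category.assoc, toProd_fst]

theorem toProd_snd (Z : RelScheme k N n S) : Z.toProd ≫ pullback.snd _ _ = Z.toTrunc.left :=
  pullback.lift_snd _ _ _

/-- A closed immersion is a monomorphism. This uniqueness is what later allows morphisms between
families to be glued and transition maps to be functorial. -/
theorem IsClosedSubscheme.hom_ext {Z : RelScheme k N n S} (hZ : Z.IsClosedSubscheme)
    {Y : Over (Spec (CommRingCat.of k))} {g h : Y ⟶ Z.Z} (h₁ : g ≫ Z.toBase = h ≫ Z.toBase)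
    (h₂ : g ≫ Z.toTrunc = h ≫ Z.toTrunc) : g = h := by
  have : IsClosedImmersion Z.toProd := hZ
  ext1
  rw [← cancel_mono Z.toProd]
  apply pullback.hom_ext
  · simpa [toProd_fst] using congr($(h₁).left)
  · simpa [toProd_snd] using congr($(h₂).left)

theorem isPullback_left {X Y Z W : Over (Spec (CommRingCat.of k))} {a : X ⟶ Y} {b : X ⟶ Z}
    {c : Y ⟶ W} {d : Z ⟶ W} (h : IsPullback a b c d) :
    IsPullback a.left b.left c.left d.left :=
  h.map (Over.forget _)

theorem isPullback_of_left {X Y Z W : Over (Spec (CommRingCat.of k))} {a : X ⟶ Y} {b : X ⟶ Z}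
    {c : Y ⟶ W} {d : Z ⟶ W} (h : IsPullback a.left b.left c.left d.left) :
    IsPullback a b c d :=
  IsPullback.of_map (Over.forget _) (by ext1; exact h.w) h

/-- The morphism `S' ×ₖ Spec R_n ⟶ S ×ₖ Spec R_n`. -/
def prodMap (k : Type u) [Field k] (N n : ℕ) {S S' : Over (Spec (CommRingCat.of k))} (f : S' ⟶ S) :
    pullback S'.hom (specOver k (TruncRing k N n)).hom ⟶
      pullback S.hom (specOver k (TruncRing k N n)).hom :=
  pullback.lift (pullback.fst _ _ ≫ f.left) (pullback.snd _ _) (by simp [pullback.condition])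

theorem prodMap_fst (f : S' ⟶ S) :
    prodMap k N n f ≫ pullback.fst _ _ = pullback.fst _ _ ≫ f.left :=
  pullback.lift_fst _ _ _

theorem prodMap_snd (f : S' ⟶ S) :
    prodMap k N n f ≫ pullback.snd _ _ = pullback.snd _ _ :=
  pullback.lift_snd _ _ _

theorem isPullback_prodMap (f : S' ⟶ S) :
    IsPullback (prodMap k N n f) (pullback.fst _ _) (pullback.fst _ _) f.left := by
  have h1 : IsPullback (pullback.snd S'.hom (specOver k (TruncRing k N n)).hom)
      (pullback.fst _ _) (specOver k (TruncRing k N n)).hom S'.hom :=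
    (IsPullback.of_hasPullback _ _).flip
  have h2 : IsPullback (pullback.snd S.hom (specOver k (TruncRing k N n)).hom)
      (pullback.fst _ _) (specOver k (TruncRing k N n)).hom S.hom :=
    (IsPullback.of_hasPullback _ _).flip
  refine IsPullback.of_right ?_ (prodMap_fst f) h2
  rw [Over.w f, prodMap_snd]
  exact h1

/-- Needed in order to transport closedness, which concerns the morphism to the product and not the
one to the base, along base change and open covers. -/
theorem IsPullbackAlong.isPullback_toProd {Z' : RelScheme k N n S'} {Z : RelScheme k N n S}
    {f : S' ⟶ S} {g : Z'.Z ⟶ Z.Z} (hg : IsPullback g Z'.toBase Z.toBase f)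
    (hg' : g ≫ Z.toTrunc = Z'.toTrunc) :
    IsPullback g.left Z'.toProd Z.toProd (prodMap k N n f) := by
  refine IsPullback.of_bot (h₃₁ := f.left) (v₂₁ := pullback.fst _ _) (v₂₂ := pullback.fst _ _) ?_ ?_
    (isPullback_prodMap f)
  · simpa only [toProd_fst] using isPullback_left hg
  · apply pullback.hom_ext
    · simpa [toProd_fst, toProd_fst_assoc, prodMap_fst] using congr($(hg.w).left)
    · simpa [toProd_snd, prodMap_snd] using congr($(hg').left)

theorem IsPullbackAlong.isClosedSubscheme {Z' : RelScheme k N n S'} {Z : RelScheme k N n S}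
    {f : S' ⟶ S} (h : Z'.IsPullbackAlong Z f) (hZ : Z.IsClosedSubscheme) :
    Z'.IsClosedSubscheme := by
  obtain ⟨g, hg, hg'⟩ := h
  have : IsClosedImmersion Z.toProd := hZ
  exact MorphismProperty.of_isPullback (P := @IsClosedImmersion)
    (IsPullbackAlong.isPullback_toProd hg hg') this

theorem IsPullbackAlong.isFlatOfLength {Z' : RelScheme k N n S'} {Z : RelScheme k N n S}
    {f : S' ⟶ S} {d : ℤ} (h : Z'.IsPullbackAlong Z f) (hZ : Z.IsFlatOfLength d) :
    Z'.IsFlatOfLength d := by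
  obtain ⟨g, hg, hg'⟩ := h
  obtain ⟨h1, h2, h3⟩ := hZ
  have hl := isPullback_left hg
  refine ⟨MorphismProperty.of_isPullback (P := @IsFinite) hl h1,
    MorphismProperty.of_isPullback (P := @Flat) hl h2, fun s => ?_⟩
  rw [Scheme.Hom.finrank_of_isPullback _ _ _ _ hl, h3]

/-- The projection of the truncation `Z ×_{Spec R_n} Spec R_t` to `Z`. -/
def truncFst (Z : RelScheme k N n S) (t : ℕ) (ht : t ≤ n) : (Z.trunc t ht).Z ⟶ Z.Z :=
  pullback.fst _ _

theorem isPullback_trunc (Z : RelScheme k N n S) (t : ℕ) (ht : t ≤ n) :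
    IsPullback (Z.truncFst t ht) (Z.trunc t ht).toTrunc Z.toTrunc (truncMap k N ht) :=
  IsPullback.of_hasPullback _ _

theorem trunc_toBase (Z : RelScheme k N n S) (t : ℕ) (ht : t ≤ n) :
    (Z.trunc t ht).toBase = Z.truncFst t ht ≫ Z.toBase := rfl

/-- A scheme over `Z` that is the base change of `Z` to `Spec R_t` is isomorphic to the
truncation of `Z`, even after base change. -/
theorem isPullbackAlong_trunc_of_isPullback {Z' : RelScheme k N n S'} {Z : RelScheme k N n S}
    {f : S' ⟶ S} (h : Z'.IsPullbackAlong Z f) {t : ℕ} (ht : t ≤ n) {Y : RelScheme k N t S'}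
    {p : Y.Z ⟶ Z'.Z} (hp : IsPullback p Y.toTrunc Z'.toTrunc (truncMap k N ht))
    (hY : Y.toBase = p ≫ Z'.toBase) : Y.IsPullbackAlong (Z.trunc t ht) f := by
  obtain ⟨g, hg, hg'⟩ := h
  have h1 := Z.isPullback_trunc t ht
  let a : Y.Z ⟶ (Z.trunc t ht).Z := h1.lift (p ≫ g) Y.toTrunc (by
    rw [Category.assoc, hg', hp.w])
  have ha : a ≫ Z.truncFst t ht = p ≫ g := h1.lift_fst _ _ _
  have ha' : a ≫ (Z.trunc t ht).toTrunc = Y.toTrunc := h1.lift_snd _ _ _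
  refine ⟨a, ?_, ha'⟩
  rw [hY, trunc_toBase]
  refine IsPullback.paste_vert ?_ hg
  refine IsPullback.flip (IsPullback.of_bot ?_ ha.symm h1)
  rw [ha', hg']
  exact hp

theorem IsPullbackAlong.trunc {Z' : RelScheme k N n S'} {Z : RelScheme k N n S}
    {f : S' ⟶ S} (h : Z'.IsPullbackAlong Z f) (t : ℕ) (ht : t ≤ n) :
    (Z'.trunc t ht).IsPullbackAlong (Z.trunc t ht) f :=
  isPullbackAlong_trunc_of_isPullback h ht (Z'.isPullback_trunc t ht) rfl

theorem truncMap_comp {r t n : ℕ} (hr : r ≤ t) (ht : t ≤ n) :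
    truncMap k N hr ≫ truncMap k N ht = truncMap k N (hr.trans ht) := by
  rw [truncMap, truncMap, specOverMap_comp]
  congr 1
  ext x
  obtain ⟨x, rfl⟩ := Ideal.Quotient.mk_surjective x
  rfl

/-- The truncation of a truncation. -/
theorem trunc_trunc (Z : RelScheme k N n S) {r t : ℕ} (hr : r ≤ t) (ht : t ≤ n) :
    ((Z.trunc t ht).trunc r hr).IsPullbackAlong (Z.trunc r (hr.trans ht)) (𝟙 S) := by
  refine isPullbackAlong_trunc_of_isPullback (IsPullbackAlong.refl Z) (hr.trans ht)
    (p := (Z.trunc t ht).truncFst r hr ≫ Z.truncFst t ht) ?_ (by simp [trunc_toBase])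
  rw [← truncMap_comp hr ht]
  exact (((Z.trunc t ht).isPullback_trunc r hr).flip.paste_vert
    (Z.isPullback_trunc t ht).flip).flip

theorem trunc_self (Z : RelScheme k N n S) : (Z.trunc n le_rfl).IsPullbackAlong Z (𝟙 S) := by
  have h : truncMap k N (le_refl n) = 𝟙 _ := by
    rw [truncMap, ← specOverMap_id]
    congr 1
    ext x
    obtain ⟨x, rfl⟩ := Ideal.Quotient.mk_surjective x
    rfl
  have hp := Z.isPullback_trunc n le_rfl
  have w := hp.w
  rw [h] at hp w
  have : IsIso (Z.truncFst n le_rfl) := hp.isIso_fst_of_isIso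
  exact ⟨Z.truncFst n le_rfl, IsPullback.of_horiz_isIso ⟨by simp [trunc_toBase]⟩, by simpa using w⟩

end RelScheme

/-! ### Properties local on the target and gluing of morphisms. -/

theorem flat_isZariskiLocalAtTarget : IsZariskiLocalAtTarget (@Flat.{u}) :=
  HasRingHomProperty.instIsZariskiLocalAtTarget _

theorem isAffineHom_isZariskiLocalAtTarget : IsZariskiLocalAtTarget (@IsAffineHom.{u}) :=
  @HasAffineProperty.instIsZariskiLocalAtTarget _ _ instHasAffinePropertyIsAffineHomIsAffine

theorem isFinite_isZariskiLocalAtTarget : IsZariskiLocalAtTarget (@IsFinite.{u}) :=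
  @HasAffineProperty.instIsZariskiLocalAtTarget _ _ IsFinite.instHasAffinePropertyAndIsAffineFiniteCarrierObjOppositeOpensCarrierCarrierCommRingCatPresheafOpOpensTopHomAppTop

/-- A property that is local at the target holds if it holds after base change to an open cover. -/
theorem of_isPullback_of_cover (P : MorphismProperty Scheme.{u}) [IsZariskiLocalAtTarget P]
    {X Y : Scheme.{u}} (f : X ⟶ Y) {ι : Type u} {V W : ι → Scheme.{u}} (j : ∀ i, V i ⟶ Y)
    (hj : ∀ i, IsOpenImmersion (j i)) (hc : ∀ y, ∃ i, y ∈ Set.range (j i))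
    {a : ∀ i, W i ⟶ X} {b : ∀ i, W i ⟶ V i} (hp : ∀ i, IsPullback (a i) (b i) f (j i))
    (h : ∀ i, P (b i)) : P f := by
  let 𝒰 : Y.OpenCover := Scheme.Cover.mkOfCovers ι V j (fun x => hc x) hj
  refine IsZariskiLocalAtTarget.of_openCover 𝒰 fun i => ?_
  have hs : (hp i).isoPullback.inv ≫ b i = pullback.snd f (j i) := (hp i).isoPullback_inv_snd
  change P (pullback.snd f (j i))
  rw [← hs]
  exact (MorphismProperty.cancel_left_of_respectsIso P _ _).mpr (h i)

theorem exists_lift_opens {X Y : Scheme.{u}} (f : Y ⟶ X) (O : X.Opens) (h : ∀ y, f y ∈ O) :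
    ∃ g : Y ⟶ O.toScheme, g ≫ O.ι = f := by
  have h' : Set.range f ⊆ Set.range O.ι := by
    rw [O.range_ι]
    rintro _ ⟨y, rfl⟩
    exact h y
  exact ⟨IsOpenImmersion.lift O.ι f h', IsOpenImmersion.lift_fac O.ι f h'⟩

section Local

variable {k : Type u} [Field k] {S Y : Over (Spec (CommRingCat.of k))}

/-- A family of open immersions of `k`-schemes, indexed by the points of `S`, that covers `S`. -/
def pointCover {V : S.left → Over (Spec (CommRingCat.of k))} (j : ∀ x, V x ⟶ S)
    (hj : ∀ x, IsOpenImmersion (j x).left) (hx : ∀ x, x ∈ Set.range (j x).left) :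
    S.left.OpenCover :=
  Scheme.Cover.mkOfCovers S.left (fun x => (V x).left) (fun x => (j x).left)
    (fun x => ⟨x, hx x⟩) hj

/-- Morphisms of `k`-schemes with a property that determines them glue. -/
theorem exists_hom_of_local (P : ∀ {V : Over (Spec (CommRingCat.of k))}, (V ⟶ S) → (V ⟶ Y) → Prop)
    (hP : ∀ {V V' : Over (Spec (CommRingCat.of k))} (i : V' ⟶ V) (j : V ⟶ S) (f : V ⟶ Y),
      P j f → P (i ≫ j) (i ≫ f))
    (hu : ∀ {V : Over (Spec (CommRingCat.of k))} (j : V ⟶ S) (f f' : V ⟶ Y),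
      P j f → P j f' → f = f')
    (hex : ∀ x : S.left, ∃ (V : Over (Spec (CommRingCat.of k))) (j : V ⟶ S),
      IsOpenImmersion j.left ∧ x ∈ Set.range j.left ∧ ∃ f : V ⟶ Y, P j f) :
    ∃ f : S ⟶ Y, ∀ x : S.left, ∃ (V : Over (Spec (CommRingCat.of k))) (j : V ⟶ S),
      IsOpenImmersion j.left ∧ x ∈ Set.range j.left ∧ P j (j ≫ f) := by
  choose V j hj hx f hf using hex
  let 𝒰 := pointCover j hj hx
  have hc : ∀ x y, pullback.fst (j x).left (j y).left ≫ (f x).left =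
      pullback.snd _ _ ≫ (f y).left := by
    intro x y
    let Q : Over (Spec (CommRingCat.of k)) :=
      Over.mk (pullback.fst (j x).left (j y).left ≫ (V x).hom)
    let a : Q ⟶ V x := Over.homMk (pullback.fst (j x).left (j y).left) rfl
    let b : Q ⟶ V y := Over.homMk (pullback.snd (j x).left (j y).left) (by
      change _ = pullback.fst (j x).left (j y).left ≫ (V x).hom
      rw [← Over.w (j x), ← Over.w (j y), pullback.condition_assoc])
    have hab : a ≫ j x = b ≫ j y := by
      ext1
      exact pullback.condition
    -- On an overlap both local morphisms have the property relative to the same map to `S`, so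
    -- uniqueness identifies them.
    have := hu (a ≫ j x) (a ≫ f x) (b ≫ f y) (hP _ _ _ (hf x)) (by rw [hab]; exact hP _ _ _ (hf y))
    exact congr($(this).left)
  let g : S.left ⟶ Y.left := 𝒰.glueMorphisms (fun x => (f x).left) hc
  have hg : ∀ x, (j x).left ≫ g = (f x).left := fun x => 𝒰.ι_glueMorphisms _ hc x
  let F : S ⟶ Y := Over.homMk g (by
    have hw : ∀ x : S.left, (j x).left ≫ g ≫ Y.hom = (j x).left ≫ S.hom := fun x => by
      rw [← Category.assoc, hg, Over.w, Over.w]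
    exact 𝒰.hom_ext _ _ hw)
  refine ⟨F, fun x => ⟨V x, j x, hj x, hx x, ?_⟩⟩
  have : j x ≫ F = f x := by
    ext1
    exact hg x
  rw [this]
  exact hf x

theorem hom_ext_of_local {f g : S ⟶ Y} (h : ∀ x : S.left,
    ∃ (V : Over (Spec (CommRingCat.of k))) (j : V ⟶ S), IsOpenImmersion j.left ∧
      x ∈ Set.range j.left ∧ j ≫ f = j ≫ g) : f = g := by
  choose V j hj hx hfg using h
  ext1
  refine (pointCover j hj hx).hom_ext _ _ fun x => ?_
  exact congr($(hfg x).left)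

/-- The open subscheme of a `k`-scheme. -/
def restr (S : Over (Spec (CommRingCat.of k))) (O : S.left.Opens) :
    Over (Spec (CommRingCat.of k)) := Over.mk (O.ι ≫ S.hom)

/-- The inclusion of an open subscheme. -/
def restrι (S : Over (Spec (CommRingCat.of k))) (O : S.left.Opens) : restr S O ⟶ S :=
  Over.homMk O.ι rfl

instance (S : Over (Spec (CommRingCat.of k))) (O : S.left.Opens) :
    IsOpenImmersion (restrι S O).left :=
  inferInstanceAs (IsOpenImmersion O.ι)

instance (S : Over (Spec (CommRingCat.of k))) (O : S.left.Opens) : Mono (restrι S O) :=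
  have : Mono (restrι S O).left := inferInstance
  Over.mono_of_mono_left _

theorem range_restrι (S : Over (Spec (CommRingCat.of k))) (O : S.left.Opens) :
    Set.range (restrι S O).left = O :=
  O.range_ι

theorem restr_hom_apply_mem (O : S.left.Opens) (x : (restr S O).left) :
    (restrι S O).left x ∈ O := by
  change _ ∈ (O : Set S.left)
  rw [← range_restrι]
  exact ⟨x, rfl⟩

/-- A morphism whose image lies in an open subset factors through the open subscheme. -/
theorem exists_lift_restr (f : Y ⟶ S) (O : S.left.Opens) (h : ∀ y, f.left y ∈ O) :
    ∃ g : Y ⟶ restr S O, g ≫ restrι S O = f := by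
  obtain ⟨g, hl⟩ := exists_lift_opens f.left O h
  exact ⟨Over.homMk g
    (by exact (Category.assoc _ _ _).symm.trans ((congr($hl ≫ S.hom)).trans (Over.w f))),
    Over.OverMorphism.ext hl⟩

/-- Every point has an affine open neighbourhood in a given open neighbourhood. -/
theorem exists_affine_nhd (S : Over (Spec (CommRingCat.of k))) (x : S.left) (O : S.left.Opens)
    (hx : x ∈ O) : ∃ (B : Type u) (_ : CommRing B) (_ : Algebra k B) (j : specOver k B ⟶ S),
      IsOpenImmersion j.left ∧ x ∈ Set.range j.left ∧ ∀ y, j.left y ∈ O := by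
  obtain ⟨W, hW, hxW, hWO⟩ := (TopologicalSpace.Opens.isBasis_iff_nbhd.mp S.left.isBasis_affineOpens) hx
  obtain ⟨g, hg⟩ := Spec.map_surjective (R := CommRingCat.of k) (S := Γ(S.left, W))
    (hW.fromSpec ≫ S.hom)
  let _ : Algebra k Γ(S.left, W) := g.hom.toAlgebra
  have hr : Set.range hW.fromSpec = (W : Set S.left) := hW.range_fromSpec
  refine ⟨Γ(S.left, W), inferInstance, inferInstance, Over.homMk hW.fromSpec ?_, ?_, ?_, ?_⟩
  · exact hg.symm
  · have : IsOpenImmersion hW.fromSpec := hW.isOpenImmersion_fromSpec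
    exact this
  · change x ∈ Set.range hW.fromSpec
    rw [hr]; exact hxW
  · intro y
    apply hWO
    change _ ∈ (W : Set S.left)
    rw [← hr]
    exact ⟨y, rfl⟩

end Local

/-! ### Locality on the base for families of closed subschemes. -/

namespace RelScheme

variable {k : Type u} [Field k] {N n : ℕ} {S S' : Over (Spec (CommRingCat.of k))}

/-- Both composites are identities by `IsClosedSubscheme.hom_ext`, so compatibility with the
structure maps is all that has to be checked. -/
theorem isPullbackAlong_id_of_iso {Z₁ Z₂ : RelScheme k N n S} (h₁ : Z₁.IsClosedSubscheme)
    (h₂ : Z₂.IsClosedSubscheme) (f : Z₁.Z ⟶ Z₂.Z) (g : Z₂.Z ⟶ Z₁.Z)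
    (hf : f ≫ Z₂.toBase = Z₁.toBase) (hf' : f ≫ Z₂.toTrunc = Z₁.toTrunc)
    (hg : g ≫ Z₁.toBase = Z₂.toBase) (hg' : g ≫ Z₁.toTrunc = Z₂.toTrunc) :
    Z₁.IsPullbackAlong Z₂ (𝟙 S) := by
  have : IsIso f := ⟨g, h₁.hom_ext (by simp [hf, hg]) (by simp [hf', hg']),
    h₂.hom_ext (by simp [hf, hg]) (by simp [hf', hg'])⟩
  exact ⟨f, IsPullback.of_horiz_isIso ⟨by simp [hf]⟩, hf'⟩

theorem exists_hom_of_local {Z₁ Z₂ : RelScheme k N n S}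
    (h₂ : Z₂.IsClosedSubscheme)
    (h : ∀ x : S.left, ∃ (V : Over (Spec (CommRingCat.of k))) (j : V ⟶ S),
      IsOpenImmersion j.left ∧ x ∈ Set.range j.left ∧ (Z₁.pb j).IsPullbackAlong Z₂ j) :
    ∃ f : Z₁.Z ⟶ Z₂.Z, f ≫ Z₂.toBase = Z₁.toBase ∧ f ≫ Z₂.toTrunc = Z₁.toTrunc := by
  obtain ⟨f, hf⟩ := CurveModuli.exists_hom_of_local (S := Z₁.Z) (Y := Z₂.Z)
    (fun j g => g ≫ Z₂.toBase = j ≫ Z₁.toBase ∧ g ≫ Z₂.toTrunc = j ≫ Z₁.toTrunc)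
    (fun i j f ⟨ha, hb⟩ => by simp [ha, hb])
    (fun j f f' ⟨ha, hb⟩ ⟨ha', hb'⟩ => h₂.hom_ext (by rw [ha, ha']) (by rw [hb, hb']))
    (fun z => by
      obtain ⟨V, j, hj, hx, g, hg, hg'⟩ := h (Z₁.toBase.left z)
      have hp := Z₁.isPullback_pb j
      have hl := isPullback_left hp
      refine ⟨(Z₁.pb j).Z, Z₁.pbFst j, ?_, ?_, g, hg.w.trans hp.w.symm, hg'⟩
      · exact MorphismProperty.of_isPullback (P := @IsOpenImmersion) hl.flip hj
      · obtain ⟨v, hv⟩ := hx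
        obtain ⟨y, hy, -⟩ := Scheme.exists_preimage_of_isPullback hl z v hv.symm
        exact ⟨y, hy⟩)
  refine ⟨f, hom_ext_of_local fun x => ?_, hom_ext_of_local fun x => ?_⟩
  · obtain ⟨V, j, hj, hx, h1, h2⟩ := hf x
    exact ⟨V, j, hj, hx, by rw [← h1]; simp⟩
  · obtain ⟨V, j, hj, hx, h1, h2⟩ := hf x
    exact ⟨V, j, hj, hx, by rw [← h2]; simp⟩

/-- For closed subschemes, being the pullback is local on the base. -/
theorem isPullbackAlong_of_local {Z' : RelScheme k N n S'} {Z : RelScheme k N n S} {f : S' ⟶ S}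
    (h' : Z'.IsClosedSubscheme) (hZ : Z.IsClosedSubscheme)
    (h : ∀ x : S'.left, ∃ (V : Over (Spec (CommRingCat.of k))) (j : V ⟶ S'),
      IsOpenImmersion j.left ∧ x ∈ Set.range j.left ∧ (Z'.pb j).IsPullbackAlong Z (j ≫ f)) :
    Z'.IsPullbackAlong Z f := by
  have h1 := (Z.isPullbackAlong_pb f).isClosedSubscheme hZ
  have key : ∀ x : S'.left, ∃ (V : Over (Spec (CommRingCat.of k))) (j : V ⟶ S'),
      IsOpenImmersion j.left ∧ x ∈ Set.range j.left ∧ (Z'.pb j).IsPullbackAlong (Z.pb f) j := by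
    intro x
    obtain ⟨V, j, hj, hx, hp⟩ := h x
    exact ⟨V, j, hj, hx, hp.of_comp (Z.isPullbackAlong_pb f)⟩
  -- The local identifications are isomorphisms, so they can be reversed; this provides the inverse
  -- of the glued morphism.
  have key' : ∀ x : S'.left, ∃ (V : Over (Spec (CommRingCat.of k))) (j : V ⟶ S'),
      IsOpenImmersion j.left ∧ x ∈ Set.range j.left ∧ ((Z.pb f).pb j).IsPullbackAlong Z' j := by
    intro x
    obtain ⟨V, j, hj, hx, hp⟩ := key x
    refine ⟨V, j, hj, hx, ?_⟩
    have := ((Z.pb f).isPullbackAlong_pb j).unique hp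
    simpa using this.comp (Z'.isPullbackAlong_pb j)
  obtain ⟨a, ha, ha'⟩ := exists_hom_of_local h1 key
  obtain ⟨b, hb, hb'⟩ := exists_hom_of_local h' key'
  simpa using (isPullbackAlong_id_of_iso h' h1 a b ha ha' hb hb').comp (Z.isPullbackAlong_pb f)

theorem isFlatOfLength_of_local {Z : RelScheme k N n S} {d : ℤ}
    (h : ∀ x : S.left, ∃ (V : Over (Spec (CommRingCat.of k))) (j : V ⟶ S),
      IsOpenImmersion j.left ∧ x ∈ Set.range j.left ∧ (Z.pb j).IsFlatOfLength d) :
    Z.IsFlatOfLength d := by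
  choose V j hj hx hd using h
  have hp := fun x => isPullback_left (Z.isPullback_pb (j x))
  have h1 : IsFinite Z.toBase.left :=
    have := isFinite_isZariskiLocalAtTarget.{u}
    of_isPullback_of_cover @IsFinite _ _ hj (fun x => ⟨x, hx x⟩) hp fun x => (hd x).1
  have h2 : Flat Z.toBase.left :=
    have := flat_isZariskiLocalAtTarget.{u}
    of_isPullback_of_cover @Flat _ _ hj (fun x => ⟨x, hx x⟩) hp fun x => (hd x).2.1
  refine ⟨h1, h2, fun x => ?_⟩
  obtain ⟨y, hy⟩ := hx x
  rw [← hy, ← Scheme.Hom.finrank_of_isPullback _ _ _ _ (hp x), (hd x).2.2]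

theorem isClosedSubscheme_of_local {Z : RelScheme k N n S}
    (h : ∀ x : S.left, ∃ (V : Over (Spec (CommRingCat.of k))) (j : V ⟶ S),
      IsOpenImmersion j.left ∧ x ∈ Set.range j.left ∧ (Z.pb j).IsClosedSubscheme) :
    Z.IsClosedSubscheme := by
  choose V j hj hx hd using h
  have hq := fun x => IsPullbackAlong.isPullback_toProd (Z.isPullback_pb (j x))
    (Z.pbFst_toTrunc (j x))
  refine of_isPullback_of_cover @IsClosedImmersion Z.toProd
    (fun x => RelScheme.prodMap k N n (j x)) (fun x => ?_) (fun y => ?_) hq hd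
  · exact MorphismProperty.of_isPullback (P := @IsOpenImmersion)
      (isPullback_prodMap (j x)).flip (hj x)
  · obtain ⟨v, hv⟩ := hx ((pullback.fst S.hom (specOver k (TruncRing k N n)).hom) y)
    obtain ⟨w, hw, -⟩ := Scheme.exists_preimage_of_isPullback
      (isPullback_prodMap (j _)) y v hv.symm
    exact ⟨_, w, hw⟩

end RelScheme

/-! ### Families over affine bases as algebras. -/

section

open TensorProduct

namespace RelScheme

variable {k : Type u} [Field k] {N n : ℕ} {B Q : Type u} [CommRing B] [Algebra k B]
  [CommRing Q] [Algebra k Q] [Algebra B Q] [IsScalarTower k B Q]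

/-- The spectrum of a `B`-algebra `Q`, with the morphism to `Spec R_n` given by `g`. -/
abbrev ofAlg (B : Type u) [CommRing B] [Algebra k B] [Algebra B Q] [IsScalarTower k B Q]
    (g : TruncRing k N n →ₐ[k] Q) : RelScheme k N n (specOver k B) where
  Z := specOver k Q
  toBase := specOverMap (IsScalarTower.toAlgHom k B Q)
  toTrunc := specOverMap g

theorem isPullback_specOverMap_of_isPushout {A₀ A₁ A₂ A₃ : Type u} [CommRing A₀] [CommRing A₁]
    [CommRing A₂] [CommRing A₃] [Algebra k A₀] [Algebra k A₁] [Algebra k A₂] [Algebra k A₃]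
    {f₁ : A₀ →ₐ[k] A₁} {f₂ : A₀ →ₐ[k] A₂} {g₁ : A₁ →ₐ[k] A₃} {g₂ : A₂ →ₐ[k] A₃}
    (h : IsPushout (CommRingCat.ofHom f₁.toRingHom) (CommRingCat.ofHom f₂.toRingHom)
      (CommRingCat.ofHom g₁.toRingHom) (CommRingCat.ofHom g₂.toRingHom)) :
    IsPullback (specOverMap g₁) (specOverMap g₂) (specOverMap f₁) (specOverMap f₂) :=
  isPullback_of_left (isPullback_SpecMap_of_isPushout _ _ _ _ h)

/-- The structure map to `Spec R_n` of the base change. -/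
def baseChangeHom (B' : Type u) [CommRing B'] [Algebra k B'] [Algebra B B'] [IsScalarTower k B B']
    (g : TruncRing k N n →ₐ[k] Q) : TruncRing k N n →ₐ[k] B' ⊗[B] Q :=
  ((Algebra.TensorProduct.includeRight : Q →ₐ[B] B' ⊗[B] Q).restrictScalars k).comp g

theorem baseChangeHom_apply (B' : Type u) [CommRing B'] [Algebra k B'] [Algebra B B']
    [IsScalarTower k B B'] (g : TruncRing k N n →ₐ[k] Q) (r) :
    baseChangeHom (B := B) B' g r = 1 ⊗ₜ g r := rfl

theorem ofAlg_baseChange (B' : Type u) [CommRing B'] [Algebra k B'] [Algebra B B']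
    [IsScalarTower k B B'] (g : TruncRing k N n →ₐ[k] Q) :
    (ofAlg B' (baseChangeHom (B := B) B' g)).IsPullbackAlong (ofAlg B g)
      (specOverMap (IsScalarTower.toAlgHom k B B')) := by
  refine ⟨specOverMap ((Algebra.TensorProduct.includeRight :
    Q →ₐ[B] B' ⊗[B] Q).restrictScalars k), ?_, specOverMap_comp _ _⟩
  exact isPullback_specOverMap_of_isPushout (CommRingCat.isPushout_tensorProduct B B' Q).flip

theorem ofAlg_isPullbackAlong_of_algEquiv {Q' : Type u} [CommRing Q'] [Algebra k Q']
    [Algebra B Q'] [IsScalarTower k B Q'] {g : TruncRing k N n →ₐ[k] Q}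
    {g' : TruncRing k N n →ₐ[k] Q'} (e : Q ≃ₐ[B] Q') (he : ∀ r, e (g r) = g' r) :
    (ofAlg B g').IsPullbackAlong (ofAlg B g) (𝟙 _) := by
  have h1 : specOverMap (e.toAlgHom.restrictScalars k) ≫
      specOverMap (e.symm.toAlgHom.restrictScalars k) = 𝟙 _ := by
    rw [specOverMap_comp, ← specOverMap_id]; congr 1; ext x; simp
  have h2 : specOverMap (e.symm.toAlgHom.restrictScalars k) ≫
      specOverMap (e.toAlgHom.restrictScalars k) = 𝟙 _ := by
    rw [specOverMap_comp, ← specOverMap_id]; congr 1; ext x; simp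
  have : IsIso (specOverMap (e.toAlgHom.restrictScalars k)) := ⟨_, h1, h2⟩
  refine ⟨specOverMap (e.toAlgHom.restrictScalars k), IsPullback.of_horiz_isIso ⟨?_⟩, ?_⟩
  · rw [Category.comp_id]
    refine (specOverMap_comp _ _).trans ?_
    change _ = specOverMap _
    congr 1; ext x; simp
  · refine (specOverMap_comp _ _).trans ?_
    change _ = specOverMap _
    congr 1; ext x; simp [he]

theorem exists_algHom_of_isPullbackAlong {B' Q' : Type u} [CommRing B'] [Algebra k B']
    [CommRing Q'] [Algebra k Q']
    [Algebra B' Q'] [IsScalarTower k B' Q'] {g : TruncRing k N n →ₐ[k] Q}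
    {g' : TruncRing k N n →ₐ[k] Q'} {ψ : B →ₐ[k] B'}
    (h : (ofAlg B' g').IsPullbackAlong (ofAlg B g) (specOverMap ψ)) :
    ∃ e : Q →ₐ[k] Q', (∀ b, e (algebraMap B Q b) = algebraMap B' Q' (ψ b)) ∧
      ∀ r, e (g r) = g' r := by
  obtain ⟨c, hc, hc'⟩ := h
  obtain ⟨e, rfl⟩ := specOverMap_surjective c
  refine ⟨e, fun b => ?_, fun r => ?_⟩
  · have := specOverMap_injective (((specOverMap_comp _ _).symm.trans hc.w).trans
      (specOverMap_comp _ _))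
    exact congr($this b)
  · have := specOverMap_injective ((specOverMap_comp _ _).symm.trans hc')
    exact congr($this r)

/-- Isomorphic families over `Spec B` come from isomorphic algebras. -/
theorem exists_algEquiv_of_isPullbackAlong {Q' : Type u} [CommRing Q'] [Algebra k Q']
    [Algebra B Q'] [IsScalarTower k B Q'] {g : TruncRing k N n →ₐ[k] Q}
    {g' : TruncRing k N n →ₐ[k] Q'} (h : (ofAlg B g').IsPullbackAlong (ofAlg B g) (𝟙 _)) :
    ∃ e : Q ≃ₐ[B] Q', ∀ r, e (g r) = g' r := by
  obtain ⟨c, hc, hc'⟩ := h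
  have : IsIso c := hc.isIso_fst_of_isIso
  obtain ⟨e, he⟩ := specOverMap_surjective c
  obtain ⟨d, hd⟩ := specOverMap_surjective (inv c)
  have h1 : d.comp e = AlgHom.id k _ := by
    apply specOverMap_injective
    rw [← specOverMap_comp, hd, he, specOverMap_id]; exact IsIso.inv_hom_id c
  have h2 : e.comp d = AlgHom.id k _ := by
    apply specOverMap_injective
    rw [← specOverMap_comp, hd, he, specOverMap_id]; exact IsIso.hom_inv_id c
  have h3 : e.comp (IsScalarTower.toAlgHom k B Q) = IsScalarTower.toAlgHom k B Q' := by
    apply specOverMap_injective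
    rw [← specOverMap_comp, he]
    exact hc.w.trans (Category.comp_id _)
  have h4 : e.comp g = g' := by
    apply specOverMap_injective
    rw [← specOverMap_comp, he]; exact hc'
  refine ⟨AlgEquiv.ofAlgHom ⟨e.toRingHom, fun b => congr($h3 b)⟩
    ⟨d.toRingHom, fun b => ?_⟩ ?_ ?_, fun r => congr($h4 r)⟩
  · have h5 : e (algebraMap B Q b) = algebraMap B Q' b := congr($h3 b)
    change d (algebraMap B Q' b) = _
    rw [← h5]; exact congr($h1 _)
  · ext x; exact congr($h2 x)
  · ext x; exact congr($h1 x)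

/-- The product of two affine `k`-schemes is affine. -/
def prodSpecIso (k : Type u) [Field k] (B C : Type u) [CommRing B] [Algebra k B] [CommRing C]
    [Algebra k C] :
    pullback (specOver k B).hom (specOver k C).hom ≅ (specOver k (B ⊗[k] C)).left :=
  pullbackSpecIso k B C

theorem prodSpecIso_inv_fst (C : Type u) [CommRing C] [Algebra k C] :
    (prodSpecIso k B C).inv ≫ pullback.fst _ _ =
      (specOverMap (Algebra.TensorProduct.includeLeft : B →ₐ[k] B ⊗[k] C)).left :=
  pullbackSpecIso_inv_fst k B C

theorem prodSpecIso_inv_snd (C : Type u) [CommRing C] [Algebra k C] :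
    (prodSpecIso k B C).inv ≫ pullback.snd _ _ =
      (specOverMap (Algebra.TensorProduct.includeRight : C →ₐ[k] B ⊗[k] C)).left :=
  pullbackSpecIso_inv_snd k B C

/-- The morphism of a family given by an algebra to `Spec (B ⊗ R_n)`. -/
theorem toProd_ofAlg (g : TruncRing k N n →ₐ[k] Q) :
    (ofAlg B g).toProd = (specOverMap (Algebra.TensorProduct.lift (IsScalarTower.toAlgHom k B Q) g
      (fun _ _ => Commute.all _ _))).left ≫ (prodSpecIso k B (TruncRing k N n)).inv := by
  apply pullback.hom_ext
  · rw [toProd_fst, Category.assoc, prodSpecIso_inv_fst, ← Over.comp_left, specOverMap_comp]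
    congr 2
    ext; simp
  · rw [toProd_snd, Category.assoc, prodSpecIso_inv_snd, ← Over.comp_left, specOverMap_comp]
    congr 2
    ext; simp

/-- The image of B ⊗ R_n is the `B`-span of the image of R_n. Closedness of a family is used below
in the form of this spanning condition. -/
theorem lift_surjective_iff (g : TruncRing k N n →ₐ[k] Q) :
    Function.Surjective (Algebra.TensorProduct.lift (IsScalarTower.toAlgHom k B Q) g
      (fun _ _ => Commute.all _ _)) ↔ Submodule.span B (Set.range g) = ⊤ := by
  rw [eq_top_iff]
  constructor
  · intro h x _
    obtain ⟨y, rfl⟩ := h x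
    induction y with
    | zero => simp
    | add a b ha hb => rw [map_add]; exact add_mem (ha trivial) (hb trivial)
    | tmul b r =>
      simp only [Algebra.TensorProduct.lift_tmul, IsScalarTower.coe_toAlgHom']
      rw [← Algebra.smul_def]
      exact Submodule.smul_mem _ _ (Submodule.subset_span ⟨r, rfl⟩)
  · intro h x
    refine Submodule.span_induction (p := fun x _ => ∃ y, Algebra.TensorProduct.lift
      (IsScalarTower.toAlgHom k B Q) g (fun _ _ => Commute.all _ _) y = x)
      ?_ ?_ ?_ ?_ (h (Submodule.mem_top : x ∈ ⊤))
    · rintro _ ⟨r, rfl⟩; exact ⟨1 ⊗ₜ r, by simp⟩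
    · exact ⟨0, by simp⟩
    · rintro _ _ _ _ ⟨a, rfl⟩ ⟨b, rfl⟩; exact ⟨a + b, by simp⟩
    · rintro b _ _ ⟨a, rfl⟩
      exact ⟨(b ⊗ₜ 1) * a, by simp [Algebra.smul_def]⟩

theorem isClosedSubscheme_ofAlg {g : TruncRing k N n →ₐ[k] Q}
    (h : Submodule.span B (Set.range g) = ⊤) : (ofAlg B g).IsClosedSubscheme := by
  change IsClosedImmersion (ofAlg B g).toProd
  rw [toProd_ofAlg, MorphismProperty.cancel_right_of_respectsIso @IsClosedImmersion]
  exact IsClosedImmersion.spec_of_surjective _ ((lift_surjective_iff g).2 h)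

theorem isClosedImmersion_iff_specOver {C : Type u} [CommRing C] [Algebra k C]
    {X : Over (Spec (CommRingCat.of k))} (f : X ⟶ specOver k C) [IsClosedImmersion f.left] :
    ∃ (I : Ideal C) (c : specOver k (C ⧸ I) ⟶ X), IsIso c ∧
      c ≫ f = specOverMap (Ideal.Quotient.mkₐ k I) := by
  obtain ⟨I, e, he⟩ := (IsClosedImmersion.Spec_iff (R := CommRingCat.of C) (f := f.left)).1 ‹_›
  have h1 : e.inv ≫ f.left = Spec.map (CommRingCat.ofHom (Ideal.Quotient.mk I)) :=
    (Iso.inv_comp_eq e).2 he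
  let c : specOver k (C ⧸ I) ⟶ X := Over.homMk e.inv (by
    rw [← Over.w f]
    exact ((Category.assoc _ _ _).symm.trans congr($h1 ≫ _)).trans
      (Over.w (specOverMap (Ideal.Quotient.mkₐ k I))))
  have : IsIso ((Over.forget _).map c) := inferInstanceAs (IsIso e.inv)
  exact ⟨I, c, isIso_of_reflects_iso c (Over.forget _), by ext1; exact h1⟩

/-- A closed subscheme of `Spec B × Spec R_n` is given by an algebra. -/
theorem IsClosedSubscheme.exists_ofAlg {Z : RelScheme k N n (specOver k B)}
    (hZ : Z.IsClosedSubscheme) :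
    ∃ (Q : Type u) (_ : CommRing Q) (_ : Algebra k Q) (_ : Algebra B Q) (_ : IsScalarTower k B Q)
      (g : TruncRing k N n →ₐ[k] Q), Submodule.span B (Set.range g) = ⊤ ∧
        (ofAlg B g).IsPullbackAlong Z (𝟙 _) := by
  have h1 : IsClosedImmersion (Z.toProd ≫ (prodSpecIso k B (TruncRing k N n)).hom) :=
    (MorphismProperty.cancel_right_of_respectsIso @IsClosedImmersion _ _).2 hZ
  have h2 : (specOver k (B ⊗[k] TruncRing k N n)).hom =
      (prodSpecIso k B (TruncRing k N n)).inv ≫ pullback.fst _ _ ≫ (specOver k B).hom := by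
    rw [← Category.assoc, prodSpecIso_inv_fst]
    exact (Over.w _).symm
  let f : Z.Z ⟶ specOver k (B ⊗[k] TruncRing k N n) := Over.homMk
    (Z.toProd ≫ (prodSpecIso k B (TruncRing k N n)).hom) (by
      rw [h2, Category.assoc, Iso.hom_inv_id_assoc, toProd_fst_assoc]
      exact Over.w _)
  have hf1 : f ≫ specOverMap Algebra.TensorProduct.includeLeft = Z.toBase := by
    ext1
    rw [Over.comp_left, ← prodSpecIso_inv_fst, ← toProd_fst]
    simp [f]
  have hf2 : f ≫ specOverMap Algebra.TensorProduct.includeRight = Z.toTrunc := by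
    ext1
    rw [Over.comp_left, ← prodSpecIso_inv_snd, ← toProd_snd]
    simp [f]
  have : IsClosedImmersion f.left := h1
  obtain ⟨I, c, hc, he⟩ := isClosedImmersion_iff_specOver f
  let g : TruncRing k N n →ₐ[k] (B ⊗[k] TruncRing k N n) ⧸ I :=
    (Ideal.Quotient.mkₐ k I).comp Algebra.TensorProduct.includeRight
  have hg : (Algebra.TensorProduct.lift (IsScalarTower.toAlgHom k B _) g
      (fun _ _ => Commute.all _ _)) = Ideal.Quotient.mkₐ k I := by
    ext x <;> simp [g]; rfl
  have hs : Function.Surjective (Algebra.TensorProduct.lift (IsScalarTower.toAlgHom k B _) g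
      (fun _ _ => Commute.all _ _)) := by
    rw [hg]; exact Ideal.Quotient.mkₐ_surjective _ _
  refine ⟨(B ⊗[k] TruncRing k N n) ⧸ I, inferInstance, inferInstance, inferInstance,
    inferInstance, g, (lift_surjective_iff g).1 hs, ?_⟩
  have : IsIso (C := Over (Spec (CommRingCat.of k))) (X := (ofAlg B g).Z) c := hc
  refine ⟨c, IsPullback.of_horiz_isIso ⟨?_⟩, ?_⟩
  · rw [Category.comp_id, ← hf1, reassoc_of% he, specOverMap_comp]
    rfl
  · rw [← hf2, reassoc_of% he, specOverMap_comp]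

end RelScheme

end

/-! ### Span loci on spectra of rings, and truncation of algebras. -/

section

open TensorProduct

section SpanLocus

/-- The support of a finite module is read off from its tensor products with residue fields, and an
extension of residue fields is faithfully flat, so it does not affect their vanishing. -/
theorem support_baseChange {B M : Type*} (B' : Type*) [CommRing B] [CommRing B'] [Algebra B B']
    [AddCommGroup M] [Module B M] [Module.Finite B M] :
    Module.support B' (B' ⊗[B] M) =
      PrimeSpectrum.comap (algebraMap B B') ⁻¹' Module.support B M := by
  ext y
  rw [Set.mem_preimage, Module.mem_support_iff_nontrivial_residueField_tensorProduct,
    Module.mem_support_iff_nontrivial_residueField_tensorProduct]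
  set p := PrimeSpectrum.comap (algebraMap B B') y with hp
  have hpy : p.asIdeal = Ideal.comap (algebraMap B B') y.asIdeal := rfl
  let φ : p.asIdeal.ResidueField →+* y.asIdeal.ResidueField :=
    Ideal.ResidueField.map p.asIdeal y.asIdeal (algebraMap B B') hpy
  algebraize [φ]
  have : IsScalarTower B p.asIdeal.ResidueField y.asIdeal.ResidueField :=
    IsScalarTower.of_algebraMap_eq' (by
      ext x
      rw [RingHom.comp_apply, RingHom.algebraMap_toAlgebra]
      simp only [φ]
      rw [Ideal.ResidueField.map_algebraMap, ← IsScalarTower.algebraMap_apply])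
  rw [(AlgebraTensorModule.cancelBaseChange B B' B' y.asIdeal.ResidueField M).nontrivial_congr,
    ← (AlgebraTensorModule.cancelBaseChange B p.asIdeal.ResidueField p.asIdeal.ResidueField
      y.asIdeal.ResidueField M).nontrivial_congr,
    Module.FaithfullyFlat.nontrivial_tensorProduct_iff_right]

variable {B Q : Type*} [CommRing B] [AddCommGroup Q] [Module B Q]

/-- The points at which `s` spans the fibre of the module `Q`. -/
def spanLocus (B : Type*) {Q : Type*} [CommRing B] [AddCommGroup Q] [Module B Q] (s : Set Q) :
    Set (PrimeSpectrum B) :=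
  (Module.support B (Q ⧸ Submodule.span B s))ᶜ

theorem isOpen_spanLocus [Module.Finite B Q] (s : Set Q) : IsOpen (spanLocus B s) :=
  Module.isClosed_support.isOpen_compl

theorem spanLocus_eq_univ_iff {s : Set Q} :
    spanLocus B s = Set.univ ↔ Submodule.span B s = ⊤ := by
  rw [spanLocus, Set.compl_univ_iff, Module.support_eq_empty_iff,
    Submodule.Quotient.subsingleton_iff]

theorem spanLocus_mono {s t : Set Q} (h : s ⊆ Submodule.span B t) :
    spanLocus B s ⊆ spanLocus B t := by
  apply Set.compl_subset_compl.2
  exact Module.support_subset_of_surjective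
    (Submodule.factor (Submodule.span_le.2 h)) (Submodule.factor_surjective _)

theorem mem_spanLocus_iff_span {K : Type*} [Field K] {Q : Type*} [AddCommGroup Q] [Module K Q]
    {s : Set Q} (y : PrimeSpectrum K) : y ∈ spanLocus K s ↔ Submodule.span K s = ⊤ := by
  rw [← spanLocus_eq_univ_iff, Set.eq_univ_iff_forall]
  exact ⟨fun h x => by rwa [Subsingleton.elim x y], fun h => h y⟩

/-- Tensor products are right exact, so the quotient by the span commutes with base change, and
`support_baseChange` applies to that quotient. -/
theorem preimage_spanLocus (B' : Type*) [CommRing B'] [Algebra B B'] [Module.Finite B Q]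
    (s : Set Q) : spanLocus B' ((fun x : Q => (1 : B') ⊗ₜ[B] x) '' s) =
      PrimeSpectrum.comap (algebraMap B B') ⁻¹' spanLocus B s := by
  rw [spanLocus, spanLocus, Set.preimage_compl, ← support_baseChange]
  congr 1
  refine (LinearEquiv.support_eq ((AlgebraTensorModule.tensorQuotientEquiv B' B B'
    (Submodule.span B s)).trans (Submodule.quotEquivOfEq _ _ ?_))).symm
  exact Submodule.baseChange_span B' s

theorem spanLocus_image_equiv {Q' : Type*} [AddCommGroup Q'] [Module B Q'] (e : Q ≃ₗ[B] Q')
    (s : Set Q) : spanLocus B (e '' s) = spanLocus B s := by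
  rw [spanLocus, spanLocus]
  congr 1
  refine (LinearEquiv.support_eq (Submodule.Quotient.equiv _ _ e ?_)).symm
  exact Submodule.map_span e.toLinearMap s

end SpanLocus

namespace RelScheme

variable {k : Type u} [Field k] {N n : ℕ} {B Q : Type u} [CommRing B] [Algebra k B]
  [CommRing Q] [Algebra k Q] [Algebra B Q] [IsScalarTower k B Q]

theorem isFlatOfLength_ofAlg_iff {g : TruncRing k N n →ₐ[k] Q} {d : ℤ} :
    (ofAlg B g).IsFlatOfLength d ↔ Module.Finite B Q ∧ Module.Flat B Q ∧
      ∀ p : PrimeSpectrum B, (Module.rankAtStalk Q p : ℤ) = d := by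
  have h1 : IsFinite (ofAlg B g).toBase.left ↔ Module.Finite B Q := by
    rw [← RingHom.finite_algebraMap]
    exact IsFinite.SpecMap_iff (CommRingCat.ofHom (algebraMap B Q))
  have h2 : Flat (ofAlg B g).toBase.left ↔ Module.Flat B Q := by
    rw [← RingHom.flat_algebraMap_iff]
    exact Flat.SpecMap_iff (f := CommRingCat.ofHom (algebraMap B Q))
  rw [IsFlatOfLength, h1, h2]
  refine and_congr_right fun _ => and_congr_right fun _ => forall_congr' fun p => ?_
  rw [← Scheme.Hom.finrank_SpecMap_algebraMap B Q p]
  rfl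

/-- The ideal `M ^ t` of `R_n`. -/
def powIdeal (k : Type u) [Field k] (N n t : ℕ) : Ideal (TruncRing k N n) :=
  (varIdeal N k ^ t).map (Ideal.Quotient.mk _)

theorem ker_factorₐ {t n : ℕ} (ht : t ≤ n) :
    RingHom.ker (Ideal.Quotient.factorₐ k (Ideal.pow_le_pow_right ht :
      varIdeal N k ^ n ≤ varIdeal N k ^ t)) = powIdeal k N n t := by
  ext x
  obtain ⟨x, rfl⟩ := Ideal.Quotient.mk_surjective x
  have h1 : Ideal.Quotient.factorₐ k (Ideal.pow_le_pow_right ht : varIdeal N k ^ n ≤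
      varIdeal N k ^ t) (Ideal.Quotient.mk _ x) = Ideal.Quotient.mk _ x := rfl
  rw [RingHom.mem_ker, h1, Ideal.Quotient.eq_zero_iff_mem, powIdeal,
    Ideal.mem_quotient_iff_mem_sup, sup_eq_left.2 (Ideal.pow_le_pow_right ht)]

/-- This is A/I ⊗_A Q = Q/IQ, for arbitrary surjections instead of literal quotients, so that it
serves both for truncation modulo a power of M and for the fibre at a k-point of the base. -/
theorem isPushout_of_ker_eq {A A' Q Q' : Type u} [CommRing A] [CommRing A'] [CommRing Q]
    [CommRing Q'] (f : A →+* A') (hf : Function.Surjective f) (g : A →+* Q) (c : Q →+* Q')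
    (hc : Function.Surjective c) (hI : RingHom.ker c = (RingHom.ker f).map g) (g' : A' →+* Q')
    (h : ∀ a, g' (f a) = c (g a)) :
    IsPushout (CommRingCat.ofHom g) (CommRingCat.ofHom f)
      (CommRingCat.ofHom c) (CommRingCat.ofHom g') := by
  have hw : ∀ (s : PushoutCocone (CommRingCat.ofHom g) (CommRingCat.ofHom f)) (a : A),
      s.inl.hom (g a) = s.inr.hom (f a) := fun s a => congr($(s.condition).hom a)
  have key : ∀ s : PushoutCocone (CommRingCat.ofHom g) (CommRingCat.ofHom f),
      RingHom.ker c ≤ RingHom.ker s.inl.hom := fun s => by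
    rw [hI, Ideal.map_le_iff_le_comap]
    intro a ha
    rw [Ideal.mem_comap, RingHom.mem_ker, hw, (RingHom.mem_ker).1 ha, map_zero]
  have hl : ∀ (s : PushoutCocone (CommRingCat.ofHom g) (CommRingCat.ofHom f)) (x : Q),
      c.liftOfSurjective hc ⟨s.inl.hom, key s⟩ (c x) = s.inl.hom x := fun s x =>
    RingHom.liftOfRightInverse_comp_apply c _ _ ⟨s.inl.hom, key s⟩ x
  refine ⟨⟨by ext a; exact (h a).symm⟩, ⟨PushoutCocone.IsColimit.mk _
    (fun s => CommRingCat.ofHom (c.liftOfSurjective hc ⟨s.inl.hom, key s⟩)) ?_ ?_ ?_⟩⟩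
  · intro s; ext a; exact hl s a
  · intro s; ext a
    obtain ⟨a, rfl⟩ := hf a
    refine Eq.trans ?_ (hw s a)
    refine Eq.trans ?_ (hl s (g a))
    simp only [CommRingCat.hom_comp, CommRingCat.hom_ofHom, RingHom.comp_apply, h]
  · intro s m h1 h2; ext a
    obtain ⟨a, rfl⟩ := hc a
    exact congr($(h1).hom a).trans (hl s a).symm

/-- The structure map of the truncation of a family given by an algebra. -/
def truncHom (g : TruncRing k N n →ₐ[k] Q) {t : ℕ} (ht : t ≤ n) :
    TruncRing k N t →ₐ[k] Q ⧸ (powIdeal k N n t).map g :=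
  Ideal.Quotient.liftₐ _ ((Ideal.Quotient.mkₐ k _).comp (g.comp (Ideal.Quotient.mkₐ k _)))
    fun _ ha => Ideal.Quotient.eq_zero_iff_mem.2
      (Ideal.mem_map_of_mem g (Ideal.mem_map_of_mem _ ha))

theorem ofAlg_trunc {S : Over (Spec (CommRingCat.of k))} {Z : RelScheme k N n S}
    {φ : specOver k B ⟶ S} {g : TruncRing k N n →ₐ[k] Q}
    (h : (ofAlg B g).IsPullbackAlong Z φ) {t : ℕ} (ht : t ≤ n) :
    (ofAlg B (truncHom g ht)).IsPullbackAlong (Z.trunc t ht) φ := by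
  have hY : (ofAlg B (truncHom g ht)).toBase =
      specOverMap (Ideal.Quotient.mkₐ k _) ≫ (ofAlg B g).toBase := by
    rw [specOverMap_comp]; rfl
  refine isPullbackAlong_trunc_of_isPullback h ht
    (p := specOverMap (Ideal.Quotient.mkₐ k _)) ?_ hY
  refine isPullback_specOverMap_of_isPushout (isPushout_of_ker_eq
    (Ideal.Quotient.factorₐ k (Ideal.pow_le_pow_right ht)).toRingHom
    (Ideal.Quotient.factor_surjective (Ideal.pow_le_pow_right ht)) g.toRingHom
    (Ideal.Quotient.mkₐ k ((powIdeal k N n t).map g)).toRingHom Ideal.Quotient.mk_surjective ?_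
    (truncHom g ht).toRingHom ?_)
  · rw [← ker_factorₐ ht]
    exact Ideal.mk_ker
  · intro a
    obtain ⟨a, rfl⟩ := Ideal.Quotient.mk_surjective a
    rfl

theorem span_range_truncHom {g : TruncRing k N n →ₐ[k] Q} (h : Submodule.span B (Set.range g) = ⊤)
    {t : ℕ} (ht : t ≤ n) : Submodule.span B (Set.range (truncHom g ht)) = ⊤ := by
  have := congr(Submodule.map (Ideal.Quotient.mkₐ B ((powIdeal k N n t).map g)).toLinearMap $h)
  rw [Submodule.map_span, Submodule.map_top, LinearMap.range_eq_top.2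
    (Ideal.Quotient.mkₐ_surjective B ((powIdeal k N n t).map g))] at this
  rw [eq_top_iff, ← this, Submodule.span_le]
  rintro _ ⟨_, ⟨r, rfl⟩, rfl⟩
  obtain ⟨r, rfl⟩ := Ideal.Quotient.mk_surjective r
  exact Submodule.subset_span ⟨Ideal.Quotient.mk _ r, rfl⟩

theorem span_range_baseChangeHom {g : TruncRing k N n →ₐ[k] Q}
    (h : Submodule.span B (Set.range g) = ⊤) (B' : Type u) [CommRing B'] [Algebra k B']
    [Algebra B B'] [IsScalarTower k B B'] :
    Submodule.span B' (Set.range (baseChangeHom (B := B) B' g)) = ⊤ := by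
  have := congr(Submodule.baseChange B' $h)
  rw [Submodule.baseChange_span, Submodule.baseChange_top, ← Set.range_comp] at this
  exact this

end RelScheme

/-! ### Powers of the ideal of variables. -/

section PowerSeries

variable {N : ℕ} {A : Type u} [CommRing A]

theorem monomial_mem_varIdeal_pow (m : Fin N →₀ ℕ) {n : ℕ} (h : n ≤ m.degree) (a : A) :
    (MvPowerSeries.monomial m a : PS N A) ∈ varIdeal N A ^ n := by
  have h1 : MvPolynomial.monomial m a ∈ MvPolynomial.idealOfVars (Fin N) A ^ n := by
    rw [MvPolynomial.mem_pow_idealOfVars_iff]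
    intro x hx
    rwa [Finset.mem_singleton.1 (MvPolynomial.support_monomial_subset hx)]
  have h2 := Ideal.mem_map_of_mem (MvPolynomial.coeToMvPowerSeries.ringHom (R := A)) h1
  rw [Ideal.map_pow] at h2
  have h3 : (MvPolynomial.idealOfVars (Fin N) A).map
      (MvPolynomial.coeToMvPowerSeries.ringHom (R := A)) ≤ varIdeal N A := by
    rw [MvPolynomial.idealOfVars, Ideal.map_span, varIdeal, ← Set.range_comp]
    apply Ideal.span_mono
    rintro _ ⟨i, rfl⟩
    exact ⟨i, by simp⟩
  simpa using Ideal.pow_right_mono h3 n h2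

/-- A product of n series without constant term has order at least n. Conversely, assigning to every
exponent of degree at least n one divisor `c b` of degree exactly n sorts the terms of `f` into
finitely many multiples of monomials of degree n. -/
theorem mem_varIdeal_pow_iff {n : ℕ} {f : PS N A} :
    f ∈ varIdeal N A ^ n ↔ ∀ m : Fin N →₀ ℕ, m.degree < n → MvPowerSeries.coeff m f = 0 := by
  constructor
  · intro h
    have : (n : ℕ∞) ≤ f.order := by
      induction n generalizing f with
      | zero => simp
      | succ n ih =>
        rw [pow_succ'] at h
        refine Submodule.mul_induction_on h ?_ fun a b ha hb =>
          le_trans (le_min ha hb) MvPowerSeries.min_order_le_add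
        intro a ha b hb
        refine le_trans ?_ MvPowerSeries.le_order_mul
        rw [Nat.cast_add, add_comm]
        refine add_le_add ?_ (ih hb)
        refine Submodule.span_induction ?_ ?_ ?_ ?_ ha
        · rintro _ ⟨i, rfl⟩
          refine MvPowerSeries.le_order fun d hd => ?_
          rw [MvPowerSeries.coeff_X, if_neg]
          rintro rfl
          simp at hd
        · simp
        · intro x y _ _ hx hy
          exact le_trans (le_min hx hy) MvPowerSeries.min_order_le_add
        · intro c x _ hx
          exact le_trans (hx.trans le_add_self) MvPowerSeries.le_order_mul
    intro m hm
    exact MvPowerSeries.coeff_of_lt_order (lt_of_lt_of_le (by exact_mod_cast hm) this)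
  · intro h
    classical
    have hc : ∀ b : Fin N →₀ ℕ, ∃ m, n ≤ b.degree → m ≤ b ∧ m.degree = n := fun b => by
      by_cases hb : n ≤ b.degree
      · obtain ⟨m, h1, h2⟩ := Finsupp.exists_le_degree_eq b n hb
        exact ⟨m, fun _ => ⟨h1, h2⟩⟩
      · exact ⟨0, fun h => absurd h hb⟩
    choose c hc using hc
    let g : (Fin N →₀ ℕ) → PS N A := fun m a => if c (a + m) = m then f.coeff (a + m) else 0
    have hg : ∀ m a, (g m).coeff a = if c (a + m) = m then f.coeff (a + m) else 0 :=
      fun _ _ => rfl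
    have hf : f = ∑ m ∈ (Finsupp.finite_of_degree_eq n).toFinset,
        MvPowerSeries.monomial m (1 : A) * g m := by
      ext b
      rw [map_sum]
      simp_rw [MvPowerSeries.coeff_monomial_mul, hg, one_mul]
      by_cases hb : n ≤ b.degree
      · rw [Finset.sum_eq_single (c b)]
        · rw [if_pos (hc b hb).1, tsub_add_cancel_of_le (hc b hb).1, if_pos rfl]
        · intro m _ hm
          split_ifs with h1 h2
          · rw [tsub_add_cancel_of_le h1] at h2; exact absurd h2.symm hm
          · rfl
          · rfl
        · intro h1; exact absurd (hc b hb).2 (by simpa using h1)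
      · rw [h b (not_le.1 hb), Finset.sum_eq_zero]
        intro m hm
        rw [if_neg]
        intro hmb
        have := Finsupp.degree_mono hmb
        have h2 : m.degree = n := by simpa using hm
        omega
    rw [hf]
    refine Ideal.sum_mem _ fun m hm => Ideal.mul_mem_right _ _
      (monomial_mem_varIdeal_pow m ?_ 1)
    have h2 : m.degree = n := by simpa using hm
    exact h2.ge

theorem sub_sum_monomial_mem (n : ℕ) (f : PS N A) :
    f - ∑ m ∈ (Finsupp.finite_of_degree_lt n).toFinset,
      f.coeff m • (MvPowerSeries.monomial m 1 : PS N A) ∈ varIdeal N A ^ n := by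
  classical
  rw [mem_varIdeal_pow_iff]
  intro b hb
  rw [map_sub, map_sum, sub_eq_zero, Finset.sum_eq_single b]
  · simp
  · intro m _ hm
    rw [map_smul, MvPowerSeries.coeff_monomial_ne hm.symm, smul_zero]
  · intro h; exact absurd hb (by simpa using h)

theorem span_monomials_sup (n : ℕ) (f : PS N A) :
    ∃ g ∈ Submodule.span A ((fun m => (MvPowerSeries.monomial m 1 : PS N A)) ''
      {m : Fin N →₀ ℕ | m.degree < n}), f - g ∈ varIdeal N A ^ n :=
  ⟨_, Submodule.sum_mem _ fun m hm => Submodule.smul_mem _ _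
    (Submodule.subset_span ⟨m, by simpa using hm, rfl⟩), sub_sum_monomial_mem n f⟩

theorem span_monomials_quotient (n : ℕ) (I : Ideal (PS N A)) (hI : varIdeal N A ^ n ≤ I) :
    Submodule.span A ((fun m => Ideal.Quotient.mk I (MvPowerSeries.monomial m 1 : PS N A)) ''
      {m : Fin N →₀ ℕ | m.degree < n}) = ⊤ := by
  rw [eq_top_iff]
  intro f _
  obtain ⟨f, rfl⟩ := Ideal.Quotient.mk_surjective f
  obtain ⟨g, hg, hfg⟩ := span_monomials_sup n f
  have h1 : Ideal.Quotient.mk I f = Ideal.Quotient.mkₐ A I g :=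
    Ideal.Quotient.eq.2 (hI hfg)
  rw [h1]
  have := Submodule.mem_map_of_mem (f := (Ideal.Quotient.mkₐ A I).toLinearMap) hg
  rw [Submodule.map_span, Set.image_image] at this
  exact this

theorem finite_quotient (n : ℕ) (I : Ideal (PS N A)) (hI : varIdeal N A ^ n ≤ I) :
    Module.Finite A (PS N A ⧸ I) :=
  ⟨Submodule.fg_def.2 ⟨_, (Finsupp.finite_of_degree_lt n).image _,
    span_monomials_quotient n I hI⟩⟩

instance finite_truncRing (k : Type u) [Field k] (N n : ℕ) : Module.Finite k (TruncRing k N n) :=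
  finite_quotient n _ le_rfl

theorem finite_of_span_range {k : Type u} [Field k] {N n : ℕ} {B Q : Type u} [CommRing B]
    [Algebra k B] [CommRing Q] [Algebra k Q] [Algebra B Q] [IsScalarTower k B Q]
    {g : TruncRing k N n →ₐ[k] Q} (h : Submodule.span B (Set.range g) = ⊤) :
    Module.Finite B Q := by
  obtain ⟨s, hs, hs'⟩ := Submodule.fg_def.1 (finite_truncRing k N n).1
  refine ⟨Submodule.fg_def.2 ⟨g '' s, hs.image _, ?_⟩⟩
  rw [eq_top_iff, ← h, Submodule.span_le]
  rintro _ ⟨r, rfl⟩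
  have h1 : r ∈ Submodule.span k s := hs' ▸ Submodule.mem_top
  have h2 := Submodule.mem_map_of_mem (f := g.toLinearMap) h1
  rw [Submodule.map_span] at h2
  exact Submodule.span_le_restrictScalars k B _ h2

end PowerSeries

end

/-! ### The open locus where given power series span the fibres. -/

section

open TensorProduct

namespace RelScheme

variable {k : Type u} [Field k] {N n : ℕ} {S S' : Over (Spec (CommRingCat.of k))}

section

variable {B Q : Type u} [CommRing B] [Algebra k B]
  [CommRing Q] [Algebra k Q] [Algebra B Q] [IsScalarTower k B Q]

/-- A homomorphism from `R_n`, as a homomorphism from `k[[X]]`. -/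
abbrev psHom (g : TruncRing k N n →ₐ[k] Q) : PS N k →ₐ[k] Q := g.comp (Ideal.Quotient.mkₐ k _)

/-- The map induced by `f` is an isomorphism between the two quotients whose supports define the
loci. -/
theorem spanLocus_image_of_surjective {B Q Q' : Type*} [CommRing B] [AddCommGroup Q] [Module B Q]
    [AddCommGroup Q'] [Module B Q'] (f : Q →ₗ[B] Q') (hf : Function.Surjective f) (s : Set Q)
    {t : Set Q} (ht : LinearMap.ker f = Submodule.span B t) :
    spanLocus B (f '' s) = spanLocus B (s ∪ t) := by
  have hle : Submodule.span B (s ∪ t) ≤ (Submodule.span B (f '' s)).comap f := by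
    rw [Submodule.span_union, sup_le_iff, ← ht, ← Submodule.map_span]
    refine ⟨Submodule.le_comap_map _ _, fun x hx => ?_⟩
    rw [Submodule.mem_comap, LinearMap.mem_ker.1 hx]
    exact zero_mem _
  let F := Submodule.mapQ _ _ f hle
  have hF : Function.Bijective F := by
    constructor
    · rw [injective_iff_map_eq_zero]
      intro x hx
      obtain ⟨x, rfl⟩ := Submodule.Quotient.mk_surjective _ x
      rw [Submodule.mapQ_apply, Submodule.Quotient.mk_eq_zero, ← Submodule.map_span] at hx
      obtain ⟨y, hy, hxy⟩ := hx
      rw [Submodule.Quotient.mk_eq_zero, Submodule.span_union, ← ht]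
      have : x = y + (x - y) := by abel
      rw [this]
      exact add_mem (Submodule.mem_sup_left hy)
        (Submodule.mem_sup_right (by rw [LinearMap.mem_ker, map_sub, hxy, sub_self]))
    · intro x
      obtain ⟨x, rfl⟩ := Submodule.Quotient.mk_surjective _ x
      obtain ⟨x, rfl⟩ := hf x
      exact ⟨Submodule.Quotient.mk x, rfl⟩
  rw [spanLocus, spanLocus, (LinearEquiv.ofBijective F hF).support_eq]

/-- Since `Q` is spanned over `B` by the image of R_n, the `B`-span of the image of an ideal is
already stable under multiplication by `Q`. -/
theorem mem_map_powIdeal_iff {g : TruncRing k N n →ₐ[k] Q}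
    (h : Submodule.span B (Set.range g) = ⊤) {t : ℕ} {x : Q} : x ∈ (powIdeal k N n t).map g ↔
      x ∈ Submodule.span B (psHom g '' (varIdeal N k ^ t : Ideal (PS N k))) := by
  constructor
  · intro hx
    refine Submodule.span_induction ?_ (zero_mem _) (fun _ _ _ _ => add_mem) ?_ hx
    · rintro _ ⟨a, ha, rfl⟩
      obtain ⟨b, hb, rfl⟩ :=
        (Ideal.mem_map_iff_of_surjective _ Ideal.Quotient.mk_surjective).1 ha
      exact Submodule.subset_span ⟨b, hb, rfl⟩
    · intro q x _ hx
      have hq : q ∈ Submodule.span B (Set.range g) := h ▸ Submodule.mem_top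
      refine Submodule.span_induction (p := fun q _ => q • x ∈ _) ?_ (by simp) ?_ ?_ hq
      · rintro _ ⟨r, rfl⟩
        obtain ⟨r, rfl⟩ := Ideal.Quotient.mk_surjective r
        refine Submodule.span_induction ?_ (by simp) ?_ ?_ hx
        · rintro _ ⟨a, ha, rfl⟩
          exact Submodule.subset_span ⟨r * a, Ideal.mul_mem_left _ _ ha, by simp⟩
        · intro x y _ _ hx hy; rw [smul_add]; exact add_mem hx hy
        · intro b x _ hx; rw [smul_comm]; exact Submodule.smul_mem _ _ hx
      · intro a b _ _ ha hb; rw [add_smul]; exact add_mem ha hb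
      · intro b a _ ha; rw [smul_assoc]; exact Submodule.smul_mem _ _ ha
  · intro hx
    refine Submodule.span_induction ?_ (zero_mem _) (fun _ _ _ _ => add_mem) ?_ hx
    · rintro _ ⟨a, ha, rfl⟩
      exact Ideal.mem_map_of_mem g (Ideal.mem_map_of_mem _ ha)
    · intro b x _ hx
      rw [Algebra.smul_def]
      exact Ideal.mul_mem_left _ _ hx

/-- Dividing by M^t Q has the same effect on spanning as adding M^t to the spanning set. -/
theorem spanLocus_truncHom {g : TruncRing k N n →ₐ[k] Q} (h : Submodule.span B (Set.range g) = ⊤)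
    {t : ℕ} (ht : t ≤ n) (V : Set (PS N k)) :
    spanLocus B (psHom (truncHom g ht) '' V) =
      spanLocus B (psHom g '' (V ∪ (varIdeal N k ^ t : Ideal (PS N k)))) := by
  rw [Set.image_union, ← spanLocus_image_of_surjective
    (Ideal.Quotient.mkₐ B ((powIdeal k N n t).map g)).toLinearMap
    (Ideal.Quotient.mkₐ_surjective B _), Set.image_image]
  · rfl
  · ext x
    rw [← mem_map_powIdeal_iff (B := B) h]
    exact Ideal.Quotient.eq_zero_iff_mem

theorem IsClosedSubscheme.exists_ofAlg_along {Z : RelScheme k N n S}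
    (hZ : Z.IsClosedSubscheme) (φ : specOver k B ⟶ S) :
    ∃ (Q : Type u) (_ : CommRing Q) (_ : Algebra k Q) (_ : Algebra B Q) (_ : IsScalarTower k B Q)
      (g : TruncRing k N n →ₐ[k] Q), Submodule.span B (Set.range g) = ⊤ ∧
        (ofAlg B g).IsPullbackAlong Z φ := by
  obtain ⟨Q, _, _, _, _, g, h1, h2⟩ :=
    ((Z.isPullbackAlong_pb φ).isClosedSubscheme hZ).exists_ofAlg
  exact ⟨Q, _, _, _, _, g, h1, by simpa using h2.comp (Z.isPullbackAlong_pb φ)⟩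

theorem exists_ofAlg_baseChange {C : Type u} [CommRing C] [Algebra k C] (ψ : B →ₐ[k] C)
    (g : TruncRing k N n →ₐ[k] Q) [Module.Finite B Q] :
    ∃ (Q' : Type u) (_ : CommRing Q') (_ : Algebra k Q') (_ : Algebra C Q')
      (_ : IsScalarTower k C Q') (g' : TruncRing k N n →ₐ[k] Q'), Module.Finite C Q' ∧
        (ofAlg C g').IsPullbackAlong (ofAlg B g) (specOverMap ψ) ∧
        ∀ V : Set (PS N k), spanLocus C (psHom g' '' V) =
          PrimeSpectrum.comap ψ.toRingHom ⁻¹' spanLocus B (psHom g '' V) := by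
  let := ψ.toRingHom.toAlgebra
  have : IsScalarTower k B C := IsScalarTower.of_algebraMap_eq' ψ.comp_algebraMap.symm
  refine ⟨C ⊗[B] Q, _, _, _, inferInstance, baseChangeHom (B := B) C g, inferInstance,
    ofAlg_baseChange C g, fun V => ?_⟩
  refine Eq.trans ?_ (preimage_spanLocus C (psHom g '' V))
  rw [Set.image_image]
  rfl

theorem spanLocus_eq_of_isPullbackAlong_id {Q' : Type u} [CommRing Q'] [Algebra k Q']
    [Algebra B Q'] [IsScalarTower k B Q'] {g : TruncRing k N n →ₐ[k] Q}
    {g' : TruncRing k N n →ₐ[k] Q'} (h : (ofAlg B g').IsPullbackAlong (ofAlg B g) (𝟙 _))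
    (V : Set (PS N k)) : spanLocus B (psHom g' '' V) = spanLocus B (psHom g '' V) := by
  obtain ⟨e, he⟩ := exists_algEquiv_of_isPullbackAlong h
  rw [← spanLocus_image_equiv e.toLinearEquiv, Set.image_image]
  congr 1
  exact Set.image_congr fun x _ => (he _).symm

/-- The fibre product of the two charts has a point above the pair; an affine neighbourhood of it is
a common refinement. -/
theorem exists_common_point {B' : Type u} [CommRing B'] [Algebra k B'] {φ : specOver k B ⟶ S}
    {φ' : specOver k B' ⟶ S} {y : (specOver k B).left} {y' : (specOver k B').left}
    (h : φ.left y = φ'.left y') :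
    ∃ (C : Type u) (_ : CommRing C) (_ : Algebra k C) (ψ : B →ₐ[k] C) (ψ' : B' →ₐ[k] C)
      (z : (specOver k C).left), specOverMap ψ ≫ φ = specOverMap ψ' ≫ φ' ∧
        (specOverMap ψ).left z = y ∧ (specOverMap ψ').left z = y' := by
  have hp := isPullback_left (IsPullback.of_hasPullback φ φ')
  obtain ⟨w, hw, hw'⟩ := Scheme.exists_preimage_of_isPullback hp y y' h
  obtain ⟨C, _, _, j, _, ⟨z, rfl⟩, _⟩ := exists_affine_nhd (pullback φ φ') w ⊤ trivial
  obtain ⟨ψ, hψ⟩ := specOverMap_surjective (j ≫ pullback.fst φ φ')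
  obtain ⟨ψ', hψ'⟩ := specOverMap_surjective (j ≫ pullback.snd φ φ')
  refine ⟨C, _, _, ψ, ψ', z, ?_, ?_, ?_⟩
  · rw [hψ, hψ', Category.assoc, Category.assoc, pullback.condition]
  · rw [hψ, ← hw]; simp
  · rw [hψ', ← hw']; simp

/-- On a common refinement the two algebras become isomorphic, so the preimages of the two loci
coincide there. Hence `locus` does not depend on the chart used to test it. -/
theorem mem_spanLocus_iff_of_eq {Z : RelScheme k N n S} {B' Q' : Type u} [CommRing B']
    [Algebra k B'] [CommRing Q'] [Algebra k Q'] [Algebra B' Q'] [IsScalarTower k B' Q']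
    {φ : specOver k B ⟶ S} {φ' : specOver k B' ⟶ S}
    {g : TruncRing k N n →ₐ[k] Q} {g' : TruncRing k N n →ₐ[k] Q'}
    (hg : (ofAlg B g).IsPullbackAlong Z φ) (hg' : (ofAlg B' g').IsPullbackAlong Z φ')
    [Module.Finite B Q] [Module.Finite B' Q'] {y : (specOver k B).left} {y' : (specOver k B').left}
    (h : φ.left y = φ'.left y') (V : Set (PS N k)) :
    y ∈ spanLocus B (psHom g '' V) ↔ y' ∈ spanLocus B' (psHom g' '' V) := by
  obtain ⟨C, _, _, ψ, ψ', z, h1, rfl, rfl⟩ := exists_common_point h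
  obtain ⟨Q₁, _, _, _, _, g₁, _, h₁, h₁'⟩ := exists_ofAlg_baseChange ψ g
  obtain ⟨Q₂, _, _, _, _, g₂, _, h₂, h₂'⟩ := exists_ofAlg_baseChange ψ' g'
  have h3 : (ofAlg C g₂).IsPullbackAlong (ofAlg C g₁) (𝟙 _) :=
    (h₂.comp hg').unique (by rw [← h1]; exact h₁.comp hg)
  have h4 := spanLocus_eq_of_isPullbackAlong_id h3 V
  rw [h₁', h₂'] at h4
  exact (Set.ext_iff.1 h4 z).symm

end

/-- The points of `S` at which the image of `V` spans the fibre of `Z`. -/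
def locus (Z : RelScheme k N n S) (V : Set (PS N k)) : Set S.left :=
  {x | ∀ (B Q : Type u) [CommRing B] [Algebra k B] [CommRing Q] [Algebra k Q] [Algebra B Q]
    [IsScalarTower k B Q] (g : TruncRing k N n →ₐ[k] Q) (φ : specOver k B ⟶ S)
    (y : (specOver k B).left), (ofAlg B g).IsPullbackAlong Z φ → Module.Finite B Q →
    φ.left y = x → y ∈ spanLocus B (psHom g '' V)}

section

variable {B Q : Type u} [CommRing B] [Algebra k B]
  [CommRing Q] [Algebra k Q] [Algebra B Q] [IsScalarTower k B Q]

theorem mem_locus_iff {Z : RelScheme k N n S} {φ : specOver k B ⟶ S}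
    {g : TruncRing k N n →ₐ[k] Q} (hg : (ofAlg B g).IsPullbackAlong Z φ) [Module.Finite B Q]
    (V : Set (PS N k)) (y : (specOver k B).left) :
    φ.left y ∈ Z.locus V ↔ y ∈ spanLocus B (psHom g '' V) := by
  constructor
  · intro h
    exact h B Q g φ y hg inferInstance rfl
  · intro h B' Q' _ _ _ _ _ _ g' φ' y' hg' _ hy
    exact (mem_spanLocus_iff_of_eq hg' hg hy V).2 h

theorem span_eq_top_iff_forall_mem_locus {Z : RelScheme k N n S} {φ : specOver k B ⟶ S}
    {g : TruncRing k N n →ₐ[k] Q} (hg : (ofAlg B g).IsPullbackAlong Z φ) [Module.Finite B Q]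
    (V : Set (PS N k)) :
    Submodule.span B (psHom g '' V) = ⊤ ↔ ∀ y, φ.left y ∈ Z.locus V := by
  rw [← spanLocus_eq_univ_iff, Set.eq_univ_iff_forall]
  exact forall_congr' fun y => (mem_locus_iff hg V y).symm

end

/-- Charts are not required to be open immersions, so an affine chart of S' composed with `f` is
also a chart of `S`, with the same algebra. -/
theorem IsPullbackAlong.mem_locus_iff {Z' : RelScheme k N n S'} {Z : RelScheme k N n S}
    {f : S' ⟶ S} (h : Z'.IsPullbackAlong Z f) (hZ : Z.IsClosedSubscheme) (V : Set (PS N k))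
    (x : S'.left) : f.left x ∈ Z.locus V ↔ x ∈ Z'.locus V := by
  obtain ⟨B, _, _, j, _, ⟨y, rfl⟩, _⟩ := exists_affine_nhd S' x ⊤ trivial
  obtain ⟨Q, _, _, _, _, g, h1, h2⟩ := (h.isClosedSubscheme hZ).exists_ofAlg_along j
  have := finite_of_span_range h1
  rw [RelScheme.mem_locus_iff h2, ← RelScheme.mem_locus_iff (h2.comp h)]
  simp

theorem isOpen_locus {Z : RelScheme k N n S} (hZ : Z.IsClosedSubscheme) (V : Set (PS N k)) :
    IsOpen (Z.locus V) := by
  rw [isOpen_iff_forall_mem_open]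
  intro x hx
  obtain ⟨B, _, _, j, hj, ⟨y, rfl⟩, _⟩ := exists_affine_nhd S x ⊤ trivial
  obtain ⟨Q, _, _, _, _, g, h1, h2⟩ := hZ.exists_ofAlg_along j
  have := finite_of_span_range h1
  refine ⟨j.left '' spanLocus B (psHom g '' V), ?_, ?_, ?_⟩
  · rintro _ ⟨z, hz, rfl⟩
    exact (mem_locus_iff h2 V z).2 hz
  · exact j.left.isOpenEmbedding.isOpenMap _ (isOpen_spanLocus _)
  · exact ⟨y, (mem_locus_iff h2 V y).1 hx, rfl⟩

theorem mem_locus_trunc_iff {Z : RelScheme k N n S} (hZ : Z.IsClosedSubscheme) {t : ℕ} (ht : t ≤ n)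
    (V : Set (PS N k)) (x : S.left) :
    x ∈ (Z.trunc t ht).locus V ↔ x ∈ Z.locus (V ∪ (varIdeal N k ^ t : Ideal (PS N k))) := by
  obtain ⟨B, _, _, j, hj, ⟨y, rfl⟩, _⟩ := exists_affine_nhd S x ⊤ trivial
  obtain ⟨Q, _, _, _, _, g, h1, h2⟩ := hZ.exists_ofAlg_along j
  have := finite_of_span_range h1
  have := finite_of_span_range (span_range_truncHom h1 ht)
  rw [mem_locus_iff h2, mem_locus_iff (ofAlg_trunc h2 ht)]
  rw [spanLocus_truncHom h1]

theorem locus_mono {Z : RelScheme k N n S} {V V' : Set (PS N k)} (h : V ⊆ V') :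
    Z.locus V ⊆ Z.locus V' := by
  intro x hx B Q _ _ _ _ _ _ g φ y hg _ hy
  exact spanLocus_mono ((Set.image_mono h).trans Submodule.subset_span) (hx B Q g φ y hg ‹_› hy)

end RelScheme

end

/-! ### Coordinates of a family with respect to a basis. -/

section

open TensorProduct

/-- A spanning family of `d` elements of a flat module of rank `d` is linearly independent. -/
theorem linearIndependent_of_span_eq_top {B Q ι : Type*} [CommRing B] [AddCommGroup Q]
    [Module B Q] [Fintype ι] [Module.Flat B Q] {v : ι → Q}
    (hs : Submodule.span B (Set.range v) = ⊤)
    (hr : ∀ p : PrimeSpectrum B, Module.rankAtStalk Q p = Fintype.card ι) :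
    LinearIndependent B v := by
  have : Module.Finite B Q := ⟨Submodule.fg_def.2 ⟨_, Set.finite_range v, hs⟩⟩
  let f : (ι → B) →ₗ[B] Q := Fintype.linearCombination B v
  have hf : Function.Surjective f := by
    rw [← LinearMap.range_eq_top, Fintype.range_linearCombination, hs]
  suffices Function.Injective f from Fintype.linearIndependent_iff.2 fun a ha i =>
    congr_fun (this (ha.trans (map_zero f).symm) : a = 0) i
  -- After localization both modules are free of the same rank, and a surjective endomorphism of a
  -- finite module is injective.
  refine injective_of_localized_maximal f fun P _ => ?_
  have h1 : Function.Surjective (LocalizedModule.map P.primeCompl f) :=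
    LocalizedModule.map_surjective _ _ hf
  have : Module.Free (Localization P.primeCompl) (LocalizedModule P.primeCompl Q) :=
    Module.free_of_flat_of_isLocalRing (R := Localization.AtPrime P)
  have : Module.Free (Localization P.primeCompl) (LocalizedModule P.primeCompl (ι → B)) :=
    Module.free_of_flat_of_isLocalRing (R := Localization.AtPrime P)
  have : Nontrivial B := ⟨0, 1, fun h => Ideal.IsPrime.ne_top' ((Ideal.eq_top_iff_one P).2 (h ▸ P.zero_mem))⟩
  have : Nontrivial (Localization P.primeCompl) :=
    inferInstanceAs (Nontrivial (Localization.AtPrime P))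
  have h2 : Module.finrank (Localization P.primeCompl) (LocalizedModule P.primeCompl Q) =
      Module.finrank (Localization P.primeCompl) (LocalizedModule P.primeCompl (ι → B)) := by
    have e1 := hr ⟨P, inferInstance⟩
    have e2 := congr_fun (Module.rankAtStalk_eq_finrank_of_free (R := B) (M := ι → B))
      ⟨P, inferInstance⟩
    simp only [Pi.natCast_apply, Nat.cast_id, Module.finrank_fintype_fun_eq_card] at e2
    exact e1.trans e2.symm
  let e := LinearEquiv.ofFinrankEq _ _ h2
  have h3 : Function.Injective (e.toLinearMap.comp (LocalizedModule.map P.primeCompl f)) :=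
    OrzechProperty.injective_of_surjective_endomorphism _ (e.surjective.comp h1)
  exact Function.Injective.of_comp h3

section Coord

variable {k : Type u} [Field k] {R B : Type u} [CommRing R] [Algebra k R] [CommRing B]
  [Algebra k B] {d : ℕ}

/-- The coordinates on `B ⊗ R`. -/
def coordLift (π : R →ₗ[k] (Fin d → B)) : B ⊗[k] R →ₗ[B] (Fin d → B) :=
  LinearMap.liftBaseChange B π

theorem coordLift_tmul (π : R →ₗ[k] (Fin d → B)) (b : B) (r : R) :
    coordLift π (b ⊗ₜ r) = b • π r := LinearMap.liftBaseChange_tmul _ _ _ _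

/-- The hypothesis says that multiplication by `r` acts on coordinates through the matrix with rows
π(r · el i). In particular the elements with vanishing coordinates form an ideal. -/
theorem coordLift_tmul_mul {el : Fin d → R} {π : R →ₗ[k] (Fin d → B)}
    (hπ : ∀ r r' j, π (r * r') j = ∑ i, π r' i * π (r * el i) j) (b : B) (r : R) (x : B ⊗[k] R) :
    coordLift π (b ⊗ₜ r * x) =
      b • Fintype.linearCombination B (fun i => π (r * el i)) (coordLift π x) := by
  induction x with
  | zero => simp
  | add x y hx hy => rw [mul_add, map_add, hx, hy, map_add, map_add, smul_add]
  | tmul b' r' =>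
    rw [Algebra.TensorProduct.tmul_mul_tmul, coordLift_tmul, coordLift_tmul, map_smul, mul_smul]
    congr 2
    ext j
    rw [hπ, Fintype.linearCombination_apply, Finset.sum_apply]
    rfl

/-- The elements of `B ⊗ R` with vanishing coordinates. -/
def coordIdeal {el : Fin d → R} {π : R →ₗ[k] (Fin d → B)}
    (hπ : ∀ r r' j, π (r * r') j = ∑ i, π r' i * π (r * el i) j) : Ideal (B ⊗[k] R) where
  carrier := {x | coordLift π x = 0}
  add_mem' {a b} ha hb := by
    change coordLift π a = 0 at ha
    change coordLift π b = 0 at hb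
    change coordLift π (a + b) = 0
    rw [map_add, ha, hb, add_zero]
  zero_mem' := map_zero _
  smul_mem' a x hx := by
    change coordLift π x = 0 at hx
    change coordLift π (a * x) = 0
    induction a with
    | zero => simp
    | add a b ha hb => rw [add_mul, map_add, ha, hb, add_zero]
    | tmul b r => rw [coordLift_tmul_mul hπ, hx, map_zero, smul_zero]

/-- A quotient of `B ⊗ R` with prescribed coordinates. -/
theorem exists_algebra_of_coord (el : Fin d → R) (π : R →ₗ[k] (Fin d → B))
    (hel : ∀ i, π (el i) = Pi.single i 1)
    (hπ : ∀ r r' j, π (r * r') j = ∑ i, π r' i * π (r * el i) j) :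
    ∃ (Q : Type u) (_ : CommRing Q) (_ : Algebra k Q) (_ : Algebra B Q) (_ : IsScalarTower k B Q)
      (g : R →ₐ[k] Q) (b : Module.Basis (Fin d) B Q),
        (∀ i, b i = g (el i)) ∧ (∀ r, b.equivFun (g r) = π r) := by
  let g : R →ₐ[k] (B ⊗[k] R) ⧸ coordIdeal hπ :=
    (Ideal.Quotient.mkₐ k (coordIdeal hπ)).comp Algebra.TensorProduct.includeRight
  let f : ((B ⊗[k] R) ⧸ coordIdeal hπ) →ₗ[B] (Fin d → B) :=
    (Submodule.liftQ ((coordIdeal hπ).restrictScalars B) (coordLift π) fun x hx => hx).comp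
      (Submodule.Quotient.restrictScalarsEquiv B (coordIdeal hπ)).symm.toLinearMap
  have hf : ∀ x, f (Ideal.Quotient.mk _ x) = coordLift π x := fun x => rfl
  have hfg : ∀ r, f (g r) = π r := fun r =>
    (hf _).trans ((coordLift_tmul π 1 r).trans (one_smul _ _))
  have hbij : Function.Bijective f := by
    constructor
    · rw [injective_iff_map_eq_zero]
      intro x hx
      obtain ⟨x, rfl⟩ := Ideal.Quotient.mk_surjective x
      exact Ideal.Quotient.eq_zero_iff_mem.2 hx
    · intro y
      refine ⟨∑ i, y i • g (el i), ?_⟩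
      rw [map_sum]
      simp_rw [map_smul, hfg, hel]
      ext j
      simp [Finset.sum_apply, Pi.single_apply]
  let e := LinearEquiv.ofBijective f hbij
  have hb : ∀ i, Module.Basis.ofEquivFun e i = g (el i) := fun i => by
    rw [Module.Basis.coe_ofEquivFun, LinearEquiv.symm_apply_eq]
    exact ((hfg _).trans (hel i)).symm
  have he : ∀ r, (Module.Basis.ofEquivFun e).equivFun (g r) = π r := fun r => by
    rw [Module.Basis.equivFun_ofEquivFun]; exact hfg r
  exact ⟨_, _, _, _, inferInstance, g, Module.Basis.ofEquivFun e, hb, he⟩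

end Coord

namespace RelScheme

variable {k : Type u} [Field k] {N n : ℕ} {S S' : Over (Spec (CommRingCat.of k))}

/-- Closed subschemes of `S × Spec R_n`, flat over `S` of length `p n`, whose truncations modulo
`M ^ t` are flat of length `p t` for `t₀ ≤ t ≤ n`. -/
structure IsAdmissible (p : ℕ → ℤ) (t₀ : ℕ) (Z : RelScheme k N n S) : Prop where
  closed : Z.IsClosedSubscheme
  flat : Z.IsFlatOfLength (p n)
  trunc : ∀ (t : ℕ) (_ : t₀ ≤ t) (h : t ≤ n), (Z.trunc t h).IsFlatOfLength (p t)

theorem IsPullbackAlong.isAdmissible {p : ℕ → ℤ} {t₀ : ℕ} {Z' : RelScheme k N n S'}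
    {Z : RelScheme k N n S} {f : S' ⟶ S} (h : Z'.IsPullbackAlong Z f) (hZ : Z.IsAdmissible p t₀) :
    Z'.IsAdmissible p t₀ :=
  ⟨h.isClosedSubscheme hZ.closed, h.isFlatOfLength hZ.flat,
    fun t h₀ ht => (h.trunc t ht).isFlatOfLength (hZ.trunc t h₀ ht)⟩

end RelScheme

/-- A family of power series adapted to the powers of the maximal ideal. -/
structure Cell (k : Type u) [Field k] (N n : ℕ) (p : ℕ → ℤ) (t₀ : ℕ) where
  d : ℕ
  v : Fin d → PS N k
  δ : Fin d → ℕ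
  mem : ∀ i, v i ∈ varIdeal N k ^ δ i
  card_eq : (d : ℤ) = p n
  card_lt : ∀ t, t₀ ≤ t → t ≤ n → (Fintype.card {i // δ i < t} : ℤ) = p t

namespace Cell

open RelScheme

variable {k : Type u} [Field k] {N n : ℕ} {p : ℕ → ℤ} {t₀ : ℕ} (c : Cell k N n p t₀)

/-- The elements of a cell in `R_n`. -/
def el (i : Fin c.d) : TruncRing k N n := Ideal.Quotient.mk _ (c.v i)

section

variable {B Q : Type u} [CommRing B] [Algebra k B]
  [CommRing Q] [Algebra k Q] [Algebra B Q] [IsScalarTower k B Q]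

/-- The conditions on the coordinates of the elements of `R_n` in a family for which the cell is
a basis. -/
structure IsCoord (π : TruncRing k N n →ₗ[k] (Fin c.d → B)) : Prop where
  el : ∀ i, π (c.el i) = Pi.single i 1
  mul : ∀ r r' j, π (r * r') j = ∑ i, π r' i * π (r * c.el i) j
  vanish : ∀ t, t₀ ≤ t → t ≤ n → ∀ r ∈ powIdeal k N n t, ∀ i, c.δ i < t → π r i = 0

variable {c}

theorem range_psHom (g : TruncRing k N n →ₐ[k] Q) :
    psHom g '' Set.range c.v = Set.range fun i => g (c.el i) := by
  rw [← Set.range_comp]; rfl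

theorem el_mem {i : Fin c.d} {t : ℕ} (h : t ≤ c.δ i) : c.el i ∈ powIdeal k N n t :=
  Ideal.mem_map_of_mem _ (Ideal.pow_le_pow_right h (c.mem i))

/-- The basis of the family given by a cell. -/
theorem exists_basis {g : TruncRing k N n →ₐ[k] Q} (hg : (ofAlg B g).IsAdmissible p t₀)
    (hs : Submodule.span B (psHom g '' Set.range c.v) = ⊤) :
    ∃ b : Module.Basis (Fin c.d) B Q, ∀ i, b i = g (c.el i) := by
  obtain ⟨_, _, h3⟩ := isFlatOfLength_ofAlg_iff.1 hg.flat
  rw [range_psHom] at hs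
  refine ⟨Module.Basis.mk (linearIndependent_of_span_eq_top hs fun q => ?_) hs.ge, fun i => ?_⟩
  · have := (h3 q).trans c.card_eq.symm
    simpa using this
  · simp

/-- The elements with δ at least t lie in M^t and die in the truncation. -/
theorem span_trunc {g : TruncRing k N n →ₐ[k] Q} (hs : Submodule.span B (psHom g '' Set.range c.v) = ⊤)
    {t : ℕ} :
    Submodule.span B (Set.range fun i : {i // c.δ i < t} =>
      Ideal.Quotient.mk ((powIdeal k N n t).map g) (g (c.el i))) = ⊤ := by
  have := congr(Submodule.map (Ideal.Quotient.mkₐ B ((powIdeal k N n t).map g)).toLinearMap $hs)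
  rw [Submodule.map_span, Submodule.map_top, LinearMap.range_eq_top.2
    (Ideal.Quotient.mkₐ_surjective B ((powIdeal k N n t).map g)), range_psHom] at this
  rw [eq_top_iff, ← this, Submodule.span_le]
  rintro _ ⟨_, ⟨i, rfl⟩, rfl⟩
  by_cases hi : c.δ i < t
  · exact Submodule.subset_span ⟨⟨i, hi⟩, rfl⟩
  · have : Ideal.Quotient.mk ((powIdeal k N n t).map g) (g (c.el i)) = 0 :=
      Ideal.Quotient.eq_zero_iff_mem.2 (Ideal.mem_map_of_mem g (el_mem (not_lt.1 hi)))
    change Ideal.Quotient.mk _ _ ∈ _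
    rw [this]
    exact zero_mem _

/-- For the vanishing condition: modulo M^t the elements with δ < t span a flat module whose rank is
their number, so they are independent. An element of M^t is zero there, hence its coordinates at
these elements vanish. -/
theorem isCoord_of_basis {g : TruncRing k N n →ₐ[k] Q} (hg : (ofAlg B g).IsAdmissible p t₀)
    (b : Module.Basis (Fin c.d) B Q) (hb : ∀ i, b i = g (c.el i)) :
    c.IsCoord ((b.equivFun.toLinearMap.restrictScalars k).comp g.toLinearMap) := by
  have hs : Submodule.span B (psHom g '' Set.range c.v) = ⊤ := by
    rw [range_psHom, ← b.span_eq]; congr; ext i; exact (hb i).symm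
  refine ⟨fun i => ?_, fun r r' j => ?_, fun t h₀ ht r hr i hi => ?_⟩
  · simp [← hb, Finsupp.single_eq_pi_single]
  · have h1 : g r' = ∑ i, b.equivFun (g r') i • g (c.el i) := by
      simp_rw [← hb]; exact (b.sum_equivFun _).symm
    have h2 : g (r * r') = ∑ i, b.equivFun (g r') i • g (r * c.el i) := by
      rw [map_mul]; conv_lhs => rw [h1]
      simp [Finset.mul_sum]
    change b.equivFun (g (r * r')) j = _
    rw [h2, map_sum, Finset.sum_apply]
    simp
  · obtain ⟨_, _, h3⟩ := isFlatOfLength_ofAlg_iff.1 ((ofAlg_trunc (IsPullbackAlong.refl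
      (ofAlg B g)) ht).isFlatOfLength (hg.trunc t h₀ ht))
    have hl := linearIndependent_of_span_eq_top (span_trunc hs (t := t)) fun q => by
      have := (h3 q).trans (c.card_lt t h₀ ht).symm
      exact_mod_cast this
    rw [Fintype.linearIndependent_iff] at hl
    refine hl (fun i => b.equivFun (g r) i) ?_ ⟨i, hi⟩
    have h1 : Ideal.Quotient.mk ((powIdeal k N n t).map g) (g r) = 0 :=
      Ideal.Quotient.eq_zero_iff_mem.2 (Ideal.mem_map_of_mem g hr)
    have h2 : g r = ∑ i, b.equivFun (g r) i • g (c.el i) := by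
      simp_rw [← hb]; exact (b.sum_equivFun _).symm
    rw [← h1]; conv_rhs => rw [h2]
    change _ = Ideal.Quotient.mkₐ B _ _
    rw [map_sum]
    simp_rw [map_smul]
    rw [← Fintype.sum_subtype_add_sum_subtype (fun i => c.δ i < t)]
    rw [Finset.sum_eq_zero (s := (Finset.univ : Finset {i // ¬ c.δ i < t})), add_zero]
    · rfl
    · intro i _
      have : Ideal.Quotient.mkₐ B ((powIdeal k N n t).map g) (g (c.el i)) = 0 :=
        Ideal.Quotient.eq_zero_iff_mem.2 (Ideal.mem_map_of_mem g (el_mem (not_lt.1 i.2)))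
      rw [this, smul_zero]

/-- If the coordinates with δ < t vanish on M^t, then they vanish on M^t Q, so the corresponding
basis elements stay independent in the truncation. They also span it, and `card_lt` gives its rank.
-/
theorem isAdmissible_of_basis {g : TruncRing k N n →ₐ[k] Q}
    (b : Module.Basis (Fin c.d) B Q) (hb : ∀ i, b i = g (c.el i))
    (hv : ∀ t, t₀ ≤ t → t ≤ n → ∀ r ∈ powIdeal k N n t, ∀ i, c.δ i < t →
      b.equivFun (g r) i = 0) : (ofAlg B g).IsAdmissible p t₀ := by
  have hs : Submodule.span B (psHom g '' Set.range c.v) = ⊤ := by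
    rw [range_psHom, ← b.span_eq]; congr; ext i; exact (hb i).symm
  have hs' : Submodule.span B (Set.range g) = ⊤ := by
    rw [eq_top_iff, ← hs]
    refine Submodule.span_mono ?_
    rintro _ ⟨r, _, rfl⟩
    exact ⟨_, rfl⟩
  have rank_of : ∀ {ι : Type} [Fintype ι] {P : Type u} [AddCommGroup P] [Module B P]
      (e : Module.Basis ι B P) (q : PrimeSpectrum B),
      (Module.rankAtStalk P q : ℤ) = Fintype.card ι := by
    intro ι _ P _ _ e q
    have := q.nontrivial
    have := Module.Free.of_basis e
    have := Module.Finite.of_basis e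
    rw [Module.rankAtStalk_eq_finrank_of_free, Module.finrank_eq_card_basis e]
    simp
  refine ⟨isClosedSubscheme_ofAlg hs', isFlatOfLength_ofAlg_iff.2
    ⟨Module.Finite.of_basis b, ?_, fun q => ?_⟩, fun t h₀ ht => ?_⟩
  · have := Module.Free.of_basis b
    infer_instance
  · rw [rank_of b, ← c.card_eq]; simp
  · refine (ofAlg_trunc (IsPullbackAlong.refl (ofAlg B g)) ht).unique (IsPullbackAlong.refl _)
      |>.symm.isFlatOfLength (isFlatOfLength_ofAlg_iff.2 ?_)
    have hl : LinearIndependent B (fun i : {i // c.δ i < t} =>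
        Ideal.Quotient.mk ((powIdeal k N n t).map g) (g (c.el i))) := by
      rw [Fintype.linearIndependent_iff]
      intro a ha i
      have h1 : ∑ i : {i // c.δ i < t}, a i • g (c.el i) ∈ (powIdeal k N n t).map g := by
        rw [← Ideal.Quotient.eq_zero_iff_mem, ← ha]
        change Ideal.Quotient.mkₐ B _ _ = _
        rw [map_sum]
        simp_rw [map_smul]
        rfl
      rw [mem_map_powIdeal_iff hs'] at h1
      have h2 : ∀ x ∈ Submodule.span B (psHom g '' (varIdeal N k ^ t : Ideal (PS N k))),
          b.equivFun x i = 0 := by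
        intro x hx
        refine Submodule.span_induction ?_ (by simp) ?_ ?_ hx
        · rintro _ ⟨r, hr, rfl⟩
          exact hv t h₀ ht _ (Ideal.mem_map_of_mem _ hr) i i.2
        · intro x y _ _ hx hy
          rw [map_add, Pi.add_apply, hx, hy, add_zero]
        · intro r x _ hx
          rw [map_smul, Pi.smul_apply, hx, smul_zero]
      have h3 := h2 _ h1
      rw [map_sum, Finset.sum_apply, Finset.sum_eq_single i] at h3
      · simpa [← hb] using h3
      · intro j _ hj
        have : (j : Fin c.d) ≠ i := fun h => hj (Subtype.ext h)
        simp [← hb, this]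
      · simp
    let e := Module.Basis.mk hl (span_trunc hs).ge
    refine ⟨Module.Finite.of_basis e, ?_, fun q => ?_⟩
    · have := Module.Free.of_basis e
      infer_instance
    · rw [rank_of e, c.card_lt t h₀ ht]

theorem IsCoord.exists_ofAlg {π : TruncRing k N n →ₗ[k] (Fin c.d → B)} (hπ : c.IsCoord π) :
    ∃ (Q : Type u) (_ : CommRing Q) (_ : Algebra k Q) (_ : Algebra B Q) (_ : IsScalarTower k B Q)
      (g : TruncRing k N n →ₐ[k] Q) (b : Module.Basis (Fin c.d) B Q),
        (∀ i, b i = g (c.el i)) ∧ (∀ r, b.equivFun (g r) = π r) ∧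
        (ofAlg B g).IsAdmissible p t₀ := by
  obtain ⟨Q, _, _, _, _, g, b, hb, he⟩ := exists_algebra_of_coord c.el π hπ.el hπ.mul
  refine ⟨Q, _, _, _, inferInstance, g, b, hb, he,
    isAdmissible_of_basis _ hb fun t h₀ ht r hr i hi => ?_⟩
  rw [he]
  exact hπ.vanish t h₀ ht r hr i hi

/-- An isomorphism of modules that respects the elements of `R_n` is an isomorphism of
algebras. -/
theorem exists_algEquiv_of_linearEquiv {Q' : Type u} [CommRing Q'] [Algebra k Q'] [Algebra B Q']
    [IsScalarTower k B Q'] {g : TruncRing k N n →ₐ[k] Q} {g' : TruncRing k N n →ₐ[k] Q'}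
    (hs : Submodule.span B (Set.range g) = ⊤) (e : Q ≃ₗ[B] Q') (he : ∀ r, e (g r) = g' r) :
    ∃ e' : Q ≃ₐ[B] Q', ∀ r, e' (g r) = g' r := by
  refine ⟨AlgEquiv.ofLinearEquiv e ?_ fun x y => ?_, he⟩
  · rw [← map_one g, he, map_one]
  · have hx : x ∈ Submodule.span B (Set.range g) := hs ▸ Submodule.mem_top
    have hy : y ∈ Submodule.span B (Set.range g) := hs ▸ Submodule.mem_top
    refine Submodule.span_induction (p := fun x _ => e (x * y) = e x * e y) ?_ (by simp) ?_ ?_ hx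
    · rintro _ ⟨r, rfl⟩
      refine Submodule.span_induction (p := fun y _ => e (g r * y) = e (g r) * e y)
        ?_ (by simp) ?_ ?_ hy
      · rintro _ ⟨r', rfl⟩
        rw [← map_mul, he, he, he, map_mul]
      · intro a b _ _ ha hb; rw [mul_add, map_add, ha, hb, map_add, mul_add]
      · intro a b _ hb; rw [mul_smul_comm, map_smul, hb, map_smul, mul_smul_comm]
    · intro a b _ _ ha hb; rw [add_mul, map_add, ha, hb, map_add, add_mul]
    · intro a b _ hb; rw [smul_mul_assoc, map_smul, hb, map_smul, smul_mul_assoc]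

variable (c) in
/-- The polynomials that vanish on all coordinate systems. -/
def relIdeal : Ideal (MvPolynomial (TruncRing k N n × Fin c.d) k) where
  carrier := {f | ∀ (B : Type u) [CommRing B] [Algebra k B]
    (π : TruncRing k N n →ₗ[k] (Fin c.d → B)), c.IsCoord π →
      MvPolynomial.aeval (fun a => π a.1 a.2) f = 0}
  add_mem' ha hb B _ _ π hπ := by rw [map_add, ha B π hπ, hb B π hπ, add_zero]
  zero_mem' B _ _ π hπ := map_zero _
  smul_mem' a x hx B _ _ π hπ := by rw [smul_eq_mul, map_mul, hx B π hπ, mul_zero]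

variable (c) in
/-- The coordinate ring of the cell. -/
abbrev CoordRing : Type u := MvPolynomial (TruncRing k N n × Fin c.d) k ⧸ c.relIdeal

/-- The homomorphism from the coordinate ring that corresponds to coordinates in `B`. -/
def IsCoord.hom {π : TruncRing k N n →ₗ[k] (Fin c.d → B)} (hπ : c.IsCoord π) :
    c.CoordRing →ₐ[k] B :=
  Ideal.Quotient.liftₐ _ (MvPolynomial.aeval (fun a => π a.1 a.2)) fun _ hf => hf B π hπ

variable (c) in
/-- The universal coordinates. -/
def univCoord : TruncRing k N n →ₗ[k] (Fin c.d → c.CoordRing) where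
  toFun r i := Ideal.Quotient.mk _ (MvPolynomial.X (r, i))
  map_add' r r' := by
    ext i
    rw [Pi.add_apply, ← map_add, Ideal.Quotient.eq]
    intro B _ _ π hπ
    simp
  map_smul' a r := by
    ext i
    change _ = a • Ideal.Quotient.mkₐ k _ _
    rw [← map_smul]
    change Ideal.Quotient.mk _ _ = Ideal.Quotient.mk _ _
    rw [Ideal.Quotient.eq]
    intro B _ _ π hπ
    simp

theorem IsCoord.hom_univCoord {π : TruncRing k N n →ₗ[k] (Fin c.d → B)} (hπ : c.IsCoord π)
    (r : TruncRing k N n) (i : Fin c.d) : hπ.hom (c.univCoord r i) = π r i := by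
  change MvPolynomial.aeval _ _ = _
  simp

theorem coordRing_hom_ext {f f' : c.CoordRing →ₐ[k] B}
    (h : ∀ r i, f (c.univCoord r i) = f' (c.univCoord r i)) : f = f' := by
  apply Ideal.Quotient.algHom_ext
  apply MvPolynomial.algHom_ext
  rintro ⟨r, i⟩
  exact h r i

/-- Each condition on coordinates is a polynomial identity that holds in every coordinate system, so
the corresponding polynomial lies in `relIdeal`. Because that ideal consists of all common
relations, no list of equations is needed. -/
theorem isCoord_univCoord : c.IsCoord c.univCoord := by
  refine ⟨fun i => ?_, fun r r' j => ?_, fun t h₀ ht r hr i hi => ?_⟩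
  · ext j
    have : (Pi.single i 1 : Fin c.d → c.CoordRing) j =
        Ideal.Quotient.mk _ (Pi.single (M := fun _ => MvPolynomial (TruncRing k N n × Fin c.d) k)
          i 1 j) := by
      by_cases h : j = i
      · subst h; simp
      · simp [h]
    rw [this]
    refine Ideal.Quotient.eq.2 ?_
    intro B _ _ π hπ
    by_cases h : j = i
    · subst h; simp [hπ.el]
    · simp [hπ.el, h]
  · have : ∑ i, c.univCoord r' i * c.univCoord (r * c.el i) j =
        Ideal.Quotient.mk _ (∑ i, MvPolynomial.X (r', i) * MvPolynomial.X (r * c.el i, j)) := by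
      rw [map_sum]; simp_rw [map_mul]; rfl
    rw [this]
    refine Ideal.Quotient.eq.2 ?_
    intro B _ _ π hπ
    simp [hπ.mul r r' j]
  · refine Ideal.Quotient.eq_zero_iff_mem.2 ?_
    intro B _ _ π hπ
    simp [hπ.vanish t h₀ ht r hr i hi]

end
end Cell

end

/-! ### The universal family over one cell. -/

section

open TensorProduct

theorem one_tmul_smul {A B M : Type*} [CommRing A] [CommRing B] [Algebra A B] [AddCommGroup M]
    [Module A M] (a : A) (x : M) :
    (1 : B) ⊗ₜ[A] (a • x) = algebraMap A B a • ((1 : B) ⊗ₜ[A] x) := by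
  rw [tmul_smul, algebraMap_smul]

namespace RelScheme

variable {k : Type u} [Field k] {N n : ℕ} {S S' X : Over (Spec (CommRingCat.of k))}

/-- `U` is the universal family with property `P`. -/
structure Represents (P : ∀ S : Over (Spec (CommRingCat.of k)), RelScheme k N n S → Prop)
    (U : RelScheme k N n X) : Prop where
  prop : P X U
  existsUnique : ∀ (S : Over (Spec (CommRingCat.of k))) (Z : RelScheme k N n S), P S Z →
    ∃! f : S ⟶ X, Z.IsPullbackAlong U f

/-- Classifying morphisms exist if they exist locally and are unique. -/
theorem exists_classifying_of_local {U : RelScheme k N n X} (hU : U.IsClosedSubscheme)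
    {Z : RelScheme k N n S} (hZ : Z.IsClosedSubscheme)
    (hu : ∀ {V : Over (Spec (CommRingCat.of k))} (j : V ⟶ S) (f f' : V ⟶ X),
      (Z.pb j).IsPullbackAlong U f → (Z.pb j).IsPullbackAlong U f' → f = f')
    (hex : ∀ x : S.left, ∃ (V : Over (Spec (CommRingCat.of k))) (j : V ⟶ S),
      IsOpenImmersion j.left ∧ x ∈ Set.range j.left ∧ ∃ f : V ⟶ X, (Z.pb j).IsPullbackAlong U f) :
    ∃! f : S ⟶ X, Z.IsPullbackAlong U f := by
  obtain ⟨f, hf⟩ := CurveModuli.exists_hom_of_local (S := S) (Y := X)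
    (fun j g => (Z.pb j).IsPullbackAlong U g)
    (fun i j f h => IsPullbackAlong.comp (Z' := Z.pb j) (IsPullbackAlong.of_comp
      (Z.isPullbackAlong_pb (i ≫ j)) (Z.isPullbackAlong_pb j)) h)
    hu hex
  refine ⟨f, isPullbackAlong_of_local hZ hU hf, fun f' hf' => ?_⟩
  refine hom_ext_of_local fun x => ?_
  obtain ⟨V, j, hj, hx, h⟩ := hf x
  exact ⟨V, j, hj, hx, hu j _ _ ((Z.isPullbackAlong_pb j).comp hf') h⟩

end RelScheme

namespace Cell

open RelScheme

variable {k : Type u} [Field k] {N n : ℕ} {p : ℕ → ℤ} {t₀ : ℕ} {c : Cell k N n p t₀}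
variable {B Q : Type u} [CommRing B] [Algebra k B]
  [CommRing Q] [Algebra k Q] [Algebra B Q] [IsScalarTower k B Q]
  {Q₀ : Type u} [CommRing Q₀] [Algebra k Q₀] [Algebra c.CoordRing Q₀]
  [IsScalarTower k c.CoordRing Q₀]

/-- The algebra map underlying the pullback carries the expansion of g₀ r in the universal basis to
an expansion of g r in the basis `b`. This yields uniqueness of classifying morphisms. -/
theorem coord_eq_of_isPullbackAlong {g₀ : TruncRing k N n →ₐ[k] Q₀}
    {b₀ : Module.Basis (Fin c.d) c.CoordRing Q₀}
    (hb₀ : ∀ i, b₀ i = g₀ (c.el i)) (he₀ : ∀ r, b₀.equivFun (g₀ r) = c.univCoord r)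
    {g : TruncRing k N n →ₐ[k] Q} {b : Module.Basis (Fin c.d) B Q}
    (hb : ∀ i, b i = g (c.el i)) {ψ : c.CoordRing →ₐ[k] B}
    (h : (ofAlg B g).IsPullbackAlong (ofAlg c.CoordRing g₀) (specOverMap ψ))
    (r : TruncRing k N n) (i : Fin c.d) : ψ (c.univCoord r i) = b.equivFun (g r) i := by
  obtain ⟨e, he, heg⟩ := exists_algHom_of_isPullbackAlong h
  have h1 : g₀ r = ∑ i, c.univCoord r i • g₀ (c.el i) := by
    simp_rw [← hb₀, ← he₀]; exact (b₀.sum_equivFun _).symm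
  have h2 : g r = ∑ i, ψ (c.univCoord r i) • b i := by
    rw [← heg, h1, map_sum]
    simp_rw [Algebra.smul_def, map_mul, he, heg, hb]
  rw [h2, map_sum, Finset.sum_apply]
  simp [Finsupp.single_apply]

/-- Matching the base-changed universal basis with `b` gives a linear isomorphism; equality of
coordinates makes it respect the images of R_n, and these span, so it is multiplicative. This yields
existence of classifying morphisms. -/
theorem isPullbackAlong_of_coord_eq {g₀ : TruncRing k N n →ₐ[k] Q₀}
    {b₀ : Module.Basis (Fin c.d) c.CoordRing Q₀}
    (hb₀ : ∀ i, b₀ i = g₀ (c.el i)) (he₀ : ∀ r, b₀.equivFun (g₀ r) = c.univCoord r)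
    {g : TruncRing k N n →ₐ[k] Q} {b : Module.Basis (Fin c.d) B Q}
    {ψ : c.CoordRing →ₐ[k] B}
    (h : ∀ r i, ψ (c.univCoord r i) = b.equivFun (g r) i) :
    (ofAlg B g).IsPullbackAlong (ofAlg c.CoordRing g₀) (specOverMap ψ) := by
  let := ψ.toRingHom.toAlgebra
  have : IsScalarTower k c.CoordRing B := IsScalarTower.of_algebraMap_eq' ψ.comp_algebraMap.symm
  have h1 := ofAlg_baseChange B g₀ (B := c.CoordRing)
  have hs : Submodule.span c.CoordRing (Set.range g₀) = ⊤ := by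
    rw [eq_top_iff, ← b₀.span_eq]
    refine Submodule.span_mono ?_
    rintro _ ⟨i, rfl⟩
    exact ⟨_, (hb₀ i).symm⟩
  let e := (b₀.baseChange B).equiv b (Equiv.refl _)
  have he : ∀ r, e (baseChangeHom (B := c.CoordRing) B g₀ r) = g r := fun r => by
    have h2 : g₀ r = ∑ i, c.univCoord r i • b₀ i := by
      simp_rw [← he₀]; exact (b₀.sum_equivFun _).symm
    have h3 : baseChangeHom (B := c.CoordRing) B g₀ r =
        ∑ i, ψ (c.univCoord r i) • b₀.baseChange B i := by
      rw [baseChangeHom_apply, h2, tmul_sum]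
      refine Finset.sum_congr rfl fun i _ => ?_
      rw [Module.Basis.baseChange_apply]
      exact one_tmul_smul _ _
    rw [h3, map_sum]
    simp_rw [map_smul, h]
    have h4 : ∀ i, e (b₀.baseChange B i) = b i := fun i => by
      rw [Module.Basis.equiv_apply]; rfl
    simp_rw [h4]
    exact b.sum_equivFun _
  obtain ⟨e', he'⟩ := exists_algEquiv_of_linearEquiv (span_range_baseChangeHom hs B) e he
  have h2 := (ofAlg_isPullbackAlong_of_algEquiv e' he').comp h1
  rw [Category.id_comp] at h2
  exact h2

variable (c) in
/-- A cell represents the families for which it is a basis. -/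
theorem exists_represents : ∃ U : RelScheme k N n (specOver k c.CoordRing),
    U.Represents fun S Z => Z.IsAdmissible p t₀ ∧ ∀ x : S.left, x ∈ Z.locus (Set.range c.v) := by
  obtain ⟨Q₀, _, _, _, _, g₀, b₀, hb₀, he₀, hadm⟩ := c.isCoord_univCoord.exists_ofAlg
  have hfin := Module.Finite.of_basis b₀
  have key : ∀ {S : Over (Spec (CommRingCat.of k))} {Z : RelScheme k N n S},
      Z.IsAdmissible p t₀ → (∀ x : S.left, x ∈ Z.locus (Set.range c.v)) →
      ∀ {B : Type u} [CommRing B] [Algebra k B] (j : specOver k B ⟶ S),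
        ∃ (Q : Type u) (_ : CommRing Q) (_ : Algebra k Q) (_ : Algebra B Q)
          (_ : IsScalarTower k B Q) (g : TruncRing k N n →ₐ[k] Q)
          (b : Module.Basis (Fin c.d) B Q), (∀ i, b i = g (c.el i)) ∧
          (ofAlg B g).IsAdmissible p t₀ ∧ (ofAlg B g).IsPullbackAlong Z j := by
    intro S Z hZ hx B _ _ j
    obtain ⟨Q, _, _, _, _, g, h1, h2⟩ := hZ.closed.exists_ofAlg_along j
    have := finite_of_span_range h1
    obtain ⟨b, hb⟩ := exists_basis (h2.isAdmissible hZ)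
      ((span_eq_top_iff_forall_mem_locus h2 _).2 fun y => hx _)
    exact ⟨Q, _, _, _, _, g, b, hb, h2.isAdmissible hZ, h2⟩
  refine ⟨ofAlg c.CoordRing g₀, ⟨⟨hadm, fun x => ?_⟩, fun S Z ⟨hZ, hx⟩ => ?_⟩⟩
  · have := (span_eq_top_iff_forall_mem_locus (IsPullbackAlong.refl (ofAlg c.CoordRing g₀))
      (Set.range c.v)).1 (by
        rw [range_psHom, ← b₀.span_eq]; congr; ext i; exact (hb₀ i).symm) x
    simpa using this
  · refine exists_classifying_of_local hadm.closed hZ.closed ?_ fun x => ?_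
    · intro V j f f' hf hf'
      have hV := (Z.isPullbackAlong_pb j).isAdmissible hZ
      have hxV : ∀ x, x ∈ (Z.pb j).locus (Set.range c.v) := fun x =>
        ((Z.isPullbackAlong_pb j).mem_locus_iff hZ.closed _ _).1 (hx _)
      refine hom_ext_of_local fun y => ?_
      obtain ⟨B, _, _, i, hi, hy, _⟩ := exists_affine_nhd V y ⊤ trivial
      refine ⟨_, i, hi, hy, ?_⟩
      obtain ⟨Q, _, _, _, _, g, b, hb, h1, h2⟩ := key hV hxV i
      obtain ⟨ψ, hψ⟩ := specOverMap_surjective (i ≫ f)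
      obtain ⟨ψ', hψ'⟩ := specOverMap_surjective (i ≫ f')
      rw [← hψ, ← hψ']
      congr 1
      refine coordRing_hom_ext fun r l => ?_
      rw [coord_eq_of_isPullbackAlong hb₀ he₀ hb (by rw [hψ]; exact h2.comp hf),
        coord_eq_of_isPullbackAlong hb₀ he₀ hb (by rw [hψ']; exact h2.comp hf')]
    · obtain ⟨B, _, _, i, hi, hy, _⟩ := exists_affine_nhd S x ⊤ trivial
      obtain ⟨Q, _, _, _, _, g, b, hb, h1, h2⟩ := key hZ hx i
      refine ⟨_, i, hi, hy, specOverMap (isCoord_of_basis h1 b hb).hom, ?_⟩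
      have h3 := isPullbackAlong_of_coord_eq hb₀ he₀ (b := b)
        (ψ := (isCoord_of_basis h1 b hb).hom) fun r l => IsCoord.hom_univCoord _ r l
      have h4 := ((Z.isPullbackAlong_pb i).unique h2).comp h3
      rwa [Category.id_comp] at h4

end Cell

end

/-! ### Gluing families and representing objects. -/

section Glue

/-- The legs of both colimits are open immersions, so only ranges have to be compared. A point of
the colimit of `G` lying over the piece F i is, by local directedness, represented over some piece
that maps to F i, and the pullback squares lift it into G i. -/
theorem isPullback_colimMap {J : Type u} [Category.{u} J] [Quiver.IsThin J] (F G : J ⥤ Scheme.{u})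
    [∀ {i j} (f : i ⟶ j), IsOpenImmersion (F.map f)]
    [∀ {i j} (f : i ⟶ j), IsOpenImmersion (G.map f)]
    [(F ⋙ Scheme.forget).IsLocallyDirected] [(G ⋙ Scheme.forget).IsLocallyDirected]
    (τ : G ⟶ F) (hτ : ∀ {i j} (f : i ⟶ j), IsPullback (G.map f) (τ.app i) (τ.app j) (F.map f))
    (i : J) : IsPullback (colimit.ι G i) (τ.app i) (colimMap τ) (colimit.ι F i) := by
  refine (IsOpenImmersion.isPullback _ _ _ _ (by simp) ?_).flip
  ext z
  constructor
  · rintro ⟨x, hx⟩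
    obtain ⟨j, w, rfl⟩ := Scheme.IsLocallyDirected.ι_jointly_surjective G z
    have h1 : colimit.ι F i x = colimit.ι F j (τ.app j w) := by
      refine hx.trans ?_
      rw [← Scheme.Hom.comp_apply, ← Scheme.Hom.comp_apply]
      simp
    obtain ⟨l, fi, fj, y, rfl, hy⟩ := (Scheme.IsLocallyDirected.ι_eq_ι_iff F).1 h1
    obtain ⟨w', hw', -⟩ := Scheme.exists_preimage_of_isPullback (hτ fj) w y hy.symm
    refine ⟨G.map fi w', ?_⟩
    rw [← hw', ← Scheme.Hom.comp_apply, ← Scheme.Hom.comp_apply, colimit.w, colimit.w]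
  · rintro ⟨w, rfl⟩
    refine ⟨τ.app i w, ?_⟩
    rw [← Scheme.Hom.comp_apply, ← Scheme.Hom.comp_apply]
    simp

end Glue

/-- A morphism whose image lies in the range of an open immersion factors through it. -/
theorem exists_lift_of_isOpenImmersion {k : Type u} [Field k]
    {X Y V : Over (Spec (CommRingCat.of k))} (ι : X ⟶ Y)
    [IsOpenImmersion ι.left] (f : V ⟶ Y) (h : ∀ y, f.left y ∈ Set.range ι.left) :
    ∃ g : V ⟶ X, g ≫ ι = f := by
  have h' : Set.range f.left ⊆ Set.range ι.left := by
    rintro _ ⟨y, rfl⟩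
    exact h y
  have h1 := IsOpenImmersion.lift_fac ι.left f.left h'
  refine ⟨Over.homMk (IsOpenImmersion.lift ι.left f.left h') ?_, Over.OverMorphism.ext h1⟩
  rw [← Over.w ι, ← Over.w f, ← Category.assoc, h1]

namespace RelScheme

variable {k : Type u} [Field k] {N n : ℕ}

/-- Bases and total spaces are glued separately as colimits of schemes. Closedness makes the
transition maps of the total spaces unique, hence functorial, and `isPullback_colimMap` shows that
the glued family restricts to the given ones. -/
theorem exists_glue {J : Type u} [Category.{u} J] [Quiver.IsThin J]
    (F : J ⥤ Over (Spec (CommRingCat.of k)))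
    (hF : ∀ {i j} (f : i ⟶ j), IsOpenImmersion (F.map f).left)
    (hF' : ((F ⋙ Over.forget _) ⋙ Scheme.forget).IsLocallyDirected)
    (U : ∀ i, RelScheme k N n (F.obj i)) (hU : ∀ i, (U i).IsClosedSubscheme)
    (hp : ∀ {i j} (f : i ⟶ j), (U i).IsPullbackAlong (U j) (F.map f)) :
    ∃ (X : Over (Spec (CommRingCat.of k))) (V : RelScheme k N n X) (ι : ∀ i, F.obj i ⟶ X),
      (∀ i, IsOpenImmersion (ι i).left) ∧ (∀ x, ∃ i y, (ι i).left y = x) ∧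
      (∀ {i j} (x : (F.obj i).left) (y : (F.obj j).left), (ι i).left x = (ι j).left y →
        ∃ (l : J) (fi : l ⟶ i) (fj : l ⟶ j) (z : (F.obj l).left),
          (F.map fi).left z = x ∧ (F.map fj).left z = y) ∧
      (∀ {i j} (f : i ⟶ j), F.map f ≫ ι j = ι i) ∧
      ∀ i, (U i).IsPullbackAlong V (ι i) := by
  choose m hm hm' using @hp
  let F₀ : J ⥤ Scheme.{u} := F ⋙ Over.forget _
  let G : J ⥤ Over (Spec (CommRingCat.of k)) :=
    { obj := fun i => (U i).Z
      map := fun f => m f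
      map_id := fun i => (hU i).hom_ext (by rw [(hm _).w]; simp) (by rw [hm']; simp)
      map_comp := fun {i j l} f g => (hU l).hom_ext
        (by rw [(hm _).w, Category.assoc, (hm _).w, reassoc_of% (hm f).w, F.map_comp])
        (by rw [hm', Category.assoc, hm', hm']) }
  let G₀ : J ⥤ Scheme.{u} := G ⋙ Over.forget _
  let τ : G₀ ⟶ F₀ :=
    { app := fun i => (U i).toBase.left
      naturality := fun i j f => by
        have := (hm f).w
        exact congr($(this).left) }
  have hτ : ∀ {i j} (f : i ⟶ j), IsPullback (G₀.map f) (τ.app i) (τ.app j) (F₀.map f) :=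
    fun f => isPullback_left (hm f)
  have i1 : ∀ {i j} (f : i ⟶ j), IsOpenImmersion (F₀.map f) := fun f => hF f
  have i2 : ∀ {i j} (f : i ⟶ j), IsOpenImmersion (G₀.map f) := fun f =>
    MorphismProperty.of_isPullback (P := @IsOpenImmersion) (hτ f).flip (i1 f)
  have i3 : (F₀ ⋙ Scheme.forget).IsLocallyDirected := hF'
  have i4 : (G₀ ⋙ Scheme.forget).IsLocallyDirected :=
    Scheme.isLocallyDirected_of_equifibered_of_injective τ (fun _ _ f => hτ f)
      fun f => (G₀.map f).isOpenEmbedding.injective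
  let cX : Cocone F₀ := ⟨Spec (CommRingCat.of k),
    { app := fun i => (F.obj i).hom, naturality := fun i j f => by
        exact (Over.w (F.map f)).trans (Category.comp_id _).symm }⟩
  let cZ : Cocone G₀ := ⟨Spec (CommRingCat.of k),
    { app := fun i => (G.obj i).hom, naturality := fun i j f => by
        exact (Over.w (G.map f)).trans (Category.comp_id _).symm }⟩
  let cT : Cocone G₀ := ⟨(specOver k (TruncRing k N n)).left,
    { app := fun i => (U i).toTrunc.left, naturality := fun i j f => by
        have := hm' f
        exact congr($(this).left).trans (Category.comp_id _).symm }⟩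
  let X : Over (Spec (CommRingCat.of k)) := Over.mk (colimit.desc F₀ cX)
  let Z : Over (Spec (CommRingCat.of k)) := Over.mk (colimit.desc G₀ cZ)
  let ι : ∀ i, F.obj i ⟶ X := fun i => Over.homMk (colimit.ι F₀ i) (colimit.ι_desc cX i)
  let κ : ∀ i, G.obj i ⟶ Z := fun i => Over.homMk (colimit.ι G₀ i) (colimit.ι_desc cZ i)
  let V : RelScheme k N n X := ⟨Z, Over.homMk (colimMap τ) (by
      refine colimit.hom_ext fun i => ?_
      refine Eq.trans ?_ (colimit.ι_desc cZ i).symm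
      refine (ι_colimMap_assoc _ _ _).trans ?_
      exact congr(τ.app i ≫ $(colimit.ι_desc cX i)).trans (Over.w (U i).toBase)),
    Over.homMk (colimit.desc G₀ cT) (by
      refine colimit.hom_ext fun i => ?_
      refine Eq.trans ?_ (colimit.ι_desc cZ i).symm
      refine (colimit.ι_desc_assoc cT _ _).trans ?_
      exact Over.w (U i).toTrunc)⟩
  refine ⟨X, V, ι, fun i => ?_, fun x => ?_, fun x y h => ?_, fun f => ?_,
    fun i => ⟨κ i, ?_, ?_⟩⟩
  · exact inferInstanceAs (IsOpenImmersion (colimit.ι F₀ i))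
  · exact Scheme.IsLocallyDirected.ι_jointly_surjective F₀ x
  · exact (Scheme.IsLocallyDirected.ι_eq_ι_iff F₀).1 h
  · ext1
    exact colimit.w F₀ f
  · exact isPullback_of_left (isPullback_colimMap F₀ G₀ τ hτ i)
  · ext1
    exact colimit.ι_desc cT i

/-- The restriction of a universal family to an open subscheme whose definition is compatible with
base change represents the families all of whose points lie in it. -/
theorem Represents.restrict {X : Over (Spec (CommRingCat.of k))} {U : RelScheme k N n X}
    {P : ∀ S : Over (Spec (CommRingCat.of k)), RelScheme k N n S → Prop} (hU : U.Represents P)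
    (hU' : U.IsClosedSubscheme)
    (hP : ∀ {S S' : Over (Spec (CommRingCat.of k))} {Z : RelScheme k N n S}
      {Z' : RelScheme k N n S'} {f : S' ⟶ S}, Z'.IsPullbackAlong Z f → P S Z → P S' Z')
    (C : ∀ {S : Over (Spec (CommRingCat.of k))}, RelScheme k N n S → Set S.left)
    (hC : ∀ {S S' : Over (Spec (CommRingCat.of k))} {Z' : RelScheme k N n S'}
      {Z : RelScheme k N n S} {f : S' ⟶ S}, Z'.IsPullbackAlong Z f → Z.IsClosedSubscheme →
        ∀ x : S'.left, f.left x ∈ C Z ↔ x ∈ C Z')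
    (O : X.left.Opens) (hO : ∀ x, x ∈ O ↔ x ∈ C U) :
    (U.pb (restrι X O)).Represents fun S Z => P S Z ∧ ∀ x : S.left, x ∈ C Z := by
  have hpb := U.isPullbackAlong_pb (restrι X O)
  refine ⟨⟨hP hpb hU.prop, fun x => ?_⟩, fun S Z ⟨hZ, hx⟩ => ?_⟩
  · exact (hC hpb hU' x).1 ((hO _).1 (restr_hom_apply_mem O x))
  · obtain ⟨f, hf, hf'⟩ := hU.existsUnique S Z hZ
    obtain ⟨g, hg⟩ := exists_lift_restr f O fun y => (hO _).2 ((hC hf hU' y).2 (hx y))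
    refine ⟨g, IsPullbackAlong.of_comp (by rwa [hg]) hpb, fun g' hg' => ?_⟩
    rw [← cancel_mono (restrι X O), hg]
    exact hf' _ (hg'.comp hpb)

/-- The restriction of a universal family to the open subscheme on which the elements of each set
in `T` span represents the families for which they do. -/
theorem Represents.restr {X : Over (Spec (CommRingCat.of k))} {U : RelScheme k N n X}
    {P : ∀ S : Over (Spec (CommRingCat.of k)), RelScheme k N n S → Prop} (hU : U.Represents P)
    (hU' : U.IsClosedSubscheme)
    (hP : ∀ {S S' : Over (Spec (CommRingCat.of k))} {Z : RelScheme k N n S}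
      {Z' : RelScheme k N n S'} {f : S' ⟶ S}, Z'.IsPullbackAlong Z f → P S Z → P S' Z')
    (T : Set (Set (PS N k))) (O : X.left.Opens) (hO : ∀ x, x ∈ O ↔ ∀ V ∈ T, x ∈ U.locus V) :
    (U.pb (restrι X O)).Represents fun S Z => P S Z ∧ ∀ V ∈ T, ∀ x : S.left, x ∈ Z.locus V := by
  have h := hU.restrict hU' hP (fun Z => {x | ∀ V ∈ T, x ∈ Z.locus V})
    (fun h hZ x => forall₂_congr fun V _ => h.mem_locus_iff hZ V x) O hO
  exact ⟨⟨h.prop.1, fun V hV x => h.prop.2 x V hV⟩, fun S Z hZ => h.existsUnique S Z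
    ⟨hZ.1, fun x V hV => hZ.2 V hV x⟩⟩

theorem Represents.of_iff {X : Over (Spec (CommRingCat.of k))} {U : RelScheme k N n X}
    {P P' : ∀ S : Over (Spec (CommRingCat.of k)), RelScheme k N n S → Prop} (hU : U.Represents P)
    (h : ∀ S Z, P S Z ↔ P' S Z) : U.Represents P' :=
  ⟨(h _ _).1 hU.prop, fun S Z hZ => hU.existsUnique S Z ((h _ _).2 hZ)⟩

theorem Represents.hom_ext {X S : Over (Spec (CommRingCat.of k))} {U : RelScheme k N n X}
    {P : ∀ S : Over (Spec (CommRingCat.of k)), RelScheme k N n S → Prop} (hU : U.Represents P)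
    {Z : RelScheme k N n S} (hZ : P S Z) {f g : S ⟶ X} (hf : Z.IsPullbackAlong U f)
    (hg : Z.IsPullbackAlong U g) : f = g :=
  (hU.existsUnique S Z hZ).unique hf hg

/-- Two representing objects are isomorphic. -/
theorem Represents.exists_iso {X X' : Over (Spec (CommRingCat.of k))} {U : RelScheme k N n X}
    {U' : RelScheme k N n X'}
    {P : ∀ S : Over (Spec (CommRingCat.of k)), RelScheme k N n S → Prop} (hU : U.Represents P)
    (hU' : U'.Represents P) : ∃ e : X ≅ X', U.IsPullbackAlong U' e.hom := by
  obtain ⟨f, hf, -⟩ := hU'.existsUnique X U hU.prop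
  obtain ⟨g, hg, -⟩ := hU.existsUnique X' U' hU'.prop
  exact ⟨⟨f, g, hU.hom_ext hU.prop (hf.comp hg) (IsPullbackAlong.refl _),
    hU'.hom_ext hU'.prop (hg.comp hf) (IsPullbackAlong.refl _)⟩, hf⟩

theorem isAdmissible_of_local {S : Over (Spec (CommRingCat.of k))} {p : ℕ → ℤ} {t₀ : ℕ}
    {Z : RelScheme k N n S}
    (h : ∀ x : S.left, ∃ (V : Over (Spec (CommRingCat.of k))) (j : V ⟶ S),
      IsOpenImmersion j.left ∧ x ∈ Set.range j.left ∧ (Z.pb j).IsAdmissible p t₀) :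
    Z.IsAdmissible p t₀ := by
  refine ⟨isClosedSubscheme_of_local fun x => ?_, isFlatOfLength_of_local fun x => ?_,
    fun t h₀ ht => isFlatOfLength_of_local fun x => ?_⟩ <;> obtain ⟨V, j, hj, hx, h1⟩ := h x
  · exact ⟨V, j, hj, hx, h1.closed⟩
  · exact ⟨V, j, hj, hx, h1.flat⟩
  · refine ⟨V, j, hj, hx, IsPullbackAlong.isFlatOfLength (Z := (Z.pb j).trunc t ht) (f := 𝟙 _) ?_
      (h1.trunc t h₀ ht)⟩
    exact ((Z.trunc t ht).isPullbackAlong_pb j).unique ((Z.isPullbackAlong_pb j).trunc t ht)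

/-- Families covered by cells are representable. -/
theorem exists_represents_of_cells {p : ℕ → ℤ} {t₀ : ℕ}
    (hcov : ∀ {S : Over (Spec (CommRingCat.of k))} {Z : RelScheme k N n S}, Z.IsAdmissible p t₀ →
      ∀ x, ∃ c : Cell k N n p t₀, x ∈ Z.locus (Set.range c.v)) :
    ∃ (X : Over (Spec (CommRingCat.of k))) (U : RelScheme k N n X),
      U.Represents fun _ Z => Z.IsAdmissible p t₀ := by
  classical
  -- Finite sets of cells are used instead of single cells so that intersections of charts are
  -- objects of the diagram. More cells mean a smaller open subscheme, whence the dual order.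
  let J := {s : Finset (Cell k N n p t₀) // s.Nonempty}ᵒᵈ
  let T : J → Set (Set (PS N k)) := fun s =>
    {V | ∃ c ∈ (OrderDual.ofDual s).1, V = Set.range c.v}
  let P : J → ∀ S : Over (Spec (CommRingCat.of k)), RelScheme k N n S → Prop := fun s S Z =>
    Z.IsAdmissible p t₀ ∧ ∀ V ∈ T s, ∀ x : S.left, x ∈ Z.locus V
  have hPmono : ∀ {s s' : J} (_ : s ≤ s') {S : Over (Spec (CommRingCat.of k))}
      {Z : RelScheme k N n S}, P s S Z → P s' S Z := fun {s s'} h S Z hZ =>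
    ⟨hZ.1, fun V ⟨c, hc, hV⟩ => hZ.2 V ⟨c, h hc, hV⟩⟩
  have hP : ∀ {s : J} {S S' : Over (Spec (CommRingCat.of k))} {Z : RelScheme k N n S}
      {Z' : RelScheme k N n S'} {f : S' ⟶ S}, Z'.IsPullbackAlong Z f → P s S Z → P s S' Z' :=
    fun h hZ => ⟨h.isAdmissible hZ.1, fun V hV x => (h.mem_locus_iff hZ.1.closed _ _).1 (hZ.2 V hV _)⟩
  have hopen : ∀ (s : J) {X : Over (Spec (CommRingCat.of k))} (U : RelScheme k N n X),
      U.IsClosedSubscheme → ∃ O : X.left.Opens, ∀ x, x ∈ O ↔ ∀ V ∈ T s, x ∈ U.locus V := by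
    intro s X U hU
    refine ⟨⟨⋂ c ∈ (OrderDual.ofDual s).1, U.locus (Set.range c.v),
      isOpen_biInter_finset fun c _ => isOpen_locus hU _⟩, fun x => ?_⟩
    change x ∈ ⋂ c ∈ (OrderDual.ofDual s).1, U.locus (Set.range c.v) ↔ _
    rw [Set.mem_iInter₂]
    exact ⟨fun h V ⟨c, hc, hV⟩ => hV ▸ h c hc, fun h c hc => h _ ⟨c, hc, rfl⟩⟩
  have hex : ∀ s : J, ∃ (X : Over (Spec (CommRingCat.of k))) (U : RelScheme k N n X),
      U.Represents (P s) := by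
    intro s
    -- Any one cell of `s` supplies an affine ambient scheme, in which the remaining cells cut out
    -- an open subset.
    obtain ⟨c, hc⟩ := (OrderDual.ofDual s).2
    obtain ⟨U, hU⟩ := c.exists_represents
    obtain ⟨O, hO⟩ := hopen s U hU.prop.1.closed
    refine ⟨_, _, (hU.restr hU.prop.1.closed (fun h hZ => ⟨h.isAdmissible hZ.1, fun x =>
      (h.mem_locus_iff hZ.1.closed _ _).1 (hZ.2 _)⟩) (T s) O hO).of_iff fun S Z =>
        ⟨fun h => ⟨h.1.1, h.2⟩, fun h => ⟨⟨h.1, h.2 _ ⟨c, hc, rfl⟩⟩, h.2⟩⟩⟩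
  choose X U hU using hex
  have hmap : ∀ {s s' : J} (_ : s ≤ s'), ∃ f : X s ⟶ X s', (U s).IsPullbackAlong (U s') f :=
    fun h => ((hU _).existsUnique _ _ (hPmono h (hU _).prop)).exists
  choose m hm using @hmap
  let F : J ⥤ Over (Spec (CommRingCat.of k)) :=
    { obj := X
      map := fun f => m f.le
      map_id := fun s => (hU s).hom_ext (hU s).prop (hm _) (IsPullbackAlong.refl _)
      map_comp := fun {s s' s''} f g => (hU s'').hom_ext (hPmono (f ≫ g).le (hU s).prop) (hm _)
        ((hm _).comp (hm _)) }
  -- the transition maps are open immersions onto the loci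
  have hloc : ∀ {s s' : J} (h : s ≤ s'), IsOpenImmersion (m h).left ∧
      ∀ x : (X s').left, (∀ V ∈ T s, x ∈ (U s').locus V) → x ∈ Set.range (m h).left := by
    intro s s' h
    obtain ⟨O, hO⟩ := hopen s (U s') (hU s').prop.1.closed
    have h1 := ((hU s').restr (hU s').prop.1.closed (fun h hZ => hP h hZ) (T s) O hO).of_iff
      (P' := P s) fun S Z => ⟨fun h => ⟨h.1.1, h.2⟩, fun hZ => ⟨hPmono h hZ, hZ.2⟩⟩
    obtain ⟨e, he⟩ := (hU s).exists_iso h1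
    have h2 : m h = e.hom ≫ restrι _ O := (hU s').hom_ext (hPmono h (hU s).prop) (hm h)
      (he.comp ((U s').isPullbackAlong_pb _))
    have h3 : (m h).left = e.hom.left ≫ (restrι _ O).left := congr($(h2).left)
    have hiso : IsIso e.hom.left := ((Over.forget _).mapIso e).isIso_hom
    refine ⟨?_, fun x hx => ?_⟩
    · rw [h3]
      infer_instance
    · have hx' : x ∈ Set.range (restrι _ O).left := by
        rw [range_restrι]
        exact (hO x).2 hx
      obtain ⟨y, rfl⟩ := hx'
      obtain ⟨z, rfl⟩ := e.hom.left.surjective y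
      refine ⟨z, ?_⟩
      rw [h3, Scheme.Hom.comp_apply]
  let un : J → J → J := fun s s' => OrderDual.toDual
    ⟨(OrderDual.ofDual s).1 ∪ (OrderDual.ofDual s').1, (OrderDual.ofDual s).2.mono Finset.subset_union_left⟩
  have hun₁ : ∀ s s', un s s' ≤ s := fun s s' => Finset.subset_union_left (s₂ := (OrderDual.ofDual s').1)
  have hun₂ : ∀ s s', un s s' ≤ s' := fun s s' =>
    Finset.subset_union_right (s₁ := (OrderDual.ofDual s).1)
  have hunT : ∀ {s s' V}, V ∈ T (un s s') → V ∈ T s ∨ V ∈ T s' := by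
    rintro s s' V ⟨c, hc, hV⟩
    rcases Finset.mem_union.1 hc with h | h
    · exact Or.inl ⟨c, h, hV⟩
    · exact Or.inr ⟨c, h, hV⟩
  have hdir : ((F ⋙ Over.forget _) ⋙ Scheme.forget).IsLocallyDirected := by
    refine ⟨fun {s s' s''} f g x y hxy => ?_⟩
    change (m f.le).left x = (m g.le).left y at hxy
    -- Points of two charts with the same image satisfy the conditions of both, so they come from
    -- the chart of the union.
    obtain ⟨z, hz⟩ := (hloc (hun₁ s s')).2 x fun V hV => by
      rcases hunT hV with h | h
      · exact (hU s).prop.2 V h x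
      · refine ((hm f.le).mem_locus_iff (hU s'').prop.1.closed V x).1 ?_
        rw [hxy]
        exact ((hm g.le).mem_locus_iff (hU s'').prop.1.closed V y).2 ((hU s').prop.2 V h y)
    refine ⟨un s s', homOfLE (hun₁ s s'), homOfLE (hun₂ s s'), z, hz, ?_⟩
    have := (hloc g.le).1
    refine (m g.le).left.isOpenEmbedding.injective ?_
    refine Eq.trans ?_ hxy
    rw [← hz]
    change (m g.le).left ((m (hun₂ s s')).left z) = _
    rw [← Scheme.Hom.comp_apply, ← Scheme.Hom.comp_apply]
    have h1 : m (hun₂ s s') ≫ m g.le = m (hun₁ s s') ≫ m f.le :=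
      (hU s'').hom_ext (hPmono ((hun₁ s s').trans f.le) (hU _).prop) ((hm _).comp (hm _))
        ((hm _).comp (hm _))
    have h2 := congr($(h1).left)
    rw [Over.comp_left, Over.comp_left] at h2
    rw [h2]
  obtain ⟨Y, V, ι, hι, hsurj, -, hcomp, hV⟩ := exists_glue F (fun f => (hloc f.le).1) hdir U
    (fun s => (hU s).prop.1.closed) (fun f => hm f.le)
  have hVadm : V.IsAdmissible p t₀ := by
    refine isAdmissible_of_local fun x => ?_
    obtain ⟨s, y, rfl⟩ := hsurj x
    exact ⟨_, ι s, hι s, ⟨y, rfl⟩,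
      ((V.isPullbackAlong_pb (ι s)).unique (hV s)).isAdmissible (hU s).prop.1⟩
  let sg : Cell k N n p t₀ → J := fun c => OrderDual.toDual ⟨{c}, Finset.singleton_nonempty c⟩
  have hsgT : ∀ c V, V ∈ T (sg c) ↔ V = Set.range c.v := fun c V =>
    ⟨fun ⟨c', hc', h⟩ => by rw [h, Finset.mem_singleton.1 hc'],
      fun h => ⟨c, Finset.mem_singleton_self c, h⟩⟩
  have hrange : ∀ c x, x ∈ V.locus (Set.range c.v) → x ∈ Set.range (ι (sg c)).left := by
    intro c x hx
    obtain ⟨s, y, rfl⟩ := hsurj x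
    obtain ⟨z, rfl⟩ := (hloc (hun₁ s (sg c))).2 y fun W hW => by
      rcases hunT hW with h | h
      · exact (hU s).prop.2 W h y
      · rw [(hsgT c W).1 h]
        exact ((hV s).mem_locus_iff hVadm.closed _ y).1 hx
    refine ⟨(m (hun₂ s (sg c))).left z, ?_⟩
    have h2 := congr($((hcomp (homOfLE (hun₁ s (sg c)))).trans
      (hcomp (homOfLE (hun₂ s (sg c)))).symm).left)
    rw [Over.comp_left, Over.comp_left] at h2
    exact congr($(h2) z).symm
  refine ⟨Y, V, hVadm, fun S Z hZ => exists_classifying_of_local hVadm.closed hZ.closed ?_ ?_⟩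
  · intro S' j f f' hf hf'
    have hZj := (Z.isPullbackAlong_pb j).isAdmissible hZ
    refine hom_ext_of_local fun y => ?_
    -- Near `y` one cell is a basis; there both morphisms land in the chart of that cell, where
    -- representability decides.
    obtain ⟨c, hc⟩ := hcov hZj y
    let O : S'.left.Opens := ⟨_, isOpen_locus hZj.closed (Set.range c.v)⟩
    refine ⟨_, restrι S' O, inferInstance, by rwa [range_restrι], ?_⟩
    have hpb := (Z.pb j).isPullbackAlong_pb (restrι S' O)
    have key : ∀ g : S' ⟶ Y, (Z.pb j).IsPullbackAlong V g → ∃ g₀ : restr S' O ⟶ X (sg c),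
        g₀ ≫ ι (sg c) = restrι S' O ≫ g ∧
          ((Z.pb j).pb (restrι S' O)).IsPullbackAlong (U (sg c)) g₀ := by
      intro g hg
      have := hι (sg c)
      obtain ⟨g₀, h₀⟩ := exists_lift_of_isOpenImmersion (ι (sg c)) (restrι S' O ≫ g) fun x => by
        refine hrange c _ (((hpb.comp hg).mem_locus_iff hVadm.closed _ x).2 ?_)
        exact (hpb.mem_locus_iff hZj.closed _ x).1 (restr_hom_apply_mem O x)
      exact ⟨g₀, h₀, IsPullbackAlong.of_comp (by rw [h₀]; exact hpb.comp hg) (hV (sg c))⟩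
    obtain ⟨g, hg, hg'⟩ := key f hf
    obtain ⟨g₁, hg₁, hg₁'⟩ := key f' hf'
    rw [← hg, ← hg₁, (hU (sg c)).hom_ext ⟨hpb.isAdmissible hZj, fun W hW x => ?_⟩ hg' hg₁']
    rw [(hsgT c W).1 hW]
    exact (hpb.mem_locus_iff hZj.closed _ x).1 (restr_hom_apply_mem O x)
  · intro x
    obtain ⟨c, hc⟩ := hcov hZ x
    let O : S.left.Opens := ⟨_, isOpen_locus hZ.closed (Set.range c.v)⟩
    have hpb := Z.isPullbackAlong_pb (restrι S O)
    obtain ⟨g, hg, -⟩ := (hU (sg c)).existsUnique _ (Z.pb (restrι S O))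
      ⟨hpb.isAdmissible hZ, fun W hW x => by
        rw [(hsgT c W).1 hW]
        exact (hpb.mem_locus_iff hZ.closed _ x).1 (restr_hom_apply_mem O x)⟩
    exact ⟨_, restrι S O, inferInstance, by rwa [range_restrι], g ≫ ι (sg c), hg.comp (hV _)⟩

end RelScheme

/-! ### Bases adapted to a filtration. -/

section LinearAlgebra

variable {K Q : Type*} [Field K] [AddCommGroup Q] [Module K Q]

/-- A linearly independent set adapted to the filtration given by the spans of `V t`. -/
theorem exists_adapted_set (V : ℕ → Set Q) (hV : Antitone V) (n : ℕ)
    (hn : Submodule.span K (V n) = ⊥) (t : ℕ) (ht : t ≤ n) :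
    ∃ (s : Set Q) (δ : Q → ℕ), LinearIndepOn K id s ∧ (∀ q ∈ s, q ∈ V (δ q) ∧ t ≤ δ q) ∧
      ∀ r, t ≤ r → r ≤ n → Submodule.span K {q ∈ s | r ≤ δ q} = Submodule.span K (V r) := by
  classical
  -- The set is built from the deepest step of the filtration outwards: the set for t + 1 is
  -- extended inside V t, and the new elements receive the value t.
  induction ht using Nat.decreasingInduction with
  | self =>
    refine ⟨∅, fun _ => 0, linearIndepOn_empty K _, by simp, fun r h₁ h₂ => ?_⟩
    rw [le_antisymm h₂ h₁, hn]
    simp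
  | of_succ t ht ih =>
    obtain ⟨s, δ, hs, hδ, hr⟩ := ih
    obtain ⟨b, hbs, hsb, hspan, hb⟩ := exists_linearIndepOn_id_extension hs
      (Set.subset_union_left (t := V t))
    have hbV : ∀ q ∈ b, q ∉ s → q ∈ V t := fun q hq hqs => (hbs hq).resolve_left hqs
    refine ⟨b, fun q => if q ∈ s then δ q else t, hb, fun q hq => ?_, fun r h₁ h₂ => ?_⟩
    · by_cases hqs : q ∈ s
      · simp only [hqs, if_true]
        exact ⟨(hδ q hqs).1, (Nat.le_succ t).trans (hδ q hqs).2⟩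
      · simp only [hqs, if_false]
        exact ⟨hbV q hq hqs, le_rfl⟩
    · rcases h₁.eq_or_lt with rfl | h₁
      · have : {q ∈ b | t ≤ if q ∈ s then δ q else t} = b := by
          refine Set.sep_eq_self_iff_mem_true.2 fun q hq => ?_
          by_cases hqs : q ∈ s
          · simp only [hqs, if_true]
            exact (Nat.le_succ t).trans (hδ q hqs).2
          · simp [hqs]
        rw [this]
        refine le_antisymm (Submodule.span_mono fun q hq => ?_)
          (Submodule.span_le.2 (Set.subset_union_right.trans hspan))
        by_cases hqs : q ∈ s
        · exact hV ((Nat.le_succ t).trans (hδ q hqs).2) (hδ q hqs).1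
        · exact hbV q hq hqs
      · rw [← hr r h₁ h₂]
        congr 1
        ext q
        constructor
        · rintro ⟨hq, hq'⟩
          by_cases hqs : q ∈ s
          · exact ⟨hqs, by simpa [hqs] using hq'⟩
          · simp only [hqs, if_false] at hq'
            omega
        · rintro ⟨hq, hq'⟩
          exact ⟨hsb hq, by simpa [hq] using hq'⟩

/-- A basis adapted to the filtration given by the spans of `V t`. -/
theorem exists_adapted_basis [Module.Finite K Q] (V : ℕ → Set Q) (hV : Antitone V) (n : ℕ)
    (hn : Submodule.span K (V n) = ⊥) (h0 : Submodule.span K (V 0) = ⊤) :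
    ∃ (v : Fin (Module.finrank K Q) → Q) (δ : Fin (Module.finrank K Q) → ℕ),
      (∀ i, v i ∈ V (δ i)) ∧ Submodule.span K (Set.range v) = ⊤ ∧
      ∀ r ≤ n, Fintype.card {i // δ i < r} = Module.finrank K (Q ⧸ Submodule.span K (V r)) := by
  classical
  obtain ⟨s, δ, hs, hδ, hr⟩ := exists_adapted_set (K := K) V hV n hn 0 n.zero_le
  have hs0 : Submodule.span K s = ⊤ := by
    rw [← h0, ← hr 0 le_rfl n.zero_le]
    simp
  let b : Module.Basis s K Q := Module.Basis.mk hs (by simp [hs0])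
  have : Finite s := Module.Finite.finite_basis b
  have := Fintype.ofFinite s
  let e : Fin (Module.finrank K Q) ≃ s :=
    (finCongr (Module.finrank_eq_card_basis b)).trans (Fintype.equivFin s).symm
  refine ⟨fun i => (e i : Q), fun i => δ (e i), fun i => (hδ _ (e i).2).1, ?_, fun r hrn => ?_⟩
  · rw [← hs0]
    congr 1
    have := e.surjective.range_comp (Subtype.val : s → Q)
    simpa [Function.comp_def] using this
  · have h1 : Module.finrank K (Submodule.span K (V r)) =
        Fintype.card {i : Fin (Module.finrank K Q) // r ≤ δ (e i)} := by
      have hli : LinearIndependent K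
          (fun i : {i : Fin (Module.finrank K Q) // r ≤ δ (e i)} => (e i : Q)) :=
        hs.comp (fun i : {i : Fin (Module.finrank K Q) // r ≤ δ (e i)} => e i)
          (e.injective.comp Subtype.val_injective)
      have hset : {q ∈ s | r ≤ δ q} =
          Set.range (fun i : {i : Fin (Module.finrank K Q) // r ≤ δ (e i)} => (e i : Q)) := by
        ext q
        constructor
        · rintro ⟨hq, hq'⟩
          exact ⟨⟨e.symm ⟨q, hq⟩, by simpa using hq'⟩, by simp⟩
        · rintro ⟨⟨i, hi⟩, rfl⟩
          exact ⟨(e i).2, hi⟩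
      rw [← finrank_span_eq_card hli, ← hr r r.zero_le hrn, hset]
    have h2 := Submodule.finrank_quotient_add_finrank (Submodule.span K (V r))
    have h3 := Fintype.card_subtype_compl (fun i : Fin (Module.finrank K Q) => r ≤ δ (e i))
    simp only [not_le, Fintype.card_fin] at h3
    have h4 := Fintype.card_subtype_le (fun i : Fin (Module.finrank K Q) => r ≤ δ (e i))
    rw [Fintype.card_fin] at h4
    change Fintype.card {i : Fin (Module.finrank K Q) // δ (e i) < r} = _
    omega

end LinearAlgebra

/-- Every point of a `k`-scheme is the image of a point with values in a field. -/
theorem exists_field_point {k : Type u} [Field k] (S : Over (Spec (CommRingCat.of k))) (x : S.left) :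
    ∃ (K : Type u) (_ : Field K) (_ : Algebra k K) (j : specOver k K ⟶ S),
      ∀ y, j.left y = x := by
  obtain ⟨g, hg⟩ := Spec.map_surjective (R := CommRingCat.of k) (S := S.left.residueField x)
    (S.left.fromSpecResidueField x ≫ S.hom)
  let _ : Algebra k (S.left.residueField x) := g.hom.toAlgebra
  refine ⟨S.left.residueField x, inferInstance, inferInstance,
    Over.homMk (S.left.fromSpecResidueField x) hg.symm, fun y => ?_⟩
  exact S.left.fromSpecResidueField_apply x y

namespace RelScheme

variable {k : Type u} [Field k] {N n : ℕ}

/-- The fibre of an admissible family at a point. -/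
theorem IsAdmissible.exists_fiber {p : ℕ → ℤ} {t₀ : ℕ} {S : Over (Spec (CommRingCat.of k))}
    {Z : RelScheme k N n S} (hZ : Z.IsAdmissible p t₀) (x : S.left) :
    ∃ (K : Type u) (_ : Field K) (Q : Type u) (_ : Algebra k K) (_ : CommRing Q) (_ : Algebra k Q)
      (_ : Algebra K Q) (_ : IsScalarTower k K Q) (g : TruncRing k N n →ₐ[k] Q),
      Submodule.span K (Set.range g) = ⊤ ∧ Module.Finite K Q ∧ (Module.finrank K Q : ℤ) = p n ∧
      (∀ t, t₀ ≤ t → t ≤ n → (Module.finrank K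
        (Q ⧸ Submodule.span K (psHom g '' (varIdeal N k ^ t : Ideal (PS N k)))) : ℤ) = p t) ∧
      ∀ V, x ∈ Z.locus V ↔ Submodule.span K (psHom g '' V) = ⊤ := by
  obtain ⟨K, _, _, j, hj⟩ := exists_field_point S x
  obtain ⟨Q, _, _, _, _, g, h1, h2⟩ := hZ.closed.exists_ofAlg_along j
  have hfin := finite_of_span_range h1
  have hadm := h2.isAdmissible hZ
  let y : PrimeSpectrum K := ⊥
  have hrank : ∀ (M : Type u) [AddCommGroup M] [Module K M] [Module.Finite K M],
      Module.rankAtStalk M y = Module.finrank K M := fun M _ _ _ =>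
    congrFun (Module.rankAtStalk_eq_finrank_of_free (R := K) (M := M)) y
  refine ⟨K, _, Q, _, _, _, _, inferInstance, g, h1, hfin, ?_, fun t h₀ ht => ?_, fun V => ?_⟩
  · rw [← (isFlatOfLength_ofAlg_iff.1 hadm.flat).2.2 y, hrank]
  · have h3 := (ofAlg_trunc h2 ht).isFlatOfLength (hZ.trunc t h₀ ht)
    obtain ⟨h4, -, h5⟩ := isFlatOfLength_ofAlg_iff.1 h3
    rw [← h5 y, hrank]
    have h6 : Submodule.span K (psHom g '' (varIdeal N k ^ t : Ideal (PS N k))) =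
        ((powIdeal k N n t).map g).restrictScalars K := by
      ext z
      exact (mem_map_powIdeal_iff h1).symm
    rw [h6]
    rfl
  · rw [← mem_spanLocus_iff_span y]
    exact (Iff.of_eq (congrArg (· ∈ Z.locus V) (hj y).symm)).trans (mem_locus_iff h2 V y)

/-- The adapted basis of the fibre can be chosen among images of power series over k, even if the
residue field is larger, because these images span each step of the filtration. The lengths of the
truncations give the required counts. -/
theorem IsAdmissible.exists_cell {p : ℕ → ℤ} {t₀ : ℕ} {S : Over (Spec (CommRingCat.of k))}
    {Z : RelScheme k N n S} (hZ : Z.IsAdmissible p t₀) (x : S.left) :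
    ∃ c : Cell k N n p t₀, x ∈ Z.locus (Set.range c.v) := by
  obtain ⟨K, _, Q, _, _, _, _, _, g, h1, h2, h3, h4, h5⟩ := hZ.exists_fiber x
  obtain ⟨v, δ, hv, hspan, hcard⟩ := exists_adapted_basis (K := K)
    (fun t => psHom g '' (varIdeal N k ^ t : Ideal (PS N k)))
    (fun s t h => Set.image_mono (Ideal.pow_le_pow_right h)) n (by
      rw [Submodule.span_eq_bot]
      rintro _ ⟨a, ha, rfl⟩
      change g (Ideal.Quotient.mk _ a) = 0
      rw [Ideal.Quotient.eq_zero_iff_mem.2 ha, map_zero]) (by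
      rw [eq_top_iff, ← h1]
      refine Submodule.span_mono ?_
      rintro _ ⟨r, rfl⟩
      obtain ⟨r, rfl⟩ := Ideal.Quotient.mk_surjective r
      exact ⟨r, by simp, rfl⟩)
  choose w hw hwv using hv
  refine ⟨⟨_, w, δ, hw, h3, fun t h₀ ht => ?_⟩, (h5 _).2 ?_⟩
  · rw [hcard t ht, h4 t h₀ ht]
  · rw [← hspan, ← Set.range_comp]
    congr 2
    exact funext hwv

/-- Serves twice: t₀ = n gives the Hilbert scheme, t₀ = e₀ + 1 its stratum W'(n). -/
theorem exists_represents_isAdmissible (k : Type u) [Field k] (N n : ℕ) (p : ℕ → ℤ) (t₀ : ℕ) :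
    ∃ (X : Over (Spec (CommRingCat.of k))) (U : RelScheme k N n X),
      U.Represents fun _ Z => Z.IsAdmissible p t₀ :=
  exists_represents_of_cells fun hZ x => hZ.exists_cell x

end RelScheme

/-! ### Limits of inverse sequences with affine transition morphisms. -/

section SequentialLimits

/-- A limit formed among affine schemes remains a limit among all schemes. -/
theorem hasLimit_of_isAffine {J : Type} [SmallCategory J] (F : J ⥤ Scheme.{u})
    (h : ∀ j, IsAffine (F.obj j)) : HasLimit F := by
  let G : J ⥤ AffineScheme.{u} := Scheme.Spec.essImage.lift F fun j => essImage_Spec.2 (h j)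
  have : PreservesLimitsOfSize.{0, 0} AffineScheme.forgetToScheme.{u} :=
    preservesSmallestLimits_of_preservesLimits _
  exact ⟨⟨⟨AffineScheme.forgetToScheme.mapCone (limit.cone G),
    isLimitOfPreserves AffineScheme.forgetToScheme (limit.isLimit G)⟩⟩⟩

theorem hasLimit_over_of_isAffine {B : Scheme.{u}} {J : Type} [SmallCategory J] [IsConnected J]
    (F : J ⥤ Over B) (h : ∀ j, IsAffine (F.obj j).left) : HasLimit F := by
  have : HasLimit (F ⋙ Over.forget B) := hasLimit_of_isAffine _ h
  exact hasLimit_of_created F (Over.forget B)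

theorem exists_cone_ofOpSequence {C : Type*} [Category C] {X : ℕ → C} {a : ∀ m, X (m + 1) ⟶ X m}
    {T : C} (f : ∀ m, T ⟶ X m) (hf : ∀ m, f (m + 1) ≫ a m = f m) :
    ∃ c : Cone (Functor.ofOpSequence a), ∃ h : c.pt = T, ∀ m, c.π.app (op m) = eqToHom h ≫ f m :=
  ⟨⟨T, NatTrans.ofOpSequence f fun n => (Category.id_comp _).trans ((hf n).symm.trans
    congr(f (n + 1) ≫ $((Functor.ofOpSequence_map_homOfLE_succ a n).symm)))⟩, rfl, fun _ => (Category.id_comp _).symm⟩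

theorem cone_ofOpSequence_w {C : Type*} [Category C] {X : ℕ → C} {a : ∀ m, X (m + 1) ⟶ X m}
    (c : Cone (Functor.ofOpSequence a)) (m : ℕ) :
    c.π.app (op (m + 1)) ≫ a m = c.π.app (op m) := by
  rw [← c.w (homOfLE (Nat.le_add_right m 1)).op, Functor.ofOpSequence_map_homOfLE_succ]
  rfl

theorem existsUnique_lift_ofOpSequence {C : Type*} [Category C] {X : ℕ → C}
    {a : ∀ m, X (m + 1) ⟶ X m} {c : Cone (Functor.ofOpSequence a)} (hc : IsLimit c)
    {T : C} (f : ∀ m, T ⟶ X m) (hf : ∀ m, f (m + 1) ≫ a m = f m) :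
    ∃! g : T ⟶ c.pt, ∀ m, g ≫ c.π.app (op m) = f m := by
  obtain ⟨d, rfl, hd⟩ := exists_cone_ofOpSequence f hf
  simp only [eqToHom_refl, Category.id_comp] at hd
  refine ⟨hc.lift d, fun m => (hc.fac d (op m)).trans (hd m), fun g hg => hc.uniq d g fun j => ?_⟩
  exact (hg j.unop).trans (hd j.unop).symm

/-- A morphism of inverse systems induces a morphism to the limit. -/
theorem exists_hom_ofOpSequence {C : Type*} [Category C] {X Y : ℕ → C}
    {a : ∀ m, X (m + 1) ⟶ X m} {b : ∀ m, Y (m + 1) ⟶ Y m} {c : Cone (Functor.ofOpSequence a)}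
    (hc : IsLimit c) (d : Cone (Functor.ofOpSequence b)) (ρ : ∀ m, Y m ⟶ X m)
    (hρ : ∀ m, b m ≫ ρ m = ρ (m + 1) ≫ a m) :
    ∃ φ : d.pt ⟶ c.pt, ∀ m, φ ≫ c.π.app (op m) = d.π.app (op m) ≫ ρ m := by
  let q : ∀ m, d.pt ⟶ Y m := fun m => d.π.app (op m)
  have hq : ∀ m, q (m + 1) ≫ b m = q m := cone_ofOpSequence_w d
  obtain ⟨φ, hφ, -⟩ := existsUnique_lift_ofOpSequence hc (fun m => q m ≫ ρ m) fun m => by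
    rw [Category.assoc, ← hρ, ← Category.assoc, hq]
  exact ⟨φ, hφ⟩

theorem exists_seqLimit_of_hasLimit {C : Type*} [Category C] {X : ℕ → C}
    (a : ∀ m, X (m + 1) ⟶ X m) [HasLimit (Functor.ofOpSequence a)] :
    ∃ (L : C) (π : ∀ m, L ⟶ X m), (∀ m, π (m + 1) ≫ a m = π m) ∧
      ∀ {T : C} (f : ∀ m, T ⟶ X m), (∀ m, f (m + 1) ≫ a m = f m) →
        ∃! g : T ⟶ L, ∀ m, g ≫ π m = f m :=
  ⟨_, fun m => (limit.cone (Functor.ofOpSequence a)).π.app (op m), cone_ofOpSequence_w _,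
    fun f hf => existsUnique_lift_ofOpSequence (limit.isLimit _) f hf⟩

variable {k : Type u} [Field k] {X : ℕ → Over (Spec (CommRingCat.of k))}
  {V V' L L' : Over (Spec (CommRingCat.of k))}

/-- `L` is the limit of the inverse system obtained from `X, a` by base change along `j`. -/
structure IsSeqLimit (a : ∀ m, X (m + 1) ⟶ X m) (j : V ⟶ X 0) (q : L ⟶ V) (π : ∀ m, L ⟶ X m) :
    Prop where
  compat : ∀ m, π (m + 1) ≫ a m = π m
  fac : q ≫ j = π 0
  existsUnique : ∀ {T : Over (Spec (CommRingCat.of k))} (r : T ⟶ V) (f : ∀ m, T ⟶ X m),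
    (∀ m, f (m + 1) ≫ a m = f m) → r ≫ j = f 0 → ∃! g : T ⟶ L, g ≫ q = r ∧ ∀ m, g ≫ π m = f m

variable {a : ∀ m, X (m + 1) ⟶ X m}

/-- The limit over V and the pullback of the limit over V' have the same universal property. This
provides the transition maps along which the local limits are glued. -/
theorem IsSeqLimit.exists_isPullback {j : V ⟶ X 0} {j' : V' ⟶ X 0} {q : L ⟶ V} {q' : L' ⟶ V'}
    {π : ∀ m, L ⟶ X m} {π' : ∀ m, L' ⟶ X m} (h : IsSeqLimit a j q π) (h' : IsSeqLimit a j' q' π')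
    (i : V ⟶ V') (hi : i ≫ j' = j) :
    ∃ m : L ⟶ L', IsPullback m q q' i ∧ ∀ n, m ≫ π' n = π n := by
  obtain ⟨m, ⟨hm, hm'⟩, -⟩ := h'.existsUnique (q ≫ i) π h.compat (by rw [Category.assoc, hi, h.fac])
  refine ⟨m, ⟨⟨hm⟩, ⟨PullbackCone.IsLimit.mk _ (fun s => (h.existsUnique s.snd
    (fun n => s.fst ≫ π' n) (fun n => by rw [Category.assoc, h'.compat])
    (by rw [← h'.fac, ← hi, ← Category.assoc, ← Category.assoc, s.condition])).choose)
    (fun s => ?_) (fun s => ?_) fun s g hg hg' => ?_⟩⟩, hm'⟩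
  all_goals
    have hs := (h.existsUnique s.snd
      (fun n => s.fst ≫ π' n) (fun n => by rw [Category.assoc, h'.compat])
      (by rw [← h'.fac, ← hi, ← Category.assoc, ← Category.assoc, s.condition])).choose_spec
  · refine (h'.existsUnique (s.fst ≫ q') (fun n => s.fst ≫ π' n)
      (fun n => by rw [Category.assoc, h'.compat]) (by rw [Category.assoc, h'.fac])).unique
      ⟨?_, fun n => ?_⟩ ⟨rfl, fun _ => rfl⟩
    · rw [Category.assoc, hm, ← Category.assoc, hs.1.1, s.condition]
    · rw [Category.assoc, hm', hs.1.2]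
  · exact hs.1.1
  · exact hs.2 _ ⟨hg', fun n => by rw [← hg, Category.assoc, hm']⟩

theorem IsSeqLimit.baseChange {j : V ⟶ X 0} {q : L ⟶ V} {π : ∀ m, L ⟶ X m}
    (h : IsSeqLimit a j q π) (i : V' ⟶ V) :
    IsSeqLimit a (i ≫ j) (pullback.snd q i) (fun m => pullback.fst q i ≫ π m) := by
  refine ⟨fun m => by rw [Category.assoc, h.compat], ?_, fun {T} r f hf hr => ?_⟩
  · rw [← Category.assoc, ← pullback.condition, Category.assoc, h.fac]
  · obtain ⟨g, ⟨hg, hg'⟩, hu⟩ := h.existsUnique (r ≫ i) f hf (by rw [Category.assoc, hr])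
    refine ⟨pullback.lift g r hg, ⟨pullback.lift_snd _ _ _, fun m => by
      rw [← Category.assoc, pullback.lift_fst, hg']⟩, fun g' ⟨h1, h2⟩ => ?_⟩
    refine pullback.hom_ext ?_ (by rw [h1, pullback.lift_snd])
    rw [pullback.lift_fst]
    exact hu _ ⟨by rw [Category.assoc, pullback.condition, ← Category.assoc, h1],
      fun m => by rw [Category.assoc, h2]⟩

/-- The composite `X m ⟶ X 0` of the transition morphisms. -/
def toZero (a : ∀ m, X (m + 1) ⟶ X m) : ∀ m, X m ⟶ X 0
  | 0 => 𝟙 _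
  | m + 1 => a m ≫ toZero a m

theorem isAffineHom_toZero (ha : ∀ m, IsAffineHom (a m).left) (m : ℕ) :
    IsAffineHom (toZero a m).left := by
  induction m with
  | zero => exact inferInstanceAs (IsAffineHom (𝟙 (X 0).left))
  | succ m ih =>
    have := ha m
    exact inferInstanceAs (IsAffineHom ((a m).left ≫ (toZero a m).left))

theorem comp_toZero {T : Over (Spec (CommRingCat.of k))} {f : ∀ m, T ⟶ X m}
    (hf : ∀ m, f (m + 1) ≫ a m = f m) (m : ℕ) : f m ≫ toZero a m = f 0 := by
  induction m with
  | zero => exact Category.comp_id _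
  | succ m ih =>
    change f (m + 1) ≫ a m ≫ toZero a m = f 0
    rw [← Category.assoc, hf, ih]

/-- The composites X m → X 0 are affine, so the base change of the system to an affine V consists of
affine schemes. -/
theorem exists_isSeqLimit_of_isAffine (ha : ∀ m, IsAffineHom (a m).left) (j : V ⟶ X 0)
    (hV : IsAffine V.left) :
    ∃ (L : Over (Spec (CommRingCat.of k))) (q : L ⟶ V) (π : ∀ m, L ⟶ X m),
      IsSeqLimit a j q π := by
  let P : ℕ → Over (Spec (CommRingCat.of k)) := fun m => pullback (toZero a m) j
  let b : ∀ m, P (m + 1) ⟶ P m := fun m =>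
    pullback.lift (pullback.fst _ _ ≫ a m) (pullback.snd _ _) (by
      rw [Category.assoc]
      exact pullback.condition)
  have hb₁ : ∀ m, b m ≫ pullback.fst _ _ = pullback.fst _ _ ≫ a m :=
    fun m => pullback.lift_fst _ _ _
  have hb₂ : ∀ m, b m ≫ pullback.snd _ _ = pullback.snd _ _ := fun m => pullback.lift_snd _ _ _
  have hP : ∀ m, IsAffine (P m).left := fun m => by
    have h1 := RelScheme.isPullback_left (IsPullback.of_hasPullback (toZero a m) j)
    have h2 : IsAffineHom (pullback.snd (toZero a m) j).left :=
      MorphismProperty.of_isPullback (P := @IsAffineHom) h1 (isAffineHom_toZero ha m)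
    exact isAffine_of_isAffineHom (pullback.snd (toZero a m) j).left
  have := hasLimit_over_of_isAffine (Functor.ofOpSequence b) fun m => hP m.unop
  obtain ⟨L, π, hw, hL⟩ := exists_seqLimit_of_hasLimit b
  have hq : ∀ m, π m ≫ pullback.snd (toZero a m) j = π 0 ≫ pullback.snd (toZero a 0) j := fun m => by
    induction m with
    | zero => rfl
    | succ m ih => rw [← ih, ← hw m, Category.assoc, hb₂]
  refine ⟨L, π 0 ≫ pullback.snd (toZero a 0) j,
    fun m => π m ≫ pullback.fst (toZero a m) j, fun m => ?_, ?_, fun {T} r f hf hr => ?_⟩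
  · rw [Category.assoc, ← hb₁, ← Category.assoc, hw]
  · rw [Category.assoc, ← pullback.condition]
    exact congr(_ ≫ $(Category.comp_id _))
  · have hcond : ∀ m, f m ≫ toZero a m = r ≫ j := fun m => by rw [comp_toZero hf, hr]
    obtain ⟨g, hg, hu⟩ := hL (fun m => (pullback.lift (f m) r (hcond m) : T ⟶ P m)) (fun m => by
        refine pullback.hom_ext ?_ ?_
        · rw [Category.assoc, hb₁, ← Category.assoc, pullback.lift_fst, hf, pullback.lift_fst]
        · rw [Category.assoc, hb₂, pullback.lift_snd, pullback.lift_snd])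
    refine ⟨g, ⟨?_, fun m => ?_⟩, fun g' ⟨h1, h2⟩ => hu g' fun m => pullback.hom_ext ?_ ?_⟩
    · rw [← Category.assoc, hg, pullback.lift_snd]
    · rw [← Category.assoc, hg, pullback.lift_fst]
    · rw [Category.assoc, h2, pullback.lift_fst]
    · rw [Category.assoc, hq, h1, pullback.lift_snd]

/-- The colimit of a locally directed diagram of open immersions. -/
theorem exists_colimit_over {J : Type u} [Category.{u} J] [Quiver.IsThin J]
    (F : J ⥤ Over (Spec (CommRingCat.of k)))
    (hF : ∀ {i j} (f : i ⟶ j), IsOpenImmersion (F.map f).left)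
    (hF' : ((F ⋙ Over.forget _) ⋙ Scheme.forget).IsLocallyDirected) :
    ∃ (Y : Over (Spec (CommRingCat.of k))) (ι : ∀ i, F.obj i ⟶ Y),
      (∀ i, IsOpenImmersion (ι i).left) ∧ (∀ x, ∃ i y, (ι i).left y = x) ∧
      (∀ {i j} (f : i ⟶ j), F.map f ≫ ι j = ι i) ∧
      ∀ {T : Over (Spec (CommRingCat.of k))} (f : ∀ i, F.obj i ⟶ T),
        (∀ {i j} (φ : i ⟶ j), F.map φ ≫ f j = f i) → ∃ g : Y ⟶ T, ∀ i, ι i ≫ g = f i := by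
  let F₀ : J ⥤ Scheme.{u} := F ⋙ Over.forget _
  have i1 : ∀ {i j} (f : i ⟶ j), IsOpenImmersion (F₀.map f) := fun f => hF f
  have i3 : (F₀ ⋙ Scheme.forget).IsLocallyDirected := hF'
  let cX : Cocone F₀ := ⟨Spec (CommRingCat.of k),
    { app := fun i => (F.obj i).hom, naturality := fun i j f => by
        exact (Over.w (F.map f)).trans (Category.comp_id _).symm }⟩
  let Y : Over (Spec (CommRingCat.of k)) := Over.mk (colimit.desc F₀ cX)
  let ι : ∀ i, F.obj i ⟶ Y := fun i => Over.homMk (colimit.ι F₀ i) (colimit.ι_desc cX i)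
  refine ⟨Y, ι, fun i => ?_, fun x => ?_, fun f => ?_, fun {T} f hf => ?_⟩
  · exact inferInstanceAs (IsOpenImmersion (colimit.ι F₀ i))
  · exact Scheme.IsLocallyDirected.ι_jointly_surjective F₀ x
  · ext1
    exact colimit.w F₀ f
  · let cT : Cocone F₀ := ⟨T.left,
      { app := fun i => (f i).left, naturality := fun i j φ => by
          have := hf φ
          exact congr($(this).left).trans (Category.comp_id _).symm }⟩
    refine ⟨Over.homMk (colimit.desc F₀ cT) ?_, fun i => ?_⟩
    · refine colimit.hom_ext fun i => ?_
      refine Eq.trans ?_ (colimit.ι_desc cX i).symm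
      refine (colimit.ι_desc_assoc cT _ _).trans ?_
      exact Over.w (f i)
    · ext1
      exact colimit.ι_desc cT i

/-- An inverse system with affine transition morphisms has a limit. -/
theorem hasLimit_ofOpSequence_of_isAffineHom (ha : ∀ m, IsAffineHom (a m).left) :
    HasLimit (Functor.ofOpSequence a) := by
  -- All opens over which the restricted system has a limit. They are stable under shrinking by base
  -- change and include the affine opens, so gluing along this ordered set reaches the whole of X 0.
  let J := {O : (X 0).left.Opens // ∃ (L : Over (Spec (CommRingCat.of k))) (q : L ⟶ restr (X 0) O)
    (π : ∀ m, L ⟶ X m), IsSeqLimit a (restrι (X 0) O) q π}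
  choose L q π h using fun O : J => O.2
  have hincl : ∀ {O O' : (X 0).left.Opens} (_ : O ≤ O'), ∃ i : restr (X 0) O ⟶ restr (X 0) O',
      i ≫ restrι (X 0) O' = restrι (X 0) O := fun {O O'} hO =>
    exists_lift_restr _ O' fun y => hO (restr_hom_apply_mem O y)
  choose i hi using @hincl
  have hdown : ∀ {O O' : (X 0).left.Opens} (_ : O ≤ O') (_ : ∃ (L : Over (Spec (CommRingCat.of k)))
      (q : L ⟶ restr (X 0) O') (π : ∀ m, L ⟶ X m), IsSeqLimit a (restrι (X 0) O') q π),
      ∃ (L : Over (Spec (CommRingCat.of k)))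
      (q : L ⟶ restr (X 0) O) (π : ∀ m, L ⟶ X m), IsSeqLimit a (restrι (X 0) O) q π := by
    rintro O O' hO ⟨L, q, π, h⟩
    have h1 := h.baseChange (i hO)
    rw [hi hO] at h1
    exact ⟨_, _, _, h1⟩
  have hmap : ∀ {O O' : J} (hO : O ≤ O'), ∃ m : L O ⟶ L O', IsPullback m (q O) (q O') (i hO) ∧
      ∀ n, m ≫ π O' n = π O n := fun {O O'} hO => (h O).exists_isPullback (h O') (i hO) (hi hO)
  choose m hm hm' using @hmap
  -- The component to the open subscheme is not needed separately: it is recovered from the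
  -- projection to X 0, since an open immersion is a monomorphism.
  have hext : ∀ (O : J) {T : Over (Spec (CommRingCat.of k))} (f g : T ⟶ L O),
      (∀ n, f ≫ π O n = g ≫ π O n) → f = g := fun O T f g hfg => by
    refine ((h O).existsUnique (f ≫ q O) (fun n => f ≫ π O n) (fun n => by
      rw [Category.assoc, (h O).compat]) (by rw [Category.assoc, (h O).fac])).unique
      ⟨rfl, fun _ => rfl⟩ ⟨?_, fun n => (hfg n).symm⟩
    rw [← cancel_mono (restrι (X 0) O.1), Category.assoc, Category.assoc, (h O).fac, hfg]
  have hopen : ∀ {O O' : J} (hO : O ≤ O'), IsOpenImmersion (m hO).left := fun {O O'} hO => by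
    have h1 : (i hO).left ≫ (restrι (X 0) O'.1).left = (restrι (X 0) O.1).left :=
      congr($(hi hO).left)
    have h2 : IsOpenImmersion (i hO).left := by
      have : IsOpenImmersion ((i hO).left ≫ (restrι (X 0) O'.1).left) := by
        rw [h1]
        infer_instance
      exact IsOpenImmersion.of_comp _ (restrι (X 0) O'.1).left
    exact MorphismProperty.of_isPullback (P := @IsOpenImmersion) (RelScheme.isPullback_left (hm hO)).flip h2
  have hpt : ∀ (O : J) (z : (L O).left), (π O 0).left z ∈ O.1 := fun O z => by
    rw [← (h O).fac]
    exact restr_hom_apply_mem O.1 _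
  have hrange : ∀ {O O' : J} (hO : O ≤ O') (z : (L O').left), (π O' 0).left z ∈ O.1 →
      z ∈ Set.range (m hO).left := by
    intro O O' hO z hz
    have h1 : (π O' 0).left z ∈ Set.range (restrι (X 0) O.1).left := by rwa [range_restrι]
    obtain ⟨y, hy⟩ := h1
    obtain ⟨w, hw, -⟩ := Scheme.exists_preimage_of_isPullback (RelScheme.isPullback_left (hm hO)) z y (by
      refine (restrι (X 0) O'.1).left.isOpenEmbedding.injective ?_
      rw [← Scheme.Hom.comp_apply, ← Scheme.Hom.comp_apply]
      have h1 : (i hO).left ≫ (restrι (X 0) O'.1).left = (restrι (X 0) O.1).left :=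
        congr($(hi hO).left)
      have h2 : (q O').left ≫ (restrι (X 0) O'.1).left = (π O' 0).left := congr($((h O').fac).left)
      rw [h1, h2, hy])
    exact ⟨w, hw⟩
  let F : J ⥤ Over (Spec (CommRingCat.of k)) :=
    { obj := L
      map := fun f => m f.le
      map_id := fun O => hext O _ _ fun n => by rw [hm', Category.id_comp]
      map_comp := fun {O O' O''} f g => hext O'' _ _ fun n => by
        rw [hm', Category.assoc, hm', hm'] }
  have hcompπ : ∀ {O O' : J} (hO : O ≤ O') z,
      (π O' 0).left ((m hO).left z) = (π O 0).left z := fun {O O'} hO z => by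
    rw [← Scheme.Hom.comp_apply, ← Over.comp_left, hm']
  let inf : J → J → J := fun O O' => ⟨O.1 ⊓ O'.1, hdown inf_le_left O.2⟩
  have hinf₁ : ∀ O O', inf O O' ≤ O := fun O O' => inf_le_left (a := O.1) (b := O'.1)
  have hinf₂ : ∀ O O', inf O O' ≤ O' := fun O O' => inf_le_right (a := O.1) (b := O'.1)
  have hdir : ((F ⋙ Over.forget _) ⋙ Scheme.forget).IsLocallyDirected := by
    refine ⟨fun {O O' O''} f g x y hxy => ?_⟩
    change (m f.le).left x = (m g.le).left y at hxy
    obtain ⟨z, hz⟩ := hrange (hinf₁ O O') x ⟨hpt O x, by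
      have h1 : (π O 0).left x = (π O' 0).left y :=
        (hcompπ f.le x).symm.trans (congr((π O'' 0).left $hxy).trans (hcompπ g.le y))
      exact h1 ▸ hpt O' y⟩
    refine ⟨inf O O', homOfLE (hinf₁ O O'), homOfLE (hinf₂ O O'), z, hz, ?_⟩
    have := hopen g.le
    refine (m g.le).left.isOpenEmbedding.injective ?_
    refine Eq.trans ?_ hxy
    rw [← hz]
    change (m g.le).left ((m (hinf₂ O O')).left z) = _
    have h1 : m (hinf₂ O O') ≫ m g.le = m (hinf₁ O O') ≫ m f.le := hext O'' _ _ fun n => by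
      rw [Category.assoc, hm', hm', Category.assoc, hm', hm']
    have h2 := congr($(h1).left)
    rw [Over.comp_left, Over.comp_left] at h2
    rw [← Scheme.Hom.comp_apply, ← Scheme.Hom.comp_apply, h2]
  obtain ⟨Y, ι, hι, hsurj, hcomp, hdesc⟩ := exists_colimit_over F (fun f => hopen f.le) hdir
  choose ϖ hϖ using fun n => hdesc (fun O => π O n) fun φ => hm' φ.le n
  have hYext : ∀ {S : Over (Spec (CommRingCat.of k))} (f g : Y ⟶ S), (∀ O, ι O ≫ f = ι O ≫ g) →
      f = g := fun f g hfg => hom_ext_of_local fun x => by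
    obtain ⟨O, y, rfl⟩ := hsurj x
    exact ⟨_, ι O, hι O, ⟨y, rfl⟩, hfg O⟩
  have hϖcompat : ∀ n, ϖ (n + 1) ≫ a n = ϖ n := fun n => hYext _ _ fun O => by
    rw [← Category.assoc, hϖ, hϖ, (h O).compat]
  have hYrange : ∀ (O : J) (z : Y.left), (ϖ 0).left z ∈ O.1 → z ∈ Set.range (ι O).left := by
    intro O z hz
    obtain ⟨O', y, rfl⟩ := hsurj z
    have h1 : (ι O').left ≫ (ϖ 0).left = (π O' 0).left := congr($(hϖ 0 O').left)
    rw [← Scheme.Hom.comp_apply, h1] at hz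
    obtain ⟨w, rfl⟩ := hrange (hinf₁ O' O) y ⟨hpt O' y, hz⟩
    refine ⟨(m (hinf₂ O' O)).left w, ?_⟩
    have h2 := congr($((hcomp (homOfLE (hinf₁ O' O))).trans
      (hcomp (homOfLE (hinf₂ O' O))).symm).left)
    rw [Over.comp_left, Over.comp_left] at h2
    exact congr($(h2) w).symm
  have hcov : ∀ x : (X 0).left, ∃ O : J, x ∈ O.1 := fun x => by
    obtain ⟨W, hW, hxW, -⟩ := (TopologicalSpace.Opens.isBasis_iff_nbhd.mp
      (X 0).left.isBasis_affineOpens) (show x ∈ (⊤ : (X 0).left.Opens) from trivial)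
    exact ⟨⟨W, exists_isSeqLimit_of_isAffine ha _ hW⟩, hxW⟩
  obtain ⟨c, rfl, hc⟩ := exists_cone_ofOpSequence ϖ hϖcompat
  simp only [eqToHom_refl, Category.id_comp] at hc
  have huniv : ∀ {T : Over (Spec (CommRingCat.of k))} (f : ∀ n, T ⟶ X n),
      (∀ n, f (n + 1) ≫ a n = f n) → ∃! g : T ⟶ c.pt, ∀ n, g ≫ ϖ n = f n := by
    intro T f hf
    have hu : ∀ {S : Over (Spec (CommRingCat.of k))} (g g' : S ⟶ c.pt),
        (∀ n, g ≫ ϖ n = g' ≫ ϖ n) → g = g' := by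
      intro S g g' hg
      refine hom_ext_of_local fun y => ?_
      obtain ⟨O, hO⟩ := hcov ((g ≫ ϖ 0).left y)
      -- Both morphisms have the same composite to X 0, so over this preimage both factor through
      -- the local limit over `O`.
      let O' : S.left.Opens := (g ≫ ϖ 0).left ⁻¹ᵁ O.1
      refine ⟨_, restrι S O', inferInstance, by rw [range_restrι]; exact hO, ?_⟩
      have key : ∀ g₁ : S ⟶ c.pt, g₁ ≫ ϖ 0 = g ≫ ϖ 0 → ∃ g₀ : restr S O' ⟶ L O,
          g₀ ≫ ι O = restrι S O' ≫ g₁ := by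
        intro g₁ h₁
        have := hι O
        refine exists_lift_of_isOpenImmersion (ι O) (restrι S O' ≫ g₁) fun x => hYrange O _ ?_
        rw [← Scheme.Hom.comp_apply, ← Over.comp_left, Category.assoc, h₁]
        exact restr_hom_apply_mem O' x
      obtain ⟨g₁, hg₁⟩ := key g rfl
      obtain ⟨g₂, hg₂⟩ := key g' (hg 0).symm
      rw [← hg₁, ← hg₂, hext O g₁ g₂ fun n => ?_]
      rw [← hϖ n O, ← Category.assoc, ← Category.assoc, hg₁, hg₂, Category.assoc, Category.assoc,
        hg]
    obtain ⟨g, hg⟩ := exists_hom_of_local (S := T) (Y := c.pt)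
      (fun j g => ∀ n, g ≫ ϖ n = j ≫ f n) (fun i j f h n => by
        rw [Category.assoc, h, Category.assoc])
      (fun j f f' h h' => hu _ _ fun n => by rw [h, h']) (fun x => by
        obtain ⟨O, hO⟩ := hcov ((f 0).left x)
        let O' : T.left.Opens := (f 0).left ⁻¹ᵁ O.1
        obtain ⟨r, hr⟩ := exists_lift_restr (restrι T O' ≫ f 0) O.1 fun y =>
          restr_hom_apply_mem O' y
        obtain ⟨g, ⟨-, hg⟩, -⟩ := (h O).existsUnique r (fun n => restrι T O' ≫ f n)
          (fun n => by rw [Category.assoc, hf]) hr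
        exact ⟨_, restrι T O', inferInstance, by rw [range_restrι]; exact hO, g ≫ ι O, fun n => by
          rw [Category.assoc, hϖ, hg]⟩)
    have hg' : ∀ n, g ≫ ϖ n = f n := fun n => hom_ext_of_local fun x => by
      obtain ⟨V, j, hj, hx, h⟩ := hg x
      exact ⟨V, j, hj, hx, by rw [← Category.assoc, h]⟩
    exact ⟨g, hg', fun g' h' => hu _ _ fun n => by rw [h', hg']⟩
  refine ⟨⟨⟨c, ⟨fun s => (huniv (fun n => s.π.app (op n)) (cone_ofOpSequence_w s)).choose,
    fun s j => ?_, fun s g hg => ?_⟩⟩⟩⟩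
  · have := (huniv (fun n => s.π.app (op n)) (cone_ofOpSequence_w s)).choose_spec.1 j.unop
    exact congr(_ ≫ $(hc j.unop)).trans this
  · exact (huniv (fun n => s.π.app (op n)) (cone_ofOpSequence_w s)).choose_spec.2 g fun n =>
      congr(_ ≫ $(hc n)).symm.trans (hg (op n))

end SequentialLimits

/-! ### Generic linear forms and common eigenvectors. -/

section Generic

variable {k : Type*} [Field k]

/-- With a section σ of A, (A + cB)σ = 1 + cBσ is an endomorphism of the finite-dimensional space W.
For c ≠ 0 it fails to be invertible only if -1/c is an eigenvalue of Bσ. -/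
theorem finite_setOf_not_surjective {U W : Type*} [AddCommGroup U] [Module k U] [AddCommGroup W]
    [Module k W] [Module.Finite k W] (A B : U →ₗ[k] W) (hA : Function.Surjective A) :
    {c : k | ¬ Function.Surjective (A + c • B)}.Finite := by
  obtain ⟨σ, hσ⟩ := A.exists_rightInverse_of_surjective (LinearMap.range_eq_top.2 hA)
  let C : Module.End k W := B ∘ₗ σ
  have hfin : ((fun c : k => -c⁻¹) ⁻¹' {μ | C.HasEigenvalue μ}).Finite :=
    Set.Finite.preimage (fun a _ b _ h => inv_injective (neg_injective h)) C.finite_hasEigenvalue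
  refine (hfin.union (Set.finite_singleton 0)).subset fun c hc => ?_
  by_contra hc'
  rw [Set.mem_union, not_or] at hc'
  obtain ⟨h1, h2⟩ := hc'
  have hc0 : c ≠ 0 := h2
  refine hc ?_
  have hinj : Function.Injective ((A + c • B) ∘ₗ σ) := by
    rw [← LinearMap.ker_eq_bot, LinearMap.ker_eq_bot']
    intro w hw
    by_contra hw0
    refine h1 (Module.End.hasEigenvalue_of_hasEigenvector (x := w)
      ⟨Module.End.mem_eigenspace_iff.2 ?_, hw0⟩)
    have h3 : A (σ w) = w := LinearMap.congr_fun hσ w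
    have h4 : w + c • B (σ w) = 0 := by
      rw [← h3]
      simpa [h3] using hw
    change B (σ w) = -c⁻¹ • w
    rw [neg_smul, ← smul_neg, ← eq_neg_of_add_eq_zero_right h4, smul_smul, inv_mul_cancel₀ hc0,
      one_smul]
  have hs := LinearMap.injective_iff_surjective.1 hinj
  exact fun w => (hs w).elim fun x hx => ⟨σ x, hx⟩

/-- Over an infinite field, finitely many linear families of linear maps that each contain a
surjective map have a common parameter with this property. -/
theorem exists_forall_surjective [Infinite k] {ι E : Type*} [AddCommGroup E] [Module k E]
    {U W : ι → Type*} [∀ i, AddCommGroup (U i)] [∀ i, Module k (U i)] [∀ i, AddCommGroup (W i)]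
    [∀ i, Module k (W i)] [∀ i, Module.Finite k (W i)] (A : ∀ i, E →ₗ[k] U i →ₗ[k] W i)
    (h : ∀ i, ∃ y, Function.Surjective (A i y)) (s : Finset ι) :
    ∃ y, ∀ i ∈ s, Function.Surjective (A i y) := by
  classical
  induction s using Finset.induction_on with
  | empty => exact ⟨0, by simp⟩
  | insert i s _ ih =>
    obtain ⟨y, hy⟩ := ih
    obtain ⟨z, hz⟩ := h i
    have h1 : (⋃ j ∈ s, {c : k | ¬ Function.Surjective (A j y + c • A j z)}).Finite :=
      s.finite_toSet.biUnion fun j hj => finite_setOf_not_surjective _ _ (hy j hj)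
    -- For the new index the roles of y and z are exchanged: A(y + cz) = c(A z + c⁻¹ A y).
    have h2 : ((fun c : k => c⁻¹) ⁻¹'
        {c : k | ¬ Function.Surjective (A i z + c • A i y)}).Finite :=
      Set.Finite.preimage inv_injective.injOn (finite_setOf_not_surjective _ _ hz)
    obtain ⟨c, hc⟩ := ((h1.union h2).union (Set.finite_singleton 0)).exists_notMem
    rw [Set.mem_union, Set.mem_union, not_or, not_or] at hc
    obtain ⟨⟨h3, h4⟩, h5⟩ := hc
    have hc0 : c ≠ 0 := h5
    refine ⟨y + c • z, fun j hj => ?_⟩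
    rcases Finset.mem_insert.1 hj with rfl | hj
    · have h6 : Function.Surjective (A j z + c⁻¹ • A j y) := not_not.1 h4
      intro w
      obtain ⟨x, hx⟩ := h6 (c⁻¹ • w)
      refine ⟨x, ?_⟩
      have h7 := congr(c • $hx)
      rw [smul_smul, mul_inv_cancel₀ hc0, one_smul] at h7
      rw [← h7, map_add, map_smul, LinearMap.add_apply, LinearMap.smul_apply, LinearMap.add_apply,
        LinearMap.smul_apply, smul_add, smul_smul, mul_inv_cancel₀ hc0, one_smul, add_comm]
    · rw [map_add, map_smul]
      by_contra h6
      exact h3 (Set.mem_biUnion hj h6)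

variable {V : Type*} [AddCommGroup V] [Module k V] [Module.Finite k V]

/-- In a minimal nonzero subspace invariant under all operators, the eigenspace of one operator is
invariant by commutativity, hence everything. So each of its nonzero vectors is a common
eigenvector. -/
theorem exists_common_eigenvector [IsAlgClosed k] {ι : Type*} [Nontrivial V]
    (T : ι → Module.End k V) (hT : ∀ i j, Commute (T i) (T j)) :
    ∃ v : V, v ≠ 0 ∧ ∀ i, ∃ μ : k, T i v = μ • v := by
  obtain ⟨U, ⟨hU0, hU⟩, hmin⟩ := WellFounded.has_min (wellFounded_lt (α := Submodule k V))
    {U | U ≠ ⊥ ∧ ∀ i, U ≤ U.comap (T i)} ⟨⊤, top_ne_bot, fun i => le_top⟩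
  obtain ⟨v, hv, hv0⟩ := Submodule.exists_mem_ne_zero_of_ne_bot hU0
  refine ⟨v, hv0, fun i => ?_⟩
  let f : Module.End k U := (T i).restrict (hU i)
  have : Nontrivial U := Submodule.nontrivial_iff_ne_bot.2 hU0
  obtain ⟨μ, hμ⟩ := Module.End.exists_eigenvalue f
  obtain ⟨w, hw, hw0⟩ := hμ.exists_hasEigenvector
  have hw' : T i w = μ • (w : V) := congr(($(Module.End.mem_eigenspace_iff.1 hw) : V))
  let U' := U ⊓ (T i).eigenspace μ
  have hU' : U' ≠ ⊥ := fun h0 => hw0 (by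
    have : (w : V) ∈ U' := ⟨w.2, Module.End.mem_eigenspace_iff.2 hw'⟩
    rw [h0, Submodule.mem_bot] at this
    exact Subtype.ext this)
  have hle : U ≤ U' := by
    by_contra hlt
    refine hmin U' ⟨hU', fun j x hx => ⟨hU j hx.1, Module.End.mem_eigenspace_iff.2 ?_⟩⟩
      (lt_of_le_not_ge inf_le_left hlt)
    have h1 := LinearMap.congr_fun (hT i j) x
    have h2 := Module.End.mem_eigenspace_iff.1 hx.2
    change T i (T j x) = T j (T i x) at h1
    rw [h1, h2, map_smul]
  exact ⟨μ, Module.End.mem_eigenspace_iff.1 (hle hv).2⟩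

/-- A nonzero linear form vanishes on at most `N - 1` of the given vectors. -/
theorem card_filter_eq_zero_le {N s : ℕ} (L : Fin s → Fin N → k)
    (hL : ∀ c : Fin N ↪ Fin s, LinearIndependent k fun i => L (c i))
    (χ : (Fin N → k) →ₗ[k] k) (hχ : χ ≠ 0) [DecidablePred fun q => χ (L q) = 0] :
    (Finset.univ.filter fun q => χ (L q) = 0).card ≤ N - 1 := by
  by_contra hlt
  have hN : N ≤ (Finset.univ.filter fun q => χ (L q) = 0).card := by omega
  obtain ⟨t, ht, htN⟩ := Finset.exists_subset_card_eq hN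
  let c : Fin N ↪ Fin s := (t.orderEmbOfFin htN).toEmbedding
  have h1 := hL c
  have hmem : ∀ i, χ (L (c i)) = 0 := fun i =>
    (Finset.mem_filter.1 (ht (t.orderEmbOfFin_mem htN i))).2
  have h2 : Submodule.span k (Set.range fun i => L (c i)) = ⊤ :=
    h1.span_eq_top_of_card_eq_finrank' (by simp)
  refine hχ (LinearMap.ext_on_range h2 fun i => ?_)
  simpa using hmem i

/-- For a linear family of commuting operators that contains the identity, at most
`dim V * (N - 1)` of the given parameters yield an operator that is not injective. -/
theorem card_filter_not_injective_le [IsAlgClosed k] {N s : ℕ} (L : Fin s → Fin N → k)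
    (hL : ∀ c : Fin N ↪ Fin s, LinearIndependent k fun i => L (c i))
    (T : (Fin N → k) →ₗ[k] Module.End k V) (hT : ∀ c c', Commute (T c) (T c')) (y : Fin N → k)
    (hy : T y = 1) [DecidablePred fun q => ¬ Function.Injective (T (L q))] :
    (Finset.univ.filter fun q => ¬ Function.Injective (T (L q))).card ≤
      Module.finrank k V * (N - 1) := by
  classical
  induction hd : Module.finrank k V generalizing V with
  | zero =>
    have : Subsingleton V := Module.finrank_zero_iff.1 hd
    rw [Finset.filter_eq_empty_iff.2 fun q _ => not_not.2 (Function.injective_of_subsingleton _)]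
    simp
  | succ d ih =>
    have : Nontrivial V := Module.nontrivial_of_finrank_pos (R := k) (by omega)
    obtain ⟨v, hv0, hv⟩ := exists_common_eigenvector T hT
    choose μ hμ using hv
    have hcan : ∀ {a b : k}, a • v = b • v → a = b := fun h => smul_left_injective k hv0 h
    -- The eigenvalue on the common eigenvector is a linear function of the parameter, and it is
    -- nonzero because it equals 1 at y. So it vanishes on at most N - 1 of the given parameters;
    -- the rest is induction on the quotient by the eigenline.
    let χ : (Fin N → k) →ₗ[k] k :=
      { toFun := μ
        map_add' := fun a b => hcan (by rw [← hμ, map_add, LinearMap.add_apply, hμ, hμ, add_smul])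
        map_smul' := fun a b => hcan (by
          rw [← hμ, map_smul, LinearMap.smul_apply, hμ, smul_smul]; rfl) }
    have hχ : χ ≠ 0 := fun h0 => by
      have h1 : μ y = 1 := hcan (by rw [← hμ, hy]; simp)
      have h2 : μ y = 0 := LinearMap.congr_fun h0 y
      exact one_ne_zero (h1.symm.trans h2)
    let P : Submodule k V := Submodule.span k {v}
    have hP : ∀ c, P ≤ P.comap (T c) := fun c => by
      rw [Submodule.span_singleton_le_iff_mem, Submodule.mem_comap, hμ]
      exact Submodule.smul_mem _ _ (Submodule.mem_span_singleton_self v)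
    let T' : (Fin N → k) →ₗ[k] Module.End k (V ⧸ P) :=
      { toFun := fun c => P.mapQ P (T c) (hP c)
        map_add' := fun a b => by
          ext x
          simp
        map_smul' := fun a b => by
          ext x
          simp }
    have hT' : ∀ c x, T' c (P.mkQ x) = P.mkQ (T c x) := fun c x => rfl
    have hfr : Module.finrank k (V ⧸ P) = d := by
      have h1 := Submodule.finrank_quotient_add_finrank P
      rw [finrank_span_singleton hv0] at h1
      omega
    have h1 := ih T' (fun c c' => by
      refine LinearMap.ext fun x => ?_
      obtain ⟨x, rfl⟩ := P.mkQ_surjective x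
      change T' c (T' c' (P.mkQ x)) = T' c' (T' c (P.mkQ x))
      rw [hT', hT', hT', hT']
      exact congr(P.mkQ $(LinearMap.congr_fun (hT c c') x))) (by
      refine LinearMap.ext fun x => ?_
      obtain ⟨x, rfl⟩ := P.mkQ_surjective x
      rw [hT', hy]
      rfl) hfr
    have h2 := card_filter_eq_zero_le L hL χ hχ
    rw [add_mul, one_mul]
    refine le_trans (Finset.card_le_card ?_) ((Finset.card_union_le _ _).trans (add_le_add h1 h2))
    intro q hq
    rw [Finset.mem_filter] at hq
    rw [Finset.mem_union, Finset.mem_filter, Finset.mem_filter]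
    by_contra hcon
    rw [not_or] at hcon
    have hi : Function.Injective (T' (L q)) := by
      by_contra h
      exact hcon.1 ⟨Finset.mem_univ _, h⟩
    have hne : μ (L q) ≠ 0 := fun h => hcon.2 ⟨Finset.mem_univ _, h⟩
    -- An operator injective on the eigenline and on the quotient is injective.
    refine hq.2 ?_
    rw [← LinearMap.ker_eq_bot, LinearMap.ker_eq_bot']
    intro x hx
    have h3 : P.mkQ x = 0 := hi (by rw [hT', hx, map_zero, map_zero])
    rw [Submodule.mkQ_apply, Submodule.Quotient.mk_eq_zero, Submodule.mem_span_singleton] at h3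
    obtain ⟨b, rfl⟩ := h3
    rw [map_smul, hμ, smul_smul, smul_eq_zero, or_iff_left hv0, mul_eq_zero, or_iff_left hne] at hx
    rw [hx, zero_smul]

end Generic

/-! ### Dimensions of quotients. -/

section Codimension

variable {k Q : Type*} [Field k] [AddCommGroup Q] [Module k Q]

theorem finrank_map_mkQ_add {K N : Submodule k Q} (h : K ≤ N) [Module.Finite k (Q ⧸ K)] :
    Module.finrank k (N.map K.mkQ) + Module.finrank k (Q ⧸ N) = Module.finrank k (Q ⧸ K) := by
  rw [← (Submodule.quotientQuotientEquivQuotient K N h).finrank_eq, add_comm]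
  exact Submodule.finrank_quotient_add_finrank _

theorem finite_quotient_of_le {K N : Submodule k Q} (h : K ≤ N) [Module.Finite k (Q ⧸ K)] :
    Module.Finite k (Q ⧸ N) :=
  Module.Finite.of_surjective (Submodule.factor h) (Submodule.factor_surjective h)

theorem finrank_quotient_anti {K N : Submodule k Q} (h : K ≤ N) [Module.Finite k (Q ⧸ K)] :
    Module.finrank k (Q ⧸ N) ≤ Module.finrank k (Q ⧸ K) := by
  rw [← finrank_map_mkQ_add h]
  exact Nat.le_add_left _ _

theorem eq_of_finrank_quotient_le {K N : Submodule k Q} (h : K ≤ N) [Module.Finite k (Q ⧸ K)]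
    (hf : Module.finrank k (Q ⧸ K) ≤ Module.finrank k (Q ⧸ N)) : K = N := by
  have h1 := finrank_map_mkQ_add h
  have h2 : Module.finrank k (N.map K.mkQ) = 0 := by omega
  rw [Submodule.finrank_eq_zero] at h2
  refine le_antisymm h fun x hx => ?_
  have h3 : K.mkQ x ∈ N.map K.mkQ := Submodule.mem_map_of_mem hx
  rw [h2, Submodule.mem_bot] at h3
  exact (Submodule.Quotient.mk_eq_zero K).1 h3

theorem le_sup_of_map_mkQ_le {K N N' : Submodule k Q} (h : N.map K.mkQ ≤ N'.map K.mkQ) :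
    N ≤ K ⊔ N' := by
  rw [← Submodule.comap_map_mkQ]
  exact Submodule.map_le_iff_le_comap.1 h

end Codimension

/-! ### Reduction by a single linear form, after Eakin and Sathaye. -/

section LocalAlgebra

variable {k Q : Type*} [Field k] [CommRing Q] [Algebra k Q] {N : ℕ}

/-- The powers of an ideal of a `k`-algebra as linear subspaces. -/
abbrev powSub (k : Type*) {Q : Type*} [Field k] [CommRing Q] [Algebra k Q] (𝔪 : Ideal Q) (t : ℕ) :
    Submodule k Q := (𝔪 ^ t).restrictScalars k

/-- The linear forms in `x`. -/
abbrev linForm (k : Type*) {Q : Type*} [Field k] [CommRing Q] [Algebra k Q] {N : ℕ} (x : Fin N → Q) :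
    (Fin N → k) →ₗ[k] Q := Fintype.linearCombination k x

variable {x : Fin N → Q}

theorem linForm_single (i : Fin N) : linForm k x (Pi.single i 1) = x i := by simp

theorem linForm_mem (c : Fin N → k) : linForm k x c ∈ Ideal.span (Set.range x) := by
  rw [Fintype.linearCombination_apply]
  refine Ideal.sum_mem _ fun i _ => ?_
  rw [Algebra.smul_def]
  exact Ideal.mul_mem_left _ _ (Ideal.subset_span ⟨i, rfl⟩)

theorem linForm_mul_mem (c : Fin N → k) {d : ℕ} {f : Q} (hf : f ∈ Ideal.span (Set.range x) ^ d) :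
    linForm k x c * f ∈ Ideal.span (Set.range x) ^ (d + 1) := by
  rw [pow_succ']
  exact Ideal.mul_mem_mul (linForm_mem c) hf

theorem apply_mul_mem (i : Fin N) {d : ℕ} {f : Q} (hf : f ∈ Ideal.span (Set.range x) ^ d) :
    x i * f ∈ Ideal.span (Set.range x) ^ (d + 1) := by
  rw [pow_succ']
  exact Ideal.mul_mem_mul (Ideal.subset_span ⟨i, rfl⟩) hf

theorem powSub_succ_le {d : ℕ} {K : Submodule k Q}
    (h : ∀ i, ∀ f ∈ Ideal.span (Set.range x) ^ d, x i * f ∈ K) :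
    powSub k (Ideal.span (Set.range x)) (d + 1) ≤ K := by
  intro z hz
  change z ∈ Ideal.span (Set.range x) ^ (d + 1) at hz
  rw [pow_succ'] at hz
  refine Submodule.mul_induction_on hz (fun a ha f hf => ?_) fun _ _ => add_mem
  induction ha using Submodule.span_induction generalizing f with
  | mem a ha =>
    obtain ⟨i, rfl⟩ := ha
    exact h i f hf
  | zero => rw [zero_mul]; exact zero_mem _
  | add a b _ _ iha ihb => rw [add_mul]; exact add_mem (iha f hf) (ihb f hf)
  | smul r a _ iha =>
    rw [smul_eq_mul, mul_assoc, mul_left_comm]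
    exact iha _ (Ideal.mul_mem_left _ _ hf)

/-- If the codimension of `K` in `𝔪 ^ (d + 1)` is at most `d + 1`, then
`𝔪 ^ (d + 1) ≤ K + y 𝔪 ^ d` for some linear form `y`. -/
theorem exists_linForm_le_sup [Infinite k] (x : Fin N → Q) (d : ℕ) (K : Submodule k Q)
    (hK : Module.Finite k ((powSub k (Ideal.span (Set.range x)) (d + 1)).map K.mkQ))
    (hd : Module.finrank k ((powSub k (Ideal.span (Set.range x)) (d + 1)).map K.mkQ) ≤ d + 1) :
    ∃ c : Fin N → k, powSub k (Ideal.span (Set.range x)) (d + 1) ≤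
      K ⊔ (powSub k (Ideal.span (Set.range x)) d).map (LinearMap.mulLeft k (linForm k x c)) := by
  set 𝔪 := Ideal.span (Set.range x) with h𝔪
  -- The subspace K varies in the induction, because the step passes to the subspaces of all f with
  -- x i f in K.
  induction d generalizing K with
  | zero =>
    by_cases hgood : ∃ c : Fin N → k, powSub k 𝔪 (0 + 1) ≤
        K ⊔ (powSub k 𝔪 0).map (LinearMap.mulLeft k (linForm k x c))
    · exact hgood
    · refine ⟨0, le_sup_of_le_left (powSub_succ_le fun i f hf => ?_)⟩
      -- If some x i f is nonzero modulo K, its class fills the image of 𝔪, which has dimension at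
      -- most 1; then x i would be a good form.
      by_contra hnot
      refine hgood ⟨Pi.single i 1, le_sup_of_map_mkQ_le (le_of_eq (Eq.symm
        (Submodule.eq_of_le_of_finrank_le (Submodule.map_mono ?_) ?_)))⟩
      · rintro _ ⟨f, hf, rfl⟩
        exact linForm_mul_mem _ hf
      · refine hd.trans (Nat.succ_le_of_lt ?_)
        have : Module.Finite k (((powSub k 𝔪 0).map (LinearMap.mulLeft k
            (linForm k x (Pi.single i 1)))).map K.mkQ) :=
          Submodule.finiteDimensional_of_le (S₂ := (powSub k 𝔪 (0 + 1)).map K.mkQ)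
            (Submodule.map_mono (by
              rintro _ ⟨f, hf, rfl⟩
              exact linForm_mul_mem _ hf))
        rw [Module.finrank_pos_iff, Submodule.nontrivial_iff_ne_bot]
        intro h0
        refine hnot ((Submodule.Quotient.mk_eq_zero K).1 ?_)
        have h1 : K.mkQ (x i * f) ∈ ((powSub k 𝔪 0).map (LinearMap.mulLeft k
            (linForm k x (Pi.single i 1)))).map K.mkQ :=
          Submodule.mem_map_of_mem ⟨f, hf, by rw [linForm_single]; rfl⟩
        rwa [h0, Submodule.mem_bot] at h1
  | succ d ih =>
    by_cases hgood : ∃ c : Fin N → k, powSub k 𝔪 (d + 1 + 1) ≤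
        K ⊔ (powSub k 𝔪 (d + 1)).map (LinearMap.mulLeft k (linForm k x c))
    · exact hgood
    · let K' : Fin N → Submodule k Q := fun i => K.comap (LinearMap.mulLeft k (x i))
      have hle : ∀ i, ((powSub k 𝔪 (d + 1)).map (LinearMap.mulLeft k (x i))).map K.mkQ ≤
          (powSub k 𝔪 (d + 1 + 1)).map K.mkQ := fun i => Submodule.map_mono (by
        rintro _ ⟨f, hf, rfl⟩
        exact apply_mul_mem i hf)
      have hfin : ∀ i, Module.Finite k
          (((powSub k 𝔪 (d + 1)).map (LinearMap.mulLeft k (x i))).map K.mkQ) := fun i =>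
        Submodule.finiteDimensional_of_le (hle i)
      -- If x i by itself is not good, the image of x i 𝔪^(d+1) is a proper subspace, of dimension
      -- at most d + 1. This is the induction hypothesis for K' i.
      have hlt : ∀ i, Module.finrank k
          (((powSub k 𝔪 (d + 1)).map (LinearMap.mulLeft k (x i))).map K.mkQ) ≤ d + 1 := by
        intro i
        by_contra hcon
        refine hgood ⟨Pi.single i 1, le_sup_of_map_mkQ_le (le_of_eq (Eq.symm ?_))⟩
        rw [linForm_single]
        exact Submodule.eq_of_le_of_finrank_le (hle i) (by omega)
      let ψ : ∀ i, (Q ⧸ K' i) →ₗ[k] Q ⧸ K := fun i =>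
        (K' i).mapQ K (LinearMap.mulLeft k (x i)) le_rfl
      have hψ : ∀ i, Function.Injective (ψ i) := fun i => by
        rw [← LinearMap.ker_eq_bot, Submodule.ker_mapQ]
        exact Submodule.mkQ_map_self (K' i)
      let e : ∀ i, ((powSub k 𝔪 (d + 1)).map (K' i).mkQ) ≃ₗ[k]
          (((powSub k 𝔪 (d + 1)).map (LinearMap.mulLeft k (x i))).map K.mkQ) := fun i =>
        (Submodule.equivMapOfInjective (ψ i) (hψ i) _).trans (LinearEquiv.ofEq _ _ (by
          rw [← Submodule.map_comp, ← Submodule.map_comp]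
          rfl))
      have hfin' : ∀ i, Module.Finite k ((powSub k 𝔪 (d + 1)).map (K' i).mkQ) := fun i =>
        Module.Finite.equiv (e i).symm
      let A : ∀ i, (Fin N → k) →ₗ[k] (powSub k 𝔪 d) →ₗ[k] ((powSub k 𝔪 (d + 1)).map (K' i).mkQ) :=
        fun i => LinearMap.mk₂ k
          (fun c f => ⟨(K' i).mkQ (linForm k x c * f), Submodule.mem_map_of_mem
            (linForm_mul_mem c f.2)⟩)
          (fun c c' f => Subtype.ext (by simp [add_mul]))
          (fun a c f => Subtype.ext (by simp))
          (fun c f f' => Subtype.ext (by simp [mul_add]))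
          (fun a c f => Subtype.ext (by simp))
      have hA : ∀ i c, Function.Surjective (A i c) ↔ powSub k 𝔪 (d + 1) ≤
          K' i ⊔ (powSub k 𝔪 d).map (LinearMap.mulLeft k (linForm k x c)) := by
        intro i c
        constructor
        · intro hs
          refine le_sup_of_map_mkQ_le ?_
          rintro _ ⟨g, hg, rfl⟩
          obtain ⟨f, hf⟩ := hs ⟨(K' i).mkQ g, Submodule.mem_map_of_mem hg⟩
          exact ⟨linForm k x c * f, ⟨f, f.2, rfl⟩, congr($hf.1)⟩
        · rintro h ⟨_, ⟨g, hg, rfl⟩⟩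
          obtain ⟨a, ha, _, ⟨f, hf, rfl⟩, hab⟩ := Submodule.mem_sup.1 (h hg)
          refine ⟨⟨f, hf⟩, Subtype.ext ?_⟩
          change (K' i).mkQ (linForm k x c * f) = (K' i).mkQ g
          rw [← hab, map_add, Submodule.mkQ_apply, Submodule.mkQ_apply, Submodule.mkQ_apply,
            (Submodule.Quotient.mk_eq_zero (K' i)).2 ha, zero_add]
          rfl
      -- Induction gives one form for each i. Surjectivity fails only for finitely many parameters
      -- on suitable lines, and k is infinite, so one form serves all i at once.
      obtain ⟨c, hc⟩ := exists_forall_surjective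
        (W := fun i => (powSub k 𝔪 (d + 1)).map (K' i).mkQ) A (fun i => by
        obtain ⟨c, hc⟩ := ih (K' i) (hfin' i) ((e i).finrank_eq.trans_le (hlt i))
        exact ⟨c, (hA i c).2 hc⟩) Finset.univ
      refine ⟨c, powSub_succ_le fun i f hf => ?_⟩
      -- From f = a + y g with x i a in K follows x i f = x i a + y (x i g).
      obtain ⟨a, ha, _, ⟨g, hg, rfl⟩, hab⟩ :=
        Submodule.mem_sup.1 ((hA i c).1 (hc i (Finset.mem_univ i)) hf)
      refine Submodule.mem_sup.2 ⟨x i * a, ha, linForm k x c * (x i * g), ⟨x i * g, ?_, rfl⟩, ?_⟩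
      · exact apply_mul_mem i hg
      · rw [← hab]
        change _ = x i * (a + linForm k x c * g)
        ring

end LocalAlgebra

/-! ### Cancellation of a linear form of small colength. -/

section Multiplication

variable {k Q : Type*} [Field k] [CommRing Q] [Algebra k Q] {𝔪 : Ideal Q} {ℓ : Q} {e : ℕ}

theorem pow_le_sup_span_of_le {s : ℕ} (h : 𝔪 ^ s ≤ 𝔪 ^ (s + 1) ⊔ Ideal.span {ℓ}) (r : ℕ) :
    𝔪 ^ s ≤ 𝔪 ^ (s + r) ⊔ Ideal.span {ℓ} := by
  induction r with
  | zero => exact le_sup_left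
  | succ r ih =>
    refine ih.trans (sup_le ?_ le_sup_right)
    rw [pow_add, mul_comm]
    refine (Ideal.mul_mono_right h).trans ?_
    rw [Ideal.mul_sup, ← pow_add]
    exact sup_le_sup (le_of_eq (by congr 1; ring)) Ideal.mul_le_right

/-- Otherwise the colengths of 𝔪^s + (ℓ) would increase strictly in each of the e + 1 steps from s =
0 to s = e + 1, exceeding the bound e. -/
theorem exists_pow_le_sup_span (hfin : ∀ t, Module.Finite k (Q ⧸ powSub k 𝔪 t))
    (hc : Module.finrank k (Q ⧸ (𝔪 ^ (e + 1) ⊔ Ideal.span {ℓ}).restrictScalars k) ≤ e) :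
    ∃ s ≤ e, 𝔪 ^ s ≤ 𝔪 ^ (s + 1) ⊔ Ideal.span {ℓ} := by
  by_contra! hcon
  have key : ∀ s ≤ e + 1,
      s ≤ Module.finrank k (Q ⧸ (𝔪 ^ s ⊔ Ideal.span {ℓ}).restrictScalars k) := by
    intro s hs
    induction s with
    | zero => exact Nat.zero_le _
    | succ s ih =>
      refine Nat.succ_le_of_lt (lt_of_le_of_lt (ih (by omega)) ?_)
      have hle : (𝔪 ^ (s + 1) ⊔ Ideal.span {ℓ}).restrictScalars k ≤
          (𝔪 ^ s ⊔ Ideal.span {ℓ}).restrictScalars k :=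
        sup_le_sup_right (Ideal.pow_le_pow_right (Nat.le_succ s)) (Ideal.span {ℓ})
      have := hfin (s + 1)
      have : Module.Finite k (Q ⧸ (𝔪 ^ (s + 1) ⊔ Ideal.span {ℓ}).restrictScalars k) :=
        finite_quotient_of_le (K := powSub k 𝔪 (s + 1))
          (le_sup_left : 𝔪 ^ (s + 1) ≤ 𝔪 ^ (s + 1) ⊔ Ideal.span {ℓ})
      by_contra hlt
      have h1 := eq_of_finrank_quotient_le hle (not_lt.1 hlt)
      refine hcon s (by omega) fun z hz => ?_
      have h2 : z ∈ (𝔪 ^ s ⊔ Ideal.span {ℓ}).restrictScalars k :=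
        (le_sup_left : 𝔪 ^ s ≤ 𝔪 ^ s ⊔ Ideal.span {ℓ}) hz
      rw [← h1] at h2
      exact h2
  have := key (e + 1) le_rfl
  omega

/-- Once 𝔪^s lies in 𝔪^(s+1) + (ℓ) for some s ≤ e, it lies in 𝔪^t + (ℓ) for all larger t, so these
ideals stop shrinking. -/
theorem finrank_quotient_sup_span_le (hfin : ∀ t, Module.Finite k (Q ⧸ powSub k 𝔪 t))
    (hc : Module.finrank k (Q ⧸ (𝔪 ^ (e + 1) ⊔ Ideal.span {ℓ}).restrictScalars k) ≤ e)
    {t : ℕ} (ht : e + 1 ≤ t) :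
    Module.finrank k (Q ⧸ (𝔪 ^ t ⊔ Ideal.span {ℓ}).restrictScalars k) ≤ e := by
  obtain ⟨s, hs, h⟩ := exists_pow_le_sup_span hfin hc
  have h1 : 𝔪 ^ (e + 1) ⊔ Ideal.span {ℓ} ≤ 𝔪 ^ t ⊔ Ideal.span {ℓ} := by
    refine sup_le ((Ideal.pow_le_pow_right (by omega : s ≤ e + 1)).trans ?_) le_sup_right
    have := pow_le_sup_span_of_le h (t - s)
    rwa [Nat.add_sub_cancel' (by omega)] at this
  have := hfin (e + 1)
  have : Module.Finite k (Q ⧸ (𝔪 ^ (e + 1) ⊔ Ideal.span {ℓ}).restrictScalars k) :=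
    finite_quotient_of_le (K := powSub k 𝔪 (e + 1))
      (le_sup_left : 𝔪 ^ (e + 1) ≤ 𝔪 ^ (e + 1) ⊔ Ideal.span {ℓ})
  exact (finrank_quotient_anti (K := (𝔪 ^ (e + 1) ⊔ Ideal.span {ℓ}).restrictScalars k) h1).trans hc

theorem range_mapQ_mulLeft {I : Ideal Q} {A : Submodule k Q}
    (hA : A ≤ (I.restrictScalars k).comap (LinearMap.mulLeft k ℓ)) :
    LinearMap.range (A.mapQ (I.restrictScalars k) (LinearMap.mulLeft k ℓ) hA) =
      ((I ⊔ Ideal.span {ℓ}).restrictScalars k).map (I.restrictScalars k).mkQ := by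
  rw [Submodule.range_mapQ]
  refine le_antisymm (Submodule.map_mono ?_) ?_
  · rintro _ ⟨a, rfl⟩
    exact (le_sup_right : Ideal.span {ℓ} ≤ I ⊔ Ideal.span {ℓ})
      (Ideal.mul_mem_right _ _ (Ideal.mem_span_singleton_self ℓ))
  · rintro _ ⟨z, hz, rfl⟩
    obtain ⟨a, ha, b, hb, rfl⟩ := Submodule.mem_sup.1 hz
    obtain ⟨c, rfl⟩ := Ideal.mem_span_singleton'.1 hb
    refine ⟨c * ℓ, ⟨c, mul_comm _ _⟩, ?_⟩
    have h0 : (I.restrictScalars k).mkQ a = 0 :=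
      (Submodule.Quotient.mk_eq_zero (I.restrictScalars k)).2 ha
    rw [map_add, h0, zero_add]

/-- Multiplication by `ℓ` is injective from `Q / 𝔪 ^ s` to `Q / 𝔪 ^ (s + 1)`. -/
theorem mem_pow_of_mul_mem (hfin : ∀ t, Module.Finite k (Q ⧸ powSub k 𝔪 t)) (hℓ : ℓ ∈ 𝔪)
    (hc : Module.finrank k (Q ⧸ (𝔪 ^ (e + 1) ⊔ Ideal.span {ℓ}).restrictScalars k) ≤ e)
    {s : ℕ} (hs : e ≤ s)
    (hd : Module.finrank k (Q ⧸ powSub k 𝔪 s) + e ≤ Module.finrank k (Q ⧸ powSub k 𝔪 (s + 1)))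
    {z : Q} (hz : ℓ * z ∈ 𝔪 ^ (s + 1)) : z ∈ 𝔪 ^ s := by
  -- With H(t) = dim Q/𝔪^t, the dimension of Q/A is H(s+1) minus the colength of 𝔪^(s+1) + (ℓ),
  -- hence at least H(s+1) - e ≥ H(s). As A contains 𝔪^s, the two agree.
  let A : Submodule k Q := (powSub k 𝔪 (s + 1)).comap (LinearMap.mulLeft k ℓ)
  have hle : powSub k 𝔪 s ≤ A := fun f hf => by
    change ℓ * f ∈ 𝔪 ^ (s + 1)
    rw [pow_succ']
    exact Ideal.mul_mem_mul hℓ hf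
  have h1 := finrank_quotient_sup_span_le hfin hc (t := s + 1) (by omega)
  have := hfin (s + 1)
  have := hfin s
  have h2 := finrank_map_mkQ_add (K := powSub k 𝔪 (s + 1))
    (N := (𝔪 ^ (s + 1) ⊔ Ideal.span {ℓ}).restrictScalars k)
    (le_sup_left : 𝔪 ^ (s + 1) ≤ 𝔪 ^ (s + 1) ⊔ Ideal.span {ℓ})
  have h3 : Function.Injective (A.mapQ (powSub k 𝔪 (s + 1)) (LinearMap.mulLeft k ℓ) le_rfl) := by
    rw [← LinearMap.ker_eq_bot, Submodule.ker_mapQ]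
    exact Submodule.mkQ_map_self A
  have h4 : Module.finrank k (((𝔪 ^ (s + 1) ⊔ Ideal.span {ℓ}).restrictScalars k).map
      (powSub k 𝔪 (s + 1)).mkQ) = Module.finrank k (Q ⧸ A) := by
    rw [← LinearMap.finrank_range_of_inj h3]
    exact congr(Module.finrank k $(range_mapQ_mulLeft (A := A) (I := 𝔪 ^ (s + 1)) le_rfl)).symm
  have h5 := eq_of_finrank_quotient_le hle (by omega)
  have h6 : z ∈ A := hz
  rw [← h5] at h6
  exact h6

/-- The family that consists of `x` and of the products `ℓ ^ r y`, `r < m`. -/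
def cellFam {α β : Type*} (x : α → Q) (y : β → Q) (ℓ : Q) (m : ℕ) : α ⊕ β × Fin m → Q :=
  Sum.elim x fun b => ℓ ^ (b.2 : ℕ) * y b.1

/-- In a relation modulo 𝔪^(e+2+m) the products with ℓ^(m+1) lie in 𝔪^(e+1+m), so the old
independence kills all other coefficients. What remains is ℓ times a combination of the ℓ^m y;
cancelling ℓ with `mem_pow_of_mul_mem` gives a relation modulo 𝔪^(e+1+m), and the old independence
applies again. -/
theorem linearIndependent_cellFam_succ (hfin : ∀ t, Module.Finite k (Q ⧸ powSub k 𝔪 t))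
    (hℓ : ℓ ∈ 𝔪)
    (hc : Module.finrank k (Q ⧸ (𝔪 ^ (e + 1) ⊔ Ideal.span {ℓ}).restrictScalars k) ≤ e) {m : ℕ}
    (hd : Module.finrank k (Q ⧸ powSub k 𝔪 (e + 1 + m)) + e ≤
      Module.finrank k (Q ⧸ powSub k 𝔪 (e + 1 + (m + 1))))
    {α β : Type*} [Fintype α] [Fintype β] {x : α → Q} {y : β → Q} (hy : ∀ b, y b ∈ 𝔪 ^ e)
    (hli : LinearIndependent k ((powSub k 𝔪 (e + 1 + m)).mkQ ∘ cellFam x y ℓ (m + 1))) :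
    LinearIndependent k ((powSub k 𝔪 (e + 1 + (m + 1))).mkQ ∘ cellFam x y ℓ (m + 1 + 1)) := by
  have hpow : ∀ r b, ℓ ^ r * y b ∈ 𝔪 ^ (r + e) := fun r b => by
    rw [pow_add]
    exact Ideal.mul_mem_mul (Ideal.pow_mem_pow hℓ r) (hy b)
  have hli' : ∀ g : α ⊕ β × Fin (m + 1) → k, ∑ s, g s • cellFam x y ℓ (m + 1) s ∈ 𝔪 ^ (e + 1 + m) →
      ∀ s, g s = 0 := fun g hg => Fintype.linearIndependent_iff.1 hli g (by
    simp_rw [Function.comp_apply, ← map_smul, ← map_sum]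
    exact (Submodule.Quotient.mk_eq_zero (powSub k 𝔪 (e + 1 + m))).2 hg)
  refine Fintype.linearIndependent_iff.2 fun g hg => ?_
  simp_rw [Function.comp_apply, ← map_smul, ← map_sum] at hg
  have hg' : ∑ s, g s • cellFam x y ℓ (m + 1 + 1) s ∈ 𝔪 ^ (e + 1 + (m + 1)) :=
    (Submodule.Quotient.mk_eq_zero (powSub k 𝔪 (e + 1 + (m + 1)))).1 hg
  let g₀ : α ⊕ β × Fin (m + 1) → k :=
    Sum.elim (fun a => g (Sum.inl a)) fun b => g (Sum.inr (b.1, b.2.castSucc))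
  have hsum : ∑ s, g s • cellFam x y ℓ (m + 1 + 1) s = ∑ s, g₀ s • cellFam x y ℓ (m + 1) s +
      ℓ * ∑ b, g (Sum.inr (b, Fin.last (m + 1))) • (ℓ ^ m * y b) := by
    rw [Fintype.sum_sum_type, Fintype.sum_sum_type, Fintype.sum_prod_type, Fintype.sum_prod_type,
      Finset.mul_sum]
    refine Eq.trans ?_ (add_assoc _ _ _).symm
    rw [← Finset.sum_add_distrib]
    congr 1
    refine Finset.sum_congr rfl fun b _ => ?_
    rw [Fin.sum_univ_castSucc]
    congr 1
    change g _ • (ℓ ^ (m + 1) * y b) = _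
    rw [mul_smul_comm, pow_succ', mul_assoc]
  have hlast : ℓ * ∑ b, g (Sum.inr (b, Fin.last (m + 1))) • (ℓ ^ m * y b) ∈ 𝔪 ^ (e + 1 + m) := by
    rw [Finset.mul_sum]
    refine Ideal.sum_mem _ fun b _ => ?_
    rw [mul_smul_comm, ← mul_assoc, ← pow_succ']
    have h1 := hpow (m + 1) b
    rw [show m + 1 + e = e + 1 + m by ring] at h1
    exact (powSub k 𝔪 (e + 1 + m)).smul_mem _ h1
  have hz₀ : ∀ s, g₀ s = 0 := hli' g₀ (by
    rw [hsum] at hg'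
    exact (Submodule.add_mem_iff_left _ hlast).1 (Ideal.pow_le_pow_right (by omega) hg'))
  have hz₁ : ∑ b, g (Sum.inr (b, Fin.last (m + 1))) • (ℓ ^ m * y b) ∈ 𝔪 ^ (e + 1 + m) := by
    refine mem_pow_of_mul_mem hfin hℓ hc (by omega) hd ?_
    rw [hsum, Finset.sum_eq_zero fun s _ => by rw [hz₀ s, zero_smul], zero_add] at hg'
    exact hg'
  let g₁ : α ⊕ β × Fin (m + 1) → k := Sum.elim (fun a => 0) fun b =>
    if b.2 = Fin.last m then g (Sum.inr (b.1, Fin.last (m + 1))) else 0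
  have hz₂ : ∀ s, g₁ s = 0 := hli' g₁ (by
    rw [Fintype.sum_sum_type, Fintype.sum_prod_type]
    convert hz₁ using 1
    simp [g₁, cellFam])
  rintro (a | ⟨b, r⟩)
  · exact hz₀ (Sum.inl a)
  · induction r using Fin.lastCases with
    | last => simpa [g₁] using hz₂ (Sum.inr (b, Fin.last m))
    | cast r => exact hz₀ (Sum.inr (b, r))

theorem linearIndependent_cellFam (hfin : ∀ t, Module.Finite k (Q ⧸ powSub k 𝔪 t))
    (hℓ : ℓ ∈ 𝔪)
    (hc : Module.finrank k (Q ⧸ (𝔪 ^ (e + 1) ⊔ Ideal.span {ℓ}).restrictScalars k) ≤ e)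
    {α β : Type*} [Fintype α] [Fintype β] {x : α → Q} {y : β → Q} (hy : ∀ b, y b ∈ 𝔪 ^ e)
    (hli : LinearIndependent k ((powSub k 𝔪 (e + 1)).mkQ ∘ cellFam x y ℓ 1)) (m : ℕ)
    (hd : ∀ m' < m, Module.finrank k (Q ⧸ powSub k 𝔪 (e + 1 + m')) + e ≤
      Module.finrank k (Q ⧸ powSub k 𝔪 (e + 1 + (m' + 1)))) :
    LinearIndependent k ((powSub k 𝔪 (e + 1 + m)).mkQ ∘ cellFam x y ℓ (m + 1)) := by
  induction m with
  | zero => exact hli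
  | succ m ih =>
    exact linearIndependent_cellFam_succ hfin hℓ hc (hd m (Nat.lt_succ_self m)) hy
      (ih fun m' h => hd m' (by omega))

end Multiplication

/-! ### Multiplication by linear forms on graded pieces. -/

section GradedPieces

variable {k Q : Type*} [Field k] [CommRing Q] [Algebra k Q] {N : ℕ}

/-- The graded piece `𝔪 ^ s / 𝔪 ^ (s + 1)` as a subspace of `Q / 𝔪 ^ (s + 1)`. -/
abbrev grPiece (k : Type*) {Q : Type*} [Field k] [CommRing Q] [Algebra k Q] (𝔪 : Ideal Q) (s : ℕ) :
    Submodule k (Q ⧸ powSub k 𝔪 (s + 1)) := (powSub k 𝔪 s).map (powSub k 𝔪 (s + 1)).mkQ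

theorem finrank_grPiece_add {𝔪 : Ideal Q} {s : ℕ} [Module.Finite k (Q ⧸ powSub k 𝔪 (s + 1))] :
    Module.finrank k (grPiece k 𝔪 s) + Module.finrank k (Q ⧸ powSub k 𝔪 s) =
      Module.finrank k (Q ⧸ powSub k 𝔪 (s + 1)) :=
  finrank_map_mkQ_add (K := powSub k 𝔪 (s + 1)) (Ideal.pow_le_pow_right (Nat.le_succ s))

variable (x : Fin N → Q)

theorem linForm_mulLeft_le (c : Fin N → k) (s : ℕ) : powSub k (Ideal.span (Set.range x)) s ≤
    (powSub k (Ideal.span (Set.range x)) (s + 1)).comap (LinearMap.mulLeft k (linForm k x c)) :=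
  fun _ hf => linForm_mul_mem c hf

/-- Multiplication by linear forms on the graded pieces. -/
def grMul (s : ℕ) : (Fin N → k) →ₗ[k] grPiece k (Ideal.span (Set.range x)) s →ₗ[k]
    grPiece k (Ideal.span (Set.range x)) (s + 1) :=
  LinearMap.mk₂ k (fun c v => ⟨(powSub k (Ideal.span (Set.range x)) (s + 1)).mapQ
      (powSub k (Ideal.span (Set.range x)) (s + 1 + 1)) (LinearMap.mulLeft k (linForm k x c))
      (linForm_mulLeft_le x c (s + 1)) v, by
        obtain ⟨_, f, hf, rfl⟩ := v
        exact ⟨linForm k x c * f, linForm_mul_mem c hf, rfl⟩⟩)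
    (by
      rintro c c' ⟨_, f, hf, rfl⟩
      refine Subtype.ext ?_
      change Submodule.mkQ _ (linForm k x (c + c') * f) =
        Submodule.mkQ _ (linForm k x c * f) + Submodule.mkQ _ (linForm k x c' * f)
      rw [map_add, add_mul, map_add])
    (by
      rintro a c ⟨_, f, hf, rfl⟩
      refine Subtype.ext ?_
      change Submodule.mkQ _ (linForm k x (a • c) * f) = a • Submodule.mkQ _ (linForm k x c * f)
      rw [map_smul, smul_mul_assoc, map_smul])
    (fun c v w => Subtype.ext (map_add _ _ _))
    (fun a c v => Subtype.ext (map_smul _ _ _))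

/-- The class of an element of `𝔪 ^ s` in the graded piece. -/
def grMk {𝔪 : Ideal Q} {s : ℕ} (f : Q) (hf : f ∈ 𝔪 ^ s) : grPiece k 𝔪 s :=
  ⟨(powSub k 𝔪 (s + 1)).mkQ f, Submodule.mem_map_of_mem hf⟩

theorem grMul_grMk {s : ℕ} (c : Fin N → k) (f : Q) (hf : f ∈ Ideal.span (Set.range x) ^ s) :
    grMul x s c (grMk f hf) = grMk (linForm k x c * f) (linForm_mul_mem c hf) := rfl

theorem exists_grMk {𝔪 : Ideal Q} {s : ℕ} (v : grPiece k 𝔪 s) : ∃ f hf, v = grMk f hf := by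
  obtain ⟨_, f, hf, rfl⟩ := v
  exact ⟨f, hf, rfl⟩

theorem grMul_comm {s : ℕ} (c c' : Fin N → k) (v : grPiece k (Ideal.span (Set.range x)) s) :
    grMul x (s + 1) c (grMul x s c' v) = grMul x (s + 1) c' (grMul x s c v) := by
  obtain ⟨f, hf, rfl⟩ := exists_grMk v
  rw [grMul_grMk, grMul_grMk, grMul_grMk, grMul_grMk]
  refine Subtype.ext ?_
  change Submodule.mkQ _ (linForm k x c * (linForm k x c' * f)) =
    Submodule.mkQ _ (linForm k x c' * (linForm k x c * f))
  rw [mul_left_comm]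

theorem surjective_grMul_iff {s : ℕ} (c : Fin N → k) : Function.Surjective (grMul x s c) ↔
    Ideal.span (Set.range x) ^ (s + 1) ≤ Ideal.span (Set.range x) ^ (s + 2) ⊔
      Ideal.span {linForm k x c} * Ideal.span (Set.range x) ^ s := by
  constructor
  · intro h z hz
    obtain ⟨v, hv⟩ := h (grMk z hz)
    obtain ⟨f, hf, rfl⟩ := exists_grMk v
    rw [grMul_grMk] at hv
    have h1 : (powSub k (Ideal.span (Set.range x)) (s + 1 + 1)).mkQ (linForm k x c * f) =
        (powSub k (Ideal.span (Set.range x)) (s + 1 + 1)).mkQ z := congr($hv.1)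
    have h2 : z - linForm k x c * f ∈ Ideal.span (Set.range x) ^ (s + 2) :=
      (Submodule.Quotient.eq (powSub k (Ideal.span (Set.range x)) (s + 1 + 1))).1 h1.symm
    rw [← sub_add_cancel z (linForm k x c * f)]
    exact Submodule.add_mem_sup h2 (Ideal.mul_mem_mul (Ideal.mem_span_singleton_self _) hf)
  · intro h v
    obtain ⟨z, hz, rfl⟩ := exists_grMk v
    obtain ⟨a, ha, b, hb, hab⟩ := Submodule.mem_sup.1 (h hz)
    obtain ⟨f, hf, rfl⟩ := Ideal.mem_span_singleton_mul.1 hb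
    refine ⟨grMk f hf, ?_⟩
    rw [grMul_grMk]
    refine Subtype.ext ?_
    refine (Submodule.Quotient.eq (powSub k (Ideal.span (Set.range x)) (s + 1 + 1))).2 ?_
    rw [← hab, sub_add_cancel_right]
    exact neg_mem (show a ∈ powSub k (Ideal.span (Set.range x)) (s + 1 + 1) from ha)

/-- Multiplying the inclusion by 𝔪: the associated graded ring is generated in degree one, so
surjectivity propagates to higher degrees. -/
theorem le_sup_span_mul_succ {𝔪 : Ideal Q} {y : Q} {s : ℕ}
    (h : 𝔪 ^ (s + 1) ≤ 𝔪 ^ (s + 2) ⊔ Ideal.span {y} * 𝔪 ^ s) :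
    𝔪 ^ (s + 1 + 1) ≤ 𝔪 ^ (s + 1 + 2) ⊔ Ideal.span {y} * 𝔪 ^ (s + 1) := by
  have h1 := Ideal.mul_mono_right (I := 𝔪) h
  rwa [Ideal.mul_sup, mul_left_comm, ← pow_succ', ← pow_succ', ← pow_succ'] at h1

/-- If the dimension of the graded piece of degree `d + 1` is at most `d + 1`, then multiplication
by some linear form maps the graded pieces of degree at least `d` onto the next ones. -/
theorem exists_surjective_grMul [Infinite k] {d : ℕ}
    (hfin : Module.Finite k (Q ⧸ powSub k (Ideal.span (Set.range x)) (d + 1 + 1)))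
    (hd : Module.finrank k (grPiece k (Ideal.span (Set.range x)) (d + 1)) ≤ d + 1) :
    ∃ c : Fin N → k, ∀ s, d ≤ s → Function.Surjective (grMul x s c) := by
  obtain ⟨c, hc⟩ := exists_linForm_le_sup x d (powSub k (Ideal.span (Set.range x)) (d + 1 + 1))
    inferInstance hd
  refine ⟨c, fun s hs => (surjective_grMul_iff x c).2 ?_⟩
  induction s, hs using Nat.le_induction with
  | base =>
    intro z hz
    obtain ⟨a, ha, _, ⟨f, hf, rfl⟩, hab⟩ := Submodule.mem_sup.1 (hc hz)
    rw [← hab]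
    exact Submodule.add_mem_sup ha (Ideal.mul_mem_mul (Ideal.mem_span_singleton_self _) hf)
  | succ s hs ih => exact le_sup_span_mul_succ ih

/-- Some of the given linear forms acts bijectively between the graded pieces. -/
theorem exists_surjective_grMul_of_finrank_eq [IsAlgClosed k] {e s : ℕ}
    (hfin : ∀ t, Module.Finite k (Q ⧸ powSub k (Ideal.span (Set.range x)) t))
    (hs : e ≤ s) (he : ∀ t, s ≤ t → Module.finrank k (grPiece k (Ideal.span (Set.range x)) t) = e)
    (L : Fin (e * (N - 1) + 1) → Fin N → k)
    (hL : ∀ c : Fin N ↪ Fin (e * (N - 1) + 1), LinearIndependent k fun i => L (c i)) :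
    ∃ q, Function.Surjective (grMul x (s + 1) (L q)) := by
  classical
  have : Infinite k := IsAlgClosed.instInfinite
  obtain ⟨y, hy⟩ := exists_surjective_grMul x (d := s) (hfin _) (by rw [he (s + 1) (by omega)]; omega)
  have hfr : ∀ t, s ≤ t → Module.finrank k (grPiece k (Ideal.span (Set.range x)) t) =
      Module.finrank k (grPiece k (Ideal.span (Set.range x)) (t + 1)) := fun t ht => by
    rw [he t ht, he (t + 1) (by omega)]
  have hbij : ∀ t, s ≤ t → Function.Bijective (grMul x t y) := fun t ht =>
    ⟨(LinearMap.injective_iff_surjective_of_finrank_eq_finrank (hfr t ht)).2 (hy t ht), hy t ht⟩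
  -- As y acts bijectively, y⁻¹c is an endomorphism of one graded piece for every form c. These
  -- operators commute, since applying y twice turns the product of two of them into the symmetric
  -- expression c c'.
  let E := LinearEquiv.ofBijective (grMul x (s + 1) y) (hbij (s + 1) (by omega))
  have hE : ∀ v, grMul x (s + 1) y (E.symm v) = v := fun v => E.apply_symm_apply v
  let T : (Fin N → k) →ₗ[k] Module.End k (grPiece k (Ideal.span (Set.range x)) (s + 1)) :=
    (LinearMap.llcomp k _ _ _ E.symm.toLinearMap).comp (grMul x (s + 1))
  have hT : ∀ c v, T c v = E.symm (grMul x (s + 1) c v) := fun c v => rfl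
  have hTT : ∀ c c' v, grMul x (s + 1 + 1) y (grMul x (s + 1) y (T c (T c' v))) =
      grMul x (s + 1 + 1) c (grMul x (s + 1) c' v) := fun c c' v => by
    rw [hT, hE, grMul_comm, hT, hE]
  have hcard := card_filter_not_injective_le L hL T (fun c c' => LinearMap.ext fun v => by
    refine (hbij (s + 1) (by omega)).1 ((hbij (s + 1 + 1) (by omega)).1 ?_)
    change grMul x (s + 1 + 1) y (grMul x (s + 1) y (T c (T c' v))) =
      grMul x (s + 1 + 1) y (grMul x (s + 1) y (T c' (T c v)))
    rw [hTT, hTT, grMul_comm]) y (LinearMap.ext fun v => by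
    rw [hT]
    exact E.symm_apply_apply v)
  rw [he (s + 1) (by omega)] at hcard
  -- At most e(N - 1) of the forms fail, and there is one more than that.
  have hex : ∃ q, Function.Injective (T (L q)) := by
    by_contra! hcon
    rw [Finset.filter_true_of_mem fun q _ => hcon q, Finset.card_univ, Fintype.card_fin] at hcard
    omega
  obtain ⟨q, hq⟩ := hex
  refine ⟨q, (LinearMap.injective_iff_surjective_of_finrank_eq_finrank
    (hfr (s + 1) (by omega))).1 fun v w hvw => hq ?_⟩
  rw [hT, hT, hvw]

end GradedPieces

/-! ### A superficial element among the given linear forms. -/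

section Curve

variable {k Q : Type*} [Field k] [IsAlgClosed k] [CommRing Q] [Algebra k Q] {N : ℕ}

/-- A local ring of dimension one with Hilbert polynomial of degree one and leading coefficient `e`:
some of the given linear forms is a superficial element of multiplicity `e`, and the Hilbert
function takes the value of the Hilbert polynomial already at `e - 1`. -/
theorem exists_superficial [IsNoetherianRing Q] (x : Fin N → Q)
    (hjac : Ideal.span (Set.range x) ≤ Ideal.jacobson ⊥)
    (hfin : ∀ t, Module.Finite k (Q ⧸ powSub k (Ideal.span (Set.range x)) t)) {e : ℕ} (he : e ≠ 0)
    (hdim : ∀ t, e + 1 ≤ t → Module.finrank k (Q ⧸ powSub k (Ideal.span (Set.range x)) t) + e =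
      Module.finrank k (Q ⧸ powSub k (Ideal.span (Set.range x)) (t + 1)))
    (hnzd : ∃ z ∈ Ideal.span (Set.range x), z ∈ nonZeroDivisors Q)
    (L : Fin (e * (N - 1) + 1) → Fin N → k)
    (hL : ∀ c : Fin N ↪ Fin (e * (N - 1) + 1), LinearIndependent k fun i => L (c i)) :
    ∃ q, Module.finrank k (Q ⧸ (Ideal.span (Set.range x) ^ (e + 1) ⊔
        Ideal.span {linForm k x (L q)}).restrictScalars k) ≤ e ∧
      Module.finrank k (Q ⧸ powSub k (Ideal.span (Set.range x)) e) + e =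
        Module.finrank k (Q ⧸ powSub k (Ideal.span (Set.range x)) (e + 1)) := by
  set 𝔪 := Ideal.span (Set.range x) with h𝔪
  have hgr : ∀ t, e + 1 ≤ t → Module.finrank k (grPiece k 𝔪 t) = e := fun t ht => by
    have h1 := finrank_grPiece_add (k := k) (𝔪 := 𝔪) (s := t)
    have h2 := hdim t ht
    omega
  obtain ⟨q, hq⟩ := exists_surjective_grMul_of_finrank_eq x hfin (s := e + 1) (by omega) hgr L hL
  set ℓ := linForm k x (L q) with hℓ
  have hℓ𝔪 : ℓ ∈ 𝔪 := linForm_mem _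
  have hle : ∀ s, e + 1 + 1 ≤ s → 𝔪 ^ (s + 1) ≤ Ideal.span {ℓ} * 𝔪 ^ s := by
    intro s hs
    have h1 : 𝔪 ^ (s + 1) ≤ 𝔪 ^ (s + 2) ⊔ Ideal.span {ℓ} * 𝔪 ^ s := by
      induction s, hs using Nat.le_induction with
      | base => exact (surjective_grMul_iff x (L q)).1 hq
      | succ s hs ih => exact le_sup_span_mul_succ ih
    -- Nakayama's lemma removes the error term 𝔪^(s+2).
    refine Submodule.le_of_le_smul_of_le_jacobson_bot (I := 𝔪) (IsNoetherian.noetherian _) hjac ?_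
    rw [sup_comm, smul_eq_mul, ← pow_succ']
    exact h1
  have hge : ∀ s, Ideal.span {ℓ} * 𝔪 ^ s ≤ 𝔪 ^ (s + 1) := fun s => by
    rw [pow_succ']
    exact Ideal.mul_mono_left ((Ideal.span_singleton_le_iff_mem _).2 hℓ𝔪)
  -- `ℓ` is a nonzerodivisor
  obtain ⟨z, hz𝔪, hz⟩ := hnzd
  have hℓz : ∀ a, ℓ * a = 0 → a = 0 := by
    intro a ha
    -- A power of the nonzerodivisor z is a multiple of ℓ, so whatever ℓ kills is killed by that
    -- power.
    have h1 : z ^ (e + 1 + 1 + 1) ∈ Ideal.span {ℓ} * 𝔪 ^ (e + 1 + 1) :=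
      hle _ le_rfl (Ideal.pow_mem_pow hz𝔪 _)
    obtain ⟨b, -, hb⟩ := Ideal.mem_span_singleton_mul.1 h1
    have h2 : a * z ^ (e + 1 + 1 + 1) = 0 := by
      rw [← hb, ← mul_assoc, mul_comm a, ha, zero_mul]
    exact (mul_right_mem_nonZeroDivisors_eq_zero_iff (pow_mem hz _)).1 h2
  have hcancel : ∀ {s a}, ℓ * a ∈ Ideal.span {ℓ} * 𝔪 ^ s → a ∈ 𝔪 ^ s := fun {s a} ha => by
    obtain ⟨b, hb, hab⟩ := Ideal.mem_span_singleton_mul.1 ha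
    have h1 := hℓz (b - a) (by rw [mul_sub, hab, sub_self])
    rwa [← sub_eq_zero.1 h1]
  -- the colength of `ℓ 𝔪 ^ s`
  have hsub : ∀ s, powSub k 𝔪 (max s (e + 1 + 1) + 1) ≤
      (Ideal.span {ℓ} * 𝔪 ^ s).restrictScalars k := fun s f hf =>
    Ideal.mul_mono_right (Ideal.pow_le_pow_right (le_max_left s (e + 1 + 1)))
      (hle _ (le_max_right _ _) hf)
  have hfin' : ∀ s, Module.Finite k (Q ⧸ (Ideal.span {ℓ} * 𝔪 ^ s).restrictScalars k) := fun s =>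
    have := hfin (max s (e + 1 + 1) + 1)
    finite_quotient_of_le (hsub s)
  have hlen : ∀ s, Module.finrank k (Q ⧸ (Ideal.span {ℓ} * 𝔪 ^ s).restrictScalars k) =
      Module.finrank k (Q ⧸ (Ideal.span {ℓ}).restrictScalars k) +
        Module.finrank k (Q ⧸ powSub k 𝔪 s) := by
    intro s
    have := hfin' s
    have h1 := finrank_map_mkQ_add (K := (Ideal.span {ℓ} * 𝔪 ^ s).restrictScalars k)
      (N := (Ideal.span {ℓ}).restrictScalars k) (Ideal.mul_le_left (I := Ideal.span {ℓ}))
    have h2 : powSub k 𝔪 s ≤ ((Ideal.span {ℓ} * 𝔪 ^ s).restrictScalars k).comap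
        (LinearMap.mulLeft k ℓ) := fun f hf =>
      Ideal.mul_mem_mul (Ideal.mem_span_singleton_self ℓ) hf
    have h3 : Function.Injective ((powSub k 𝔪 s).mapQ
        ((Ideal.span {ℓ} * 𝔪 ^ s).restrictScalars k) (LinearMap.mulLeft k ℓ) h2) := by
      rw [← LinearMap.ker_eq_bot, Submodule.ker_mapQ, eq_bot_iff, Submodule.map_le_iff_le_comap]
      intro a ha
      exact (Submodule.Quotient.mk_eq_zero (powSub k 𝔪 s)).2 (hcancel ha)
    have h4 := LinearMap.finrank_range_of_inj h3
    rw [congr(Module.finrank k $(range_mapQ_mulLeft h2)),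
      sup_eq_right.2 (Ideal.mul_le_left (I := Ideal.span {ℓ}))] at h4
    omega
  -- Here ℓ 𝔪^(e+2) = 𝔪^(e+3), so the colength of ℓ is a difference of consecutive values of the
  -- Hilbert function.
  have hℓe : Module.finrank k (Q ⧸ (Ideal.span {ℓ}).restrictScalars k) = e := by
    have h1 := hlen (e + 1 + 1)
    rw [le_antisymm (hge (e + 1 + 1)) (hle (e + 1 + 1) le_rfl)] at h1
    have h2 := hdim (e + 1 + 1) (by omega)
    change Module.finrank k (Q ⧸ powSub k 𝔪 (e + 1 + 1 + 1)) = _ at h1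
    omega
  have hℓe' : Module.finrank k (Q ⧸ (𝔪 ^ (e + 1) ⊔ Ideal.span {ℓ}).restrictScalars k) ≤ e := by
    have : Module.Finite k (Q ⧸ (Ideal.span {ℓ}).restrictScalars k) :=
      have := hfin' 0
      finite_quotient_of_le (K := (Ideal.span {ℓ} * 𝔪 ^ 0).restrictScalars k)
        (Ideal.mul_le_left (I := Ideal.span {ℓ}))
    exact (finrank_quotient_anti (K := (Ideal.span {ℓ}).restrictScalars k)
      (le_sup_right : Ideal.span {ℓ} ≤ 𝔪 ^ (e + 1) ⊔ Ideal.span {ℓ})).trans hℓe.le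
  refine ⟨q, hℓe', ?_⟩
  -- Because ℓ 𝔪^e is contained in 𝔪^(e+1), the graded piece of degree e has dimension at most e.
  -- With d = e - 1 this is the hypothesis of `exists_surjective_grMul`, which maps that piece onto
  -- the next one, of dimension e; hence equality.
  have hub : Module.finrank k (Q ⧸ powSub k 𝔪 (e + 1)) ≤
      e + Module.finrank k (Q ⧸ powSub k 𝔪 e) := by
    have := hfin' e
    have h1 := hlen e
    rw [hℓe] at h1
    rw [← h1]
    exact finrank_quotient_anti (K := (Ideal.span {ℓ} * 𝔪 ^ e).restrictScalars k) (hge e)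
  have hgre := finrank_grPiece_add (k := k) (𝔪 := 𝔪) (s := e)
  have : Infinite k := IsAlgClosed.instInfinite
  obtain ⟨d, rfl⟩ := Nat.exists_eq_succ_of_ne_zero he
  obtain ⟨c, hc⟩ := exists_surjective_grMul x (d := d) (hfin _) (by
    change Module.finrank k (grPiece k 𝔪 (d + 1)) ≤ d + 1
    rw [Nat.succ_eq_add_one] at hgre hub
    omega)
  have h1 := LinearMap.finrank_le_finrank_of_surjective (hc (d + 1) (by omega))
  have h2 := hgr (d + 1 + 1) le_rfl
  change Module.finrank k (grPiece k 𝔪 (d + 1 + 1)) ≤ Module.finrank k (grPiece k 𝔪 (d + 1)) at h1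
  rw [Nat.succ_eq_add_one] at hgre hub ⊢
  omega

end Curve

/-! ### Monomials and multiples of a linear form as a basis. -/

section CellFamilies

theorem restrictScalars_map_eq_span {B R Q : Type*} [CommRing B] [CommRing R] [CommRing Q]
    [Algebra B Q] (f : R →+* Q) (h : Submodule.span B (Set.range f) = ⊤) (I : Ideal R) :
    (I.map f).restrictScalars B = Submodule.span B (f '' I) := by
  refine le_antisymm (fun z hz => ?_) (Submodule.span_le.2 ?_)
  · refine Submodule.span_induction (p := fun z _ => z ∈ Submodule.span B (f '' I)) ?_
      (zero_mem _) (fun _ _ _ _ => add_mem) ?_ hz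
    · rintro _ ⟨a, ha, rfl⟩
      exact Submodule.subset_span ⟨a, ha, rfl⟩
    · intro a b _ hb
      have ha : a ∈ Submodule.span B (Set.range f) := h ▸ Submodule.mem_top
      rw [smul_eq_mul]
      refine Submodule.span_induction (p := fun b _ => a * b ∈ Submodule.span B (f '' I)) ?_
        (by simp) (fun _ _ _ _ h h' => by rw [mul_add]; exact add_mem h h')
        (fun c b _ h => by rw [mul_smul_comm]; exact Submodule.smul_mem _ _ h) hb
      rintro _ ⟨b, hb, rfl⟩
      refine Submodule.span_induction (p := fun a _ => a * f b ∈ Submodule.span B (f '' I)) ?_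
        (by simp) (fun _ _ _ _ h h' => by rw [add_mul]; exact add_mem h h')
        (fun c b _ h => by rw [smul_mul_assoc]; exact Submodule.smul_mem _ _ h) ha
      rintro _ ⟨a, rfl⟩
      rw [← map_mul]
      exact Submodule.subset_span ⟨_, I.mul_mem_left a hb, rfl⟩
  · rintro _ ⟨a, ha, rfl⟩
    exact Ideal.mem_map_of_mem f ha

variable {k : Type u} [Field k] {N : ℕ}

/-- The monomials with exponents in a finite set. -/
def monom (k : Type u) [Field k] {N : ℕ} (i : Finset (Fin N →₀ ℕ)) (a : i) : PS N k :=
  MvPowerSeries.monomial a.1 1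

/-- The set of conditions that cut out the open sets `B_n(i, j, q)`: it spans modulo
`M ^ (e + 1)`. -/
def baseSet (k : Type u) [Field k] {N : ℕ} (e : ℕ) (i j : Finset (Fin N →₀ ℕ)) : Set (PS N k) :=
  Set.range (monom k i) ∪ Set.range (monom k j) ∪ (varIdeal N k ^ (e + 1) : Ideal (PS N k))

/-- The set of conditions that cut out the open sets `U_n(ℓ)`. -/
def colengthSet (e : ℕ) (ℓ : PS N k) (v : Fin e → PS N k) : Set (PS N k) :=
  Set.range v ∪ (varIdeal N k ^ (e + 1) ⊔ Ideal.span {ℓ} : Ideal (PS N k))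

theorem map_cellFam {R Q α β F : Type*} [CommRing R] [CommRing Q] [FunLike F R Q]
    [RingHomClass F R Q] (f : F) (x : α → R) (y : β → R) (ℓ : R) (m : ℕ) :
    f ∘ cellFam x y ℓ m = cellFam (f ∘ x) (f ∘ y) (f ℓ) m := by
  funext s
  rcases s with a | b
  · rfl
  · simp [cellFam]

theorem range_cellFam_one {Q α β : Type*} [CommRing Q] (x : α → Q) (y : β → Q) (ℓ : Q) :
    Set.range (cellFam x y ℓ 1) = Set.range x ∪ Set.range y := by
  ext z
  constructor
  · rintro ⟨a | b, rfl⟩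
    · exact Or.inl ⟨a, rfl⟩
    · exact Or.inr ⟨b.1, by simp [cellFam]⟩
  · rintro (⟨a, rfl⟩ | ⟨b, rfl⟩)
    · exact ⟨Sum.inl a, rfl⟩
    · exact ⟨Sum.inr (b, 0), by simp [cellFam]⟩

theorem monom_mem {i : Finset (Fin N →₀ ℕ)} {e : ℕ} (hi : ∀ a ∈ i, e ≤ a.degree) (a : i) :
    monom k i a ∈ varIdeal N k ^ e :=
  monomial_mem_varIdeal_pow a.1 (hi a a.2) 1

theorem linearForm_mem (c : Fin N → k) : linearForm c ∈ varIdeal N k :=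
  Ideal.sum_mem _ fun i _ => Ideal.mul_mem_left _ _ (Ideal.subset_span ⟨i, rfl⟩)

variable {K Q : Type u} [Field K] [CommRing Q] [Algebra K Q]

theorem linearIndependent_mkQ_of_span {P : Submodule K Q} {ι : Type*} [Fintype ι] {v : ι → Q}
    (h : Submodule.span K (Set.range v) ⊔ P = ⊤)
    (hc : Fintype.card ι = Module.finrank K (Q ⧸ P)) : LinearIndependent K (P.mkQ ∘ v) := by
  refine linearIndependent_of_top_le_span_of_card_eq_finrank ?_ hc
  rw [Set.range_comp, ← Submodule.map_span]
  have h1 := congr(Submodule.map P.mkQ $h)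
  rw [Submodule.map_sup, Submodule.mkQ_map_self, sup_bot_eq, Submodule.map_top,
    Submodule.range_mkQ] at h1
  exact h1.ge

theorem span_sup_eq_top_of_linearIndependent {P : Submodule K Q} {ι : Type*} [Fintype ι]
    [Module.Finite K (Q ⧸ P)] {v : ι → Q} (h : LinearIndependent K (P.mkQ ∘ v))
    (hc : Fintype.card ι = Module.finrank K (Q ⧸ P)) :
    Submodule.span K (Set.range v) ⊔ P = ⊤ := by
  have h1 := h.span_eq_top_of_card_eq_finrank' hc
  rw [Set.range_comp, ← Submodule.map_span] at h1
  rw [sup_comm, ← Submodule.comap_map_mkQ, h1, Submodule.comap_top]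

/-- If the conditions for the cell hold modulo `M ^ (e + 1)`, then the cell is a basis. -/
theorem span_cellFam_eq_top {f : PS N k →+* Q} (hf : Submodule.span K (Set.range f) = ⊤)
    [Module.Finite K Q] {e m : ℕ} {e₁ : ℤ}
    (hdim : ∀ t : ℕ, e + 1 ≤ t → t ≤ e + 1 + m → (Module.finrank K
      (Q ⧸ Submodule.span K (f '' (varIdeal N k ^ t : Ideal (PS N k)))) : ℤ) =
        hilbPoly e e₁ ((t : ℤ) - 1))
    (hnil : ∀ z ∈ varIdeal N k ^ (e + 1 + m), f z = 0)
    {i j : Finset (Fin N →₀ ℕ)} (hi : (i.card : ℤ) = hilbPoly e e₁ ((e : ℤ) - 1))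
    (hj : j.card = e) (hj' : ∀ b ∈ j, b.degree = e) {ℓ : PS N k} (hℓ : ℓ ∈ varIdeal N k)
    (h₀ : Submodule.span K (f '' baseSet k e i j) = ⊤) {v : Fin e → PS N k}
    (h₁ : Submodule.span K (f '' colengthSet e ℓ v) = ⊤) :
    Submodule.span K (f '' Set.range (cellFam (monom k i) (monom k j) ℓ (m + 1))) = ⊤ := by
  let 𝔪 : Ideal Q := (varIdeal N k).map f
  have hpow : ∀ t, powSub K 𝔪 t =
      Submodule.span K (f '' (varIdeal N k ^ t : Ideal (PS N k))) := fun t => by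
    rw [powSub, ← Ideal.map_pow]
    exact restrictScalars_map_eq_span f hf _
  have hdim' : ∀ t : ℕ, e + 1 ≤ t → t ≤ e + 1 + m →
      (Module.finrank K (Q ⧸ powSub K 𝔪 t) : ℤ) = e * t - e₁ := fun t h h' => by
    rw [hpow, hdim t h h', hilbPoly]
    ring
  rw [hilbPoly] at hi
  have hspan0 : Submodule.span K (Set.range (cellFam (f ∘ monom k i) (f ∘ monom k j) (f ℓ) 1)) ⊔
      powSub K 𝔪 (e + 1) = ⊤ := by
    rw [hpow, range_cellFam_one, Set.range_comp, Set.range_comp, ← Set.image_union,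
      ← Submodule.span_union, ← Set.image_union]
    exact h₀
  -- The number of elements is p(e - 1) + e = p(e), the dimension of the quotient by 𝔪^(e+1).
  have hli := linearIndependent_mkQ_of_span hspan0 (by
    have h1 := hdim' (e + 1) le_rfl (by omega)
    rw [Fintype.card_sum, Fintype.card_prod, Fintype.card_coe, Fintype.card_coe, Fintype.card_fin,
      hj]
    push_cast at h1 ⊢
    zify
    rw [hi, h1]
    ring)
  have hc : Module.finrank K (Q ⧸ (𝔪 ^ (e + 1) ⊔ Ideal.span {f ℓ}).restrictScalars K) ≤ e := by
    have h1 : (𝔪 ^ (e + 1) ⊔ Ideal.span {f ℓ}).restrictScalars K =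
        Submodule.span K (f '' (varIdeal N k ^ (e + 1) ⊔ Ideal.span {ℓ} : Ideal (PS N k))) := by
      rw [← restrictScalars_map_eq_span f hf, Ideal.map_sup, Ideal.map_pow, Ideal.map_span,
        Set.image_singleton]
    set P := (𝔪 ^ (e + 1) ⊔ Ideal.span {f ℓ}).restrictScalars K with hP
    have h2 : Submodule.span K (Set.range (P.mkQ ∘ f ∘ v)) = ⊤ := by
      rw [colengthSet, Set.image_union, Submodule.span_union, ← h1, ← Set.range_comp] at h₁
      have h3 := congr(Submodule.map P.mkQ $h₁)
      rw [Submodule.map_sup, Submodule.mkQ_map_self, sup_bot_eq, Submodule.map_top,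
        Submodule.range_mkQ, Submodule.map_span, ← Set.range_comp] at h3
      exact h3
    have h4 := finrank_range_le_card (R := K) (P.mkQ ∘ f ∘ v)
    rw [Set.finrank, h2, finrank_top, Fintype.card_fin] at h4
    exact h4
  have hli' := linearIndependent_cellFam (fun t => inferInstance) (Ideal.mem_map_of_mem f hℓ) hc
    (fun b => by
      rw [← Ideal.map_pow]
      exact Ideal.mem_map_of_mem f (monom_mem (fun b hb => (hj' b hb).ge) b)) hli m
    (fun m' hm' => by
      have h1 := hdim' (e + 1 + m') (by omega) (by omega)
      have h2 := hdim' (e + 1 + (m' + 1)) (by omega) (by omega)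
      zify
      rw [h1, h2]
      push_cast
      apply le_of_eq
      ring)
  -- Now the number of elements is p(e - 1) + e(m + 1) = p(e + m), again the dimension, so
  -- independence turns back into spanning.
  have h5 := span_sup_eq_top_of_linearIndependent hli' (by
    have h1 := hdim' (e + 1 + m) (by omega) le_rfl
    rw [Fintype.card_sum, Fintype.card_prod, Fintype.card_coe, Fintype.card_coe, Fintype.card_fin,
      hj]
    zify
    rw [hi, h1]
    push_cast
    ring)
  have h6 : Submodule.span K (f '' (varIdeal N k ^ (e + 1 + m) : Ideal (PS N k))) = ⊥ := by
    rw [Submodule.span_eq_bot]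
    rintro _ ⟨z, hz, rfl⟩
    exact hnil z hz
  rw [hpow, h6, sup_bot_eq, ← map_cellFam f] at h5
  rwa [← Set.range_comp]

end CellFamilies

/-! ### Every curve singularity lies in a cell. -/

section CurveCells

theorem exists_finset_span_eq {k V ι : Type*} [Field k] [AddCommGroup V] [Module k V]
    [Module.Finite k V] (v : ι → V) (S : Set ι) : ∃ i : Finset ι, (i : Set ι) ⊆ S ∧
      Submodule.span k (v '' i) = Submodule.span k (v '' S) ∧
      i.card = Module.finrank k (Submodule.span k (v '' S)) := by
  obtain ⟨b, hbS, -, hb, hli⟩ := exists_linearIndepOn_extension (K := k) (v := v)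
    (linearIndepOn_empty k v) (Set.empty_subset S)
  have hfin : Finite b := LinearIndependent.finite (R := k) hli
  cases nonempty_fintype b
  have hspan : Submodule.span k (v '' b) = Submodule.span k (v '' S) :=
    le_antisymm (Submodule.span_mono (Set.image_mono hbS)) (Submodule.span_le.2 hb)
  refine ⟨b.toFinset, by simpa using hbS, by simpa using hspan, ?_⟩
  have h1 := finrank_span_eq_card (R := k) hli
  rw [Set.toFinset_card, ← h1, ← hspan, Set.image_eq_range]

/-- A part of S is chosen to give a basis of V/P, and a part of T to give a basis of P/P'. It is
applied to monomials of degree less than e₀ and of degree e₀. -/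
theorem exists_finsets_adapted {k V ι : Type*} [Field k] [AddCommGroup V] [Module k V]
    (v : ι → V) {P P' : Submodule k V} (hP : P' ≤ P) [Module.Finite k (V ⧸ P')] {S T : Set ι}
    (hS : Submodule.span k (v '' S) ⊔ P = ⊤) (hT : Submodule.span k (v '' T) ⊔ P' = P) :
    ∃ i j : Finset ι, (i : Set ι) ⊆ S ∧ (j : Set ι) ⊆ T ∧ i.card = Module.finrank k (V ⧸ P) ∧
      j.card + Module.finrank k (V ⧸ P) = Module.finrank k (V ⧸ P') ∧
      Submodule.span k (v '' i ∪ v '' j) ⊔ P' = ⊤ := by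
  have := finite_quotient_of_le hP
  have key : ∀ (R : Submodule k V) (i : Set ι), Submodule.span k (v '' i) ⊔ R =
      (Submodule.span k ((R.mkQ ∘ v) '' i)).comap R.mkQ := fun R i => by
    rw [Set.image_comp, ← Submodule.map_span, Submodule.comap_map_mkQ, sup_comm]
  obtain ⟨i, hi, hi', hic⟩ := exists_finset_span_eq (k := k) (P.mkQ ∘ v) S
  obtain ⟨j, hj, hj', hjc⟩ := exists_finset_span_eq (k := k) (P'.mkQ ∘ v) T
  refine ⟨i, j, hi, hj, ?_, ?_, ?_⟩
  · have h1 : Submodule.span k ((P.mkQ ∘ v) '' S) = ⊤ := by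
      rw [Set.image_comp, ← Submodule.map_span]
      have h3 := congr(Submodule.map P.mkQ $hS)
      rwa [Submodule.map_sup, Submodule.mkQ_map_self, sup_bot_eq, Submodule.map_top,
        Submodule.range_mkQ] at h3
    rw [hic, h1, finrank_top]
  · have h3 := congr(Submodule.map P'.mkQ $hT)
    rw [Submodule.map_sup, Submodule.mkQ_map_self, sup_bot_eq] at h3
    rw [hjc, ← finrank_map_mkQ_add hP, Set.image_comp, ← Submodule.map_span, h3]
  · rw [Submodule.span_union, sup_assoc, key P', hj', ← key P', hT, key P, hi', ← key P, hS]

variable {k : Type u} [Field k] {N : ℕ}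

theorem span_monomials_sup_varIdeal_pow (e : ℕ) :
    Submodule.span k ((fun m => (MvPowerSeries.monomial m 1 : PS N k)) ''
      {m : Fin N →₀ ℕ | m.degree = e}) ⊔ (varIdeal N k ^ (e + 1)).restrictScalars k =
      (varIdeal N k ^ e).restrictScalars k := by
  classical
  refine le_antisymm (sup_le (Submodule.span_le.2 ?_) ?_) fun f hf => ?_
  · rintro _ ⟨m, hm, rfl⟩
    exact monomial_mem_varIdeal_pow m (le_of_eq hm.symm) 1
  · exact Ideal.pow_le_pow_right (Nat.le_succ e)
  · have hfin : {m : Fin N →₀ ℕ | m.degree = e}.Finite :=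
      (Finsupp.finite_of_degree_lt (e + 1)).subset fun m hm => by
        change m.degree = e at hm
        change m.degree < e + 1
        omega
    refine Submodule.mem_sup.2 ⟨∑ m ∈ hfin.toFinset,
      f.coeff m • (MvPowerSeries.monomial m 1 : PS N k), ?_, _, ?_, add_sub_cancel _ f⟩
    · exact Submodule.sum_mem _ fun m hm => Submodule.smul_mem _ _
        (Submodule.subset_span ⟨m, hfin.mem_toFinset.1 hm, rfl⟩)
    · change _ ∈ varIdeal N k ^ (e + 1)
      rw [mem_varIdeal_pow_iff]
      intro m hm
      rw [map_sub, map_sum]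
      simp only [map_smul, MvPowerSeries.coeff_monomial, smul_eq_mul, mul_ite, mul_one, mul_zero]
      rw [Finset.sum_ite_eq]
      split_ifs with h
      · exact sub_self _
      · have h1 : m.degree ≠ e := fun h' => h (hfin.mem_toFinset.2 h')
        rw [sub_zero]
        exact mem_varIdeal_pow_iff.1 hf m (by omega)

theorem span_monomials_sup_eq_top (e : ℕ) :
    Submodule.span k ((fun m => (MvPowerSeries.monomial m 1 : PS N k)) ''
      {m : Fin N →₀ ℕ | m.degree < e}) ⊔ (varIdeal N k ^ e).restrictScalars k = ⊤ := by
  rw [eq_top_iff]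
  intro f _
  obtain ⟨g, hg, hfg⟩ := span_monomials_sup e f
  exact Submodule.mem_sup.2 ⟨g, hg, _, hfg, add_sub_cancel _ _⟩

theorem varIdeal_le_jacobson : varIdeal N k ≤ Ideal.jacobson ⊥ := by
  rw [IsLocalRing.jacobson_eq_maximalIdeal _ bot_ne_top, varIdeal, Ideal.span_le]
  rintro _ ⟨i, rfl⟩
  simp [IsLocalRing.mem_maximalIdeal, MvPowerSeries.isUnit_iff_constantCoeff]

theorem map_varIdeal_le_jacobson (I : Ideal (PS N k)) :
    (varIdeal N k).map (Ideal.Quotient.mk I) ≤ Ideal.jacobson ⊥ := by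
  rw [Ideal.map_le_iff_le_comap]
  intro f hf
  have h1 := varIdeal_le_jacobson hf
  rw [Ideal.mem_comap, Ideal.mem_jacobson_bot]
  rw [Ideal.mem_jacobson_bot] at h1
  intro y
  obtain ⟨y, rfl⟩ := Ideal.Quotient.mk_surjective y
  simpa using (h1 y).map (Ideal.Quotient.mk I)

/-- `(R / I) / J (R / I)` has the dimension of `R / (I + J)`. -/
theorem finrank_quotient_map (I J : Ideal (PS N k)) :
    Module.finrank k ((PS N k ⧸ I) ⧸ (J.map (Ideal.Quotient.mk I)).restrictScalars k) =
      Module.finrank k (PS N k ⧸ (I ⊔ J)) := by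
  rw [(Submodule.Quotient.restrictScalarsEquiv k (J.map (Ideal.Quotient.mk I))).finrank_eq]
  exact (DoubleQuot.quotQuotEquivQuotSupₐ k I J).toLinearEquiv.finrank_eq

theorem finite_quotient_map {I J : Ideal (PS N k)} [Module.Finite k (PS N k ⧸ (I ⊔ J))] :
    Module.Finite k ((PS N k ⧸ I) ⧸ (J.map (Ideal.Quotient.mk I)).restrictScalars k) :=
  Module.Finite.equiv ((Submodule.Quotient.restrictScalarsEquiv k
    (J.map (Ideal.Quotient.mk I))).trans (DoubleQuot.quotQuotEquivQuotSupₐ k I J).toLinearEquiv).symm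

theorem map_varIdeal (I : Ideal (PS N k)) : (varIdeal N k).map (Ideal.Quotient.mk I) =
    Ideal.span (Set.range fun i => Ideal.Quotient.mk I (MvPowerSeries.X i : PS N k)) := by
  rw [varIdeal, Ideal.map_span, ← Set.range_comp]
  rfl

theorem linForm_mk (I : Ideal (PS N k)) (c : Fin N → k) :
    linForm k (fun i => Ideal.Quotient.mk I (MvPowerSeries.X i : PS N k)) c =
      Ideal.Quotient.mk I (linearForm c) := by
  rw [Fintype.linearCombination_apply, linearForm, map_sum]
  refine Finset.sum_congr rfl fun i _ => ?_
  rw [← MvPowerSeries.smul_eq_C_mul]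
  rfl

/-- The multiplicity of a curve singularity is positive. -/
theorem HasHilbertPolynomial.ne_zero {I : Ideal (PS N k)} {e₀ : ℕ} {e₁ : ℤ}
    (h : HasHilbertPolynomial I e₀ e₁) (hI : IsCurveSingularity I) : e₀ ≠ 0 := by
  rintro rfl
  obtain ⟨hdim, x, hx, hx'⟩ := hI
  obtain ⟨t, ht⟩ := Filter.eventually_atTop.1 h
  have h1 := ht t le_rfl
  have h2 := ht (t + 1) (Nat.le_succ t)
  simp only [hilbPoly, Nat.cast_zero, zero_mul] at h1 h2
  set 𝔪 := (varIdeal N k).map (Ideal.Quotient.mk I) with h𝔪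
  have hfin : ∀ t, Module.Finite k ((PS N k ⧸ I) ⧸ powSub k 𝔪 t) := fun t => by
    have := finite_quotient t (I ⊔ varIdeal N k ^ t) le_sup_right
    rw [powSub, h𝔪, ← Ideal.map_pow]
    exact finite_quotient_map
  -- If e₀ = 0 the Hilbert function is eventually constant, so the powers of 𝔪 become stationary and
  -- vanish by Nakayama. Then the nonzerodivisor x is nilpotent and the ring is zero, contradicting
  -- dimension one.
  have h3 : powSub k 𝔪 (t + 1 + 1) = powSub k 𝔪 (t + 1) := by
    refine eq_of_finrank_quotient_le (Ideal.pow_le_pow_right (Nat.le_succ _)) (le_of_eq ?_)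
    rw [powSub, powSub, h𝔪, ← Ideal.map_pow, ← Ideal.map_pow, finrank_quotient_map,
      finrank_quotient_map]
    zify
    rw [h1, ← h2]
  have h4 : 𝔪 ^ (t + 1 + 1) = 𝔪 ^ (t + 1) := by
    ext z
    exact SetLike.ext_iff.1 h3 z
  have h5 : 𝔪 ^ (t + 1) = ⊥ := by
    refine Submodule.eq_bot_of_le_smul_of_le_jacobson_bot 𝔪 _ (IsNoetherian.noetherian _) ?_
      (map_varIdeal_le_jacobson I)
    rw [smul_eq_mul, ← pow_succ', h4]
  have h6 : Ideal.Quotient.mk I x ^ (t + 1) = 0 := by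
    have h7 := Ideal.pow_mem_pow (Ideal.mem_map_of_mem (Ideal.Quotient.mk I) hx) (t + 1)
    rw [← h𝔪, h5] at h7
    exact h7
  have h7 := pow_mem hx' (t + 1)
  rw [h6] at h7
  have h8 : Subsingleton (PS N k ⧸ I) :=
    subsingleton_of_zero_eq_one (mem_nonZeroDivisors_iff.1 h7 |>.1 1 (by simp)).symm
  rw [ringKrullDim_eq_bot_of_subsingleton] at hdim
  exact absurd hdim (by decide)

/-- A curve singularity lies in one of the cells. -/
theorem IsCurveSingularity.exists_cell [IsAlgClosed k] {I : Ideal (PS N k)}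
    (hI : IsCurveSingularity I) {e₀ : ℕ} {e₁ : ℤ} (he : e₀ ≠ 0)
    (hdim : ∀ t : ℕ, e₀ + 1 ≤ t →
      (Module.finrank k (PS N k ⧸ (I ⊔ varIdeal N k ^ t)) : ℤ) = hilbPoly e₀ e₁ ((t : ℤ) - 1))
    (L : Fin (e₀ * (N - 1) + 1) → Fin N → k)
    (hL : ∀ c : Fin N ↪ Fin (e₀ * (N - 1) + 1), LinearIndependent k fun i => L (c i)) :
    ∃ (i j : Finset (Fin N →₀ ℕ)) (q : Fin (e₀ * (N - 1) + 1)),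
      ((i.card : ℤ) = hilbPoly e₀ e₁ ((e₀ : ℤ) - 1) ∧ ∀ a ∈ i, a.degree < e₀) ∧
      (j.card = e₀ ∧ ∀ b ∈ j, b.degree = e₀) ∧
      Submodule.span k (baseSet k e₀ i j) ⊔ I.restrictScalars k = ⊤ ∧
      Module.finrank k
        (PS N k ⧸ (I ⊔ (varIdeal N k ^ (e₀ + 1) ⊔ Ideal.span {linearForm (L q)}))) ≤ e₀ := by
  obtain ⟨-, x, hx, hx'⟩ := hI
  have hfr : ∀ t, Module.finrank k ((PS N k ⧸ I) ⧸ powSub k (Ideal.span (Set.range fun i =>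
      Ideal.Quotient.mk I (MvPowerSeries.X i : PS N k))) t) =
      Module.finrank k (PS N k ⧸ (I ⊔ varIdeal N k ^ t)) := fun t => by
    rw [powSub, ← map_varIdeal, ← Ideal.map_pow, finrank_quotient_map]
  obtain ⟨q, hq, hq'⟩ := exists_superficial (k := k)
    (fun i => Ideal.Quotient.mk I (MvPowerSeries.X i : PS N k))
    (by rw [← map_varIdeal]; exact map_varIdeal_le_jacobson I)
    (fun t => by
      have := finite_quotient t (I ⊔ varIdeal N k ^ t) le_sup_right
      rw [powSub, ← map_varIdeal, ← Ideal.map_pow]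
      exact finite_quotient_map) he
    (fun t ht => by
      rw [hfr, hfr]
      zify
      rw [hdim t ht, hdim (t + 1) (by omega), hilbPoly, hilbPoly]
      push_cast
      ring)
    ⟨_, by rw [← map_varIdeal]; exact Ideal.mem_map_of_mem _ hx, hx'⟩ L hL
  rw [hfr, hfr] at hq'
  rw [linForm_mk, ← map_varIdeal, ← Ideal.map_pow, ← Set.image_singleton, ← Ideal.map_span,
    ← Ideal.map_sup, finrank_quotient_map] at hq
  have hrs : ∀ t, (I ⊔ varIdeal N k ^ t).restrictScalars k =
      I.restrictScalars k ⊔ (varIdeal N k ^ t).restrictScalars k := fun t => by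
    ext z
    simp only [Submodule.restrictScalars_mem, Submodule.mem_sup]
  have hfr' : ∀ t, Module.finrank k (PS N k ⧸ (I ⊔ varIdeal N k ^ t).restrictScalars k) =
      Module.finrank k (PS N k ⧸ (I ⊔ varIdeal N k ^ t)) := fun t =>
    (Submodule.Quotient.restrictScalarsEquiv k _).finrank_eq
  have hfin : Module.Finite k (PS N k ⧸ (I ⊔ varIdeal N k ^ (e₀ + 1)).restrictScalars k) := by
    have := finite_quotient (e₀ + 1) (I ⊔ varIdeal N k ^ (e₀ + 1)) le_sup_right
    exact Module.Finite.equiv (Submodule.Quotient.restrictScalarsEquiv k _).symm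
  -- The equality `hq'`, that the Hilbert function grows by e₀ from e₀ to e₀ + 1, is what gives the
  -- two sets the prescribed numbers of elements.
  obtain ⟨i, j, hi, hj, hic, hjc, hij⟩ := exists_finsets_adapted (k := k)
    (fun m => (MvPowerSeries.monomial m 1 : PS N k))
    (P := (I ⊔ varIdeal N k ^ e₀).restrictScalars k)
    (P' := (I ⊔ varIdeal N k ^ (e₀ + 1)).restrictScalars k)
    (sup_le_sup_left (Ideal.pow_le_pow_right (Nat.le_succ _)) I)
    (S := {m | m.degree < e₀}) (T := {m | m.degree = e₀})
    (by rw [hrs, sup_left_comm, span_monomials_sup_eq_top, sup_top_eq])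
    (by rw [hrs, hrs, sup_left_comm, span_monomials_sup_varIdeal_pow])
  rw [hfr', hfr'] at hjc
  rw [hfr'] at hic
  have h1 := hdim (e₀ + 1) le_rfl
  refine ⟨i, j, q, ⟨?_, fun a ha => hi ha⟩, ⟨by omega, fun b hb => hj hb⟩, ?_, hq⟩
  · rw [hic]
    zify at hq'
    rw [hilbPoly] at h1 ⊢
    push_cast at h1
    linarith
  · rw [hrs, Set.image_eq_range, Set.image_eq_range] at hij
    rw [baseSet, Submodule.span_union, ← hij, sup_assoc]
    congr 1
    rw [sup_comm]
    congr 1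
    exact (Submodule.span_eq ((varIdeal N k ^ (e₀ + 1)).restrictScalars k))

end CurveCells

/-- The Hilbert function `t ↦ p(t - 1)` of the truncations. -/
def curveLength (e₀ : ℕ) (e₁ : ℤ) (t : ℕ) : ℤ := hilbPoly e₀ e₁ ((t : ℤ) - 1)

/-- The index of a cell: sets of monomials `i` and `j`, a linear form `L_q`, and power series `u`
that witness the colength of `L_q`. -/
structure CellIndex {k : Type u} [Field k] {N : ℕ} (e₀ : ℕ) (e₁ : ℤ) {s : ℕ}
    (L : Fin s → Fin N → k) : Type u where
  i : Finset (Fin N →₀ ℕ)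
  j : Finset (Fin N →₀ ℕ)
  q : Fin s
  u : Fin e₀ → PS N k
  card_i : (i.card : ℤ) = hilbPoly e₀ e₁ ((e₀ : ℤ) - 1)
  degree_i : ∀ a ∈ i, a.degree < e₀
  card_j : j.card = e₀
  degree_j : ∀ b ∈ j, b.degree = e₀

/-! ### Cells as open conditions on families. -/

namespace CellIndex

open RelScheme

variable {k : Type u} [Field k] {N e₀ : ℕ} {e₁ : ℤ} {s : ℕ} {L : Fin s → Fin N → k}
  (σ : CellIndex e₀ e₁ L)

/-- The sets of power series that have to span. -/
def conditions : Set (Set (PS N k)) :=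
  {baseSet k e₀ σ.i σ.j, colengthSet e₀ (linearForm (L σ.q)) σ.u}

/-- The open subset of the base of a family on which it lies in the cell. -/
def locus {S : Over (Spec (CommRingCat.of k))} {n : ℕ} (Z : RelScheme k N n S) : Set S.left :=
  {x | ∀ V ∈ σ.conditions, x ∈ Z.locus V}

theorem mem_locus_iff {S : Over (Spec (CommRingCat.of k))} {n : ℕ} {Z : RelScheme k N n S}
    {x : S.left} : x ∈ σ.locus Z ↔ x ∈ Z.locus (baseSet k e₀ σ.i σ.j) ∧
      x ∈ Z.locus (colengthSet e₀ (linearForm (L σ.q)) σ.u) := by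
  refine ⟨fun h => ⟨h _ (Or.inl rfl), h _ (Or.inr rfl)⟩, ?_⟩
  rintro ⟨h, h'⟩ V (rfl | rfl)
  · exact h
  · exact h'

theorem isOpen_locus {S : Over (Spec (CommRingCat.of k))} {n : ℕ} {Z : RelScheme k N n S}
    (hZ : Z.IsClosedSubscheme) : IsOpen (σ.locus Z) := by
  have : σ.locus Z = Z.locus (baseSet k e₀ σ.i σ.j) ∩
      Z.locus (colengthSet e₀ (linearForm (L σ.q)) σ.u) := Set.ext fun x => σ.mem_locus_iff
  rw [this]
  exact (RelScheme.isOpen_locus hZ _).inter (RelScheme.isOpen_locus hZ _)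

theorem mem_locus_iff_of_isPullbackAlong {S S' : Over (Spec (CommRingCat.of k))} {n : ℕ}
    {Z' : RelScheme k N n S'} {Z : RelScheme k N n S} {f : S' ⟶ S} (h : Z'.IsPullbackAlong Z f)
    (hZ : Z.IsClosedSubscheme) (x : S'.left) : f.left x ∈ σ.locus Z ↔ x ∈ σ.locus Z' :=
  forall₂_congr fun V _ => h.mem_locus_iff hZ V x

/-- Because of this the conditions are insensitive to truncation, so that each cell of Ξ_{n+1} is
the full preimage of the corresponding cell of Ξ_n. -/
theorem varIdeal_pow_subset {V : Set (PS N k)} (hV : V ∈ σ.conditions) {t : ℕ} (ht : e₀ + 1 ≤ t) :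
    ((varIdeal N k ^ t : Ideal (PS N k)) : Set (PS N k)) ⊆ V := by
  have h1 : varIdeal N k ^ t ≤ varIdeal N k ^ (e₀ + 1) := Ideal.pow_le_pow_right ht
  rcases hV with rfl | rfl
  · exact fun z hz => Or.inr (h1 hz)
  · exact fun z hz => Or.inr (Ideal.mem_sup_left (h1 hz))

theorem mem_locus_trunc_iff {S : Over (Spec (CommRingCat.of k))} {n : ℕ} {Z : RelScheme k N n S}
    (hZ : Z.IsClosedSubscheme) {t : ℕ} (h₀ : e₀ + 1 ≤ t) (ht : t ≤ n) (x : S.left) :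
    x ∈ σ.locus (Z.trunc t ht) ↔ x ∈ σ.locus Z := by
  refine forall₂_congr fun V hV => ?_
  rw [RelScheme.mem_locus_trunc_iff hZ,
    Set.union_eq_self_of_subset_right (σ.varIdeal_pow_subset hV h₀)]

theorem card_sum_prod {α β : Type*} {m : ℕ} [Fintype α] [Fintype β] {δ : α ⊕ β × Fin m → ℕ} {e t : ℕ}
    (h₀ : ∀ a, δ (Sum.inl a) < t) (h₁ : ∀ b, δ (Sum.inr b) = e + b.2) (he : e ≤ t)
    (hm : t ≤ e + m) :
    Fintype.card {x // δ x < t} = Fintype.card α + Fintype.card β * (t - e) := by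
  let f : α ⊕ β × Fin (t - e) → {x // δ x < t} := Sum.elim (fun a => ⟨Sum.inl a, h₀ a⟩)
    fun b => ⟨Sum.inr (b.1, ⟨b.2, by omega⟩), by
      rw [h₁]
      have := b.2.2
      simp only
      omega⟩
  have hf : Function.Bijective f := by
    constructor
    · rintro (a | b) (a' | b') h
      · simpa [f] using h
      · simp [f] at h
      · simp [f] at h
      · simpa [f, Prod.ext_iff, Fin.ext_iff] using h
    · rintro ⟨a | b, h⟩
      · exact ⟨Sum.inl a, rfl⟩
      · rw [h₁] at h
        exact ⟨Sum.inr (b.1, ⟨b.2, by omega⟩), rfl⟩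
  rw [← Fintype.card_of_bijective hf]
  simp

/-- The basis of the families in a cell. -/
def cell (m : ℕ) : Cell k N (e₀ + 1 + m) (curveLength e₀ e₁) (e₀ + 1) where
  d := Fintype.card (σ.i ⊕ σ.j × Fin (m + 1))
  v := cellFam (monom k σ.i) (monom k σ.j) (linearForm (L σ.q)) (m + 1) ∘
    (Fintype.equivFin (σ.i ⊕ σ.j × Fin (m + 1))).symm
  -- Only counts for t ≥ e₀ + 1 are required, and there all monomials of `i` are counted, so their
  -- actual degrees do not matter and 0 suffices.
  δ := Sum.elim (fun _ => 0) (fun b => e₀ + b.2) ∘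
    (Fintype.equivFin (σ.i ⊕ σ.j × Fin (m + 1))).symm
  mem x := by
    simp only [Function.comp_apply]
    generalize (Fintype.equivFin (σ.i ⊕ σ.j × Fin (m + 1))).symm x = y
    rcases y with a | b
    · simp
    · simp only [cellFam, Sum.elim_inr]
      rw [add_comm, pow_add]
      exact Ideal.mul_mem_mul (Ideal.pow_mem_pow (linearForm_mem _) _)
        (monom_mem (fun b hb => (σ.degree_j b hb).ge) _)
  card_eq := by
    have h1 := σ.card_i
    rw [curveLength, Fintype.card_sum, Fintype.card_prod, Fintype.card_coe, Fintype.card_coe,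
      Fintype.card_fin, σ.card_j]
    push_cast
    rw [h1, hilbPoly, hilbPoly]
    ring
  card_lt t h₀ ht := by
    have h1 := σ.card_i
    have h2 := Fintype.card_congr ((Fintype.equivFin (σ.i ⊕ σ.j × Fin (m + 1))).symm.subtypeEquiv
      (p := fun x => (Sum.elim (fun _ => 0) (fun b : σ.j × Fin (m + 1) => e₀ + (b.2 : ℕ)) ∘
        (Fintype.equivFin (σ.i ⊕ σ.j × Fin (m + 1))).symm) x < t)
      (q := fun x => Sum.elim (fun _ => 0) (fun b : σ.j × Fin (m + 1) => e₀ + (b.2 : ℕ)) x < t)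
      fun x => Iff.rfl)
    rw [h2, card_sum_prod (e := e₀) (fun _ => by simp only [Sum.elim_inl]; omega) (fun _ => rfl)
      (by omega) (by omega), Fintype.card_coe, Fintype.card_coe, σ.card_j, curveLength]
    push_cast [Nat.cast_sub (show e₀ ≤ t by omega)]
    rw [h1, hilbPoly, hilbPoly]
    ring

theorem range_cell_v (m : ℕ) : Set.range (σ.cell m).v =
    Set.range (cellFam (monom k σ.i) (monom k σ.j) (linearForm (L σ.q)) (m + 1)) := by
  simp only [cell, EquivLike.range_comp]

theorem span_cell_eq_top {K Q : Type u} [Field K] [CommRing Q] [Algebra K Q] [Module.Finite K Q]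
    {f : PS N k → Q} (φ : PS N k →+* Q) (hφ : ⇑φ = f) (hf : Submodule.span K (Set.range f) = ⊤)
    {m : ℕ}
    (hdim : ∀ t : ℕ, e₀ + 1 ≤ t → t ≤ e₀ + 1 + m → (Module.finrank K
      (Q ⧸ Submodule.span K (f '' (varIdeal N k ^ t : Ideal (PS N k)))) : ℤ) = curveLength e₀ e₁ t)
    (hnil : ∀ z ∈ varIdeal N k ^ (e₀ + 1 + m), f z = 0)
    (h : ∀ V ∈ σ.conditions, Submodule.span K (f '' V) = ⊤) :
    Submodule.span K (f '' Set.range (σ.cell m).v) = ⊤ := by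
  subst hφ
  rw [range_cell_v]
  exact span_cellFam_eq_top hf hdim hnil σ.card_i σ.card_j σ.degree_j (linearForm_mem _)
    (h _ (Or.inl rfl)) (h _ (Or.inr rfl))

theorem range_psHom_eq {n : ℕ} {Q : Type u} [CommRing Q] [Algebra k Q]
    (g : TruncRing k N n →ₐ[k] Q) : Set.range (psHom g) = Set.range g := by
  ext z
  constructor
  · rintro ⟨a, rfl⟩
    exact ⟨_, rfl⟩
  · rintro ⟨a, rfl⟩
    obtain ⟨a, rfl⟩ := Ideal.Quotient.mk_surjective a
    exact ⟨a, rfl⟩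

theorem psHom_eq_zero {n : ℕ} {Q : Type u} [CommRing Q] [Algebra k Q]
    (g : TruncRing k N n →ₐ[k] Q) {z : PS N k} (hz : z ∈ varIdeal N k ^ n) : psHom g z = 0 := by
  change g (Ideal.Quotient.mk _ z) = 0
  rw [Ideal.Quotient.eq_zero_iff_mem.2 hz, map_zero]

/-- On the open subset that belongs to a cell the cell is a basis. -/
theorem locus_subset {S : Over (Spec (CommRingCat.of k))} {m : ℕ}
    {Z : RelScheme k N (e₀ + 1 + m) S} (hZ : Z.IsAdmissible (curveLength e₀ e₁) (e₀ + 1)) :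
    σ.locus Z ⊆ Z.locus (Set.range (σ.cell m).v) := by
  intro x hx
  obtain ⟨K, _, Q, _, _, _, _, _, g, hs, _, -, hdim, hl⟩ := hZ.exists_fiber x
  rw [hl]
  exact σ.span_cell_eq_top (psHom g).toRingHom rfl ((congrArg _ (range_psHom_eq g)).trans hs) hdim
    (fun z hz => psHom_eq_zero g hz) fun V hV => (hl V).1 (hx V hV)

end CellIndex

/-- The open subset of the base of a family on which it lies in some cell. -/
def cellLocus {k : Type u} [Field k] {N : ℕ} (e₀ : ℕ) (e₁ : ℤ) {s : ℕ} (L : Fin s → Fin N → k)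
    {S : Over (Spec (CommRingCat.of k))} {n : ℕ} (Z : RelScheme k N n S) : Set S.left :=
  ⋃ σ : CellIndex e₀ e₁ L, σ.locus Z

section

variable {k : Type u} [Field k] {N e₀ : ℕ} {e₁ : ℤ} {s : ℕ} {L : Fin s → Fin N → k}
  {S S' : Over (Spec (CommRingCat.of k))} {n : ℕ}

theorem isOpen_cellLocus {Z : RelScheme k N n S} (hZ : Z.IsClosedSubscheme) :
    IsOpen (cellLocus e₀ e₁ L Z) :=
  isOpen_iUnion fun σ => σ.isOpen_locus hZ

theorem RelScheme.IsPullbackAlong.mem_cellLocus_iff {Z' : RelScheme k N n S'}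
    {Z : RelScheme k N n S} {f : S' ⟶ S} (h : Z'.IsPullbackAlong Z f)
    (hZ : Z.IsClosedSubscheme) (x : S'.left) :
    f.left x ∈ cellLocus e₀ e₁ L Z ↔ x ∈ cellLocus e₀ e₁ L Z' := by
  simp only [cellLocus, Set.mem_iUnion]
  exact exists_congr fun σ => σ.mem_locus_iff_of_isPullbackAlong h hZ x

theorem mem_cellLocus_trunc_iff {Z : RelScheme k N n S} (hZ : Z.IsClosedSubscheme) {t : ℕ}
    (h₀ : e₀ + 1 ≤ t) (ht : t ≤ n) (x : S.left) :
    x ∈ cellLocus e₀ e₁ L (Z.trunc t ht) ↔ x ∈ cellLocus e₀ e₁ L Z := by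
  simp only [cellLocus, Set.mem_iUnion]
  exact exists_congr fun σ => σ.mem_locus_trunc_iff hZ h₀ ht x

end

/-! ### Truncations of a family over an affine base, and their fibres. -/

section Truncation

open RelScheme

variable {k : Type u} [Field k] {N : ℕ} {A : Type u} [CommRing A] [Algebra k A]

/-- The homomorphism `R_n → A[[X]] / (J + (X) ^ n)`. -/
def truncationHom (k : Type u) [Field k] [Algebra k A] (J : Ideal (PS N A)) (n : ℕ) :
    TruncRing k N n →ₐ[k] PS N A ⧸ (J ⊔ varIdeal N A ^ n) :=
  Ideal.quotientMapₐ (J ⊔ varIdeal N A ^ n)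
    (MvPowerSeries.mapAlgHom (Algebra.ofId k A)) (varIdeal_pow_le_comap J n)

theorem truncation_eq (J : Ideal (PS N A)) (n : ℕ) :
    truncation k J n = ofAlg A (truncationHom k J n) := rfl

theorem truncationHom_mk (J : Ideal (PS N A)) (n : ℕ) (f : PS N k) :
    truncationHom k J n (Ideal.Quotient.mk _ f) =
      Ideal.Quotient.mk _ (MvPowerSeries.map (algebraMap k A) f) := rfl

theorem span_range_truncationHom (J : Ideal (PS N A)) (n : ℕ) :
    Submodule.span A (Set.range (truncationHom k J n)) = ⊤ := by
  rw [eq_top_iff, ← span_monomials_quotient n (J ⊔ varIdeal N A ^ n) le_sup_right]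
  refine Submodule.span_mono ?_
  rintro _ ⟨m, -, rfl⟩
  refine ⟨Ideal.Quotient.mk _ (MvPowerSeries.monomial m 1), ?_⟩
  rw [truncationHom_mk, MvPowerSeries.map_monomial, map_one]

theorem isClosedSubscheme_truncation (J : Ideal (PS N A)) (n : ℕ) :
    (truncation k J n).IsClosedSubscheme :=
  isClosedSubscheme_ofAlg (span_range_truncationHom J n)

theorem map_varIdeal_map {A' : Type u} [CommRing A'] (f : A →+* A') :
    (varIdeal N A).map (MvPowerSeries.map (σ := Fin N) f) = varIdeal N A' := by
  rw [varIdeal, varIdeal, Ideal.map_span, ← Set.range_comp]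
  congr 2
  funext i
  simp

/-- The truncations of `Z_n` are the `Z_t`. -/
theorem truncation_isPullbackAlong_trunc (J : Ideal (PS N A)) {t n : ℕ} (ht : t ≤ n) :
    (truncation k J t).IsPullbackAlong ((truncation k J n).trunc t ht) (𝟙 _) := by
  have hle : J ⊔ varIdeal N A ^ n ≤ J ⊔ varIdeal N A ^ t :=
    sup_le_sup_left (Ideal.pow_le_pow_right ht) J
  rw [truncation_eq, truncation_eq]
  refine isPullbackAlong_trunc_of_isPullback (IsPullbackAlong.refl _) ht
    (p := specOverMap ((Ideal.Quotient.factorₐ A hle).restrictScalars k)) ?_ ?_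
  · refine isPullback_specOverMap_of_isPushout (isPushout_of_ker_eq
      (Ideal.Quotient.factorₐ k (Ideal.pow_le_pow_right ht)).toRingHom
      (Ideal.Quotient.factor_surjective (Ideal.pow_le_pow_right ht))
      (truncationHom k J n).toRingHom
      ((Ideal.Quotient.factorₐ A hle).restrictScalars k).toRingHom
      (Ideal.Quotient.factor_surjective hle) ?_ (truncationHom k J t).toRingHom ?_)
    · have h1 : RingHom.ker (Ideal.Quotient.factorₐ k (Ideal.pow_le_pow_right ht)).toRingHom =
        powIdeal k N n t := ker_factorₐ ht
      rw [h1]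
      have h2 : (powIdeal k N n t).map (truncationHom k J n).toRingHom =
          (varIdeal N A ^ t).map (Ideal.Quotient.mk (J ⊔ varIdeal N A ^ n)) := by
        have h5 : varIdeal N A ^ t = (varIdeal N k ^ t).map (MvPowerSeries.map (algebraMap k A)) := by
          rw [Ideal.map_pow, map_varIdeal_map]
        rw [powIdeal, Ideal.map_map, h5, Ideal.map_map]
        rfl
      rw [h2]
      ext x
      obtain ⟨x, rfl⟩ := Ideal.Quotient.mk_surjective x
      have h3 : ((Ideal.Quotient.factorₐ A hle).restrictScalars k).toRingHom
        (Ideal.Quotient.mk _ x) = Ideal.Quotient.mk _ x := rfl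
      rw [RingHom.mem_ker, h3, Ideal.Quotient.eq_zero_iff_mem, Ideal.mem_quotient_iff_mem_sup]
      have h4 : varIdeal N A ^ t ⊔ (J ⊔ varIdeal N A ^ n) = J ⊔ varIdeal N A ^ t := by
        rw [sup_left_comm, sup_eq_left.2 (Ideal.pow_le_pow_right ht :
          varIdeal N A ^ n ≤ varIdeal N A ^ t)]
      rw [h4]
    · intro a
      obtain ⟨a, rfl⟩ := Ideal.Quotient.mk_surjective a
      rfl
  · rw [specOverMap_comp]
    rfl

theorem map_surjective {A' : Type u} [CommRing A'] {f : A →+* A'} (hf : Function.Surjective f) :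
    Function.Surjective (MvPowerSeries.map (σ := Fin N) f) := fun g =>
  ⟨fun m => (hf (MvPowerSeries.coeff m g)).choose, MvPowerSeries.ext fun m =>
    (hf (MvPowerSeries.coeff m g)).choose_spec⟩

/-- The fibre of a family at a `k`-point of the base. -/
theorem truncation_map_isPullbackAlong (J : Ideal (PS N A)) (n : ℕ) (s : A →ₐ[k] k) :
    (truncation k (J.map (MvPowerSeries.map (s : A →+* k))) n).IsPullbackAlong
      (truncation k J n) (specOverMap s) := by
  have hs : Function.Surjective s := fun x => ⟨algebraMap k A x, by simp⟩
  have hmap : (J ⊔ varIdeal N A ^ n).map (MvPowerSeries.map (s : A →+* k)) =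
      J.map (MvPowerSeries.map (s : A →+* k)) ⊔ varIdeal N k ^ n := by
    rw [Ideal.map_sup, Ideal.map_pow, map_varIdeal_map]
  let c : (PS N A ⧸ (J ⊔ varIdeal N A ^ n)) →ₐ[k]
      PS N k ⧸ (J.map (MvPowerSeries.map (s : A →+* k)) ⊔ varIdeal N k ^ n) :=
    Ideal.quotientMapₐ _ (MvPowerSeries.mapAlgHom s) (Ideal.map_le_iff_le_comap.1 hmap.le)
  have hc : ∀ x, c (Ideal.Quotient.mk _ x) =
      Ideal.Quotient.mk _ (MvPowerSeries.map (s : A →+* k) x) := fun x => rfl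
  rw [truncation_eq, truncation_eq]
  refine ⟨specOverMap c, ?_, ?_⟩
  · refine isPullback_specOverMap_of_isPushout (isPushout_of_ker_eq s.toRingHom hs
      (IsScalarTower.toAlgHom k A _).toRingHom c.toRingHom ?_ ?_
      (IsScalarTower.toAlgHom k k _).toRingHom ?_)
    · intro x
      obtain ⟨x, rfl⟩ := Ideal.Quotient.mk_surjective x
      obtain ⟨y, rfl⟩ := map_surjective (N := N) (f := (s : A →+* k)) hs x
      exact ⟨_, hc y⟩
    · refine le_antisymm (fun x hx => ?_) (Ideal.map_le_iff_le_comap.2 fun a ha => ?_)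
      · obtain ⟨x, rfl⟩ := Ideal.Quotient.mk_surjective x
        have hx' : c (Ideal.Quotient.mk _ x) = 0 := hx
        rw [hc, Ideal.Quotient.eq_zero_iff_mem, ← hmap] at hx'
        obtain ⟨y, hy, hyx⟩ := (Ideal.mem_map_iff_of_surjective _
          (map_surjective (N := N) (f := (s : A →+* k)) hs)).1 hx'
        have h1 : Ideal.Quotient.mk (J ⊔ varIdeal N A ^ n) x = Ideal.Quotient.mk _ (x - y) := by
          rw [map_sub, Ideal.Quotient.eq_zero_iff_mem.2 hy, sub_zero]
        rw [h1]
        have h2 : ∀ m, MvPowerSeries.coeff m (x - y) ∈ RingHom.ker s.toRingHom := fun m => by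
          have h3 := congr(MvPowerSeries.coeff m $hyx)
          rw [MvPowerSeries.coeff_map, MvPowerSeries.coeff_map] at h3
          rw [RingHom.mem_ker, map_sub, map_sub, sub_eq_zero]
          exact h3.symm
        -- Modulo (X)^n only finitely many coefficients remain, so a series with all coefficients in
        -- the kernel of `s` lies in the ideal generated by that kernel.
        have h3 : Ideal.Quotient.mk (J ⊔ varIdeal N A ^ n) (x - y) =
            Ideal.Quotient.mk _ (∑ m ∈ (Finsupp.finite_of_degree_lt n).toFinset,
              (x - y).coeff m • (MvPowerSeries.monomial m 1 : PS N A)) :=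
          Ideal.Quotient.eq.2 (Ideal.mem_sup_right (sub_sum_monomial_mem n (x - y)))
        rw [h3, map_sum]
        refine Ideal.sum_mem _ fun m _ => ?_
        rw [Algebra.smul_def, map_mul]
        exact Ideal.mul_mem_right _ _ (Ideal.mem_map_of_mem _ (h2 m))
      · have h1 : s a = 0 := ha
        have h2 : c.toRingHom ((IsScalarTower.toAlgHom k A _).toRingHom a) =
            Ideal.Quotient.mk _ (MvPowerSeries.map (s : A →+* k) (algebraMap A (PS N A) a)) := rfl
        rw [Ideal.mem_comap, RingHom.mem_ker, h2, MvPowerSeries.algebraMap_apply,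
          MvPowerSeries.map_C]
        simp [h1]
    · intro a
      have h2 : c.toRingHom ((IsScalarTower.toAlgHom k A _).toRingHom a) =
        Ideal.Quotient.mk _ (MvPowerSeries.map (s : A →+* k) (algebraMap A (PS N A) a)) := rfl
      rw [h2, MvPowerSeries.algebraMap_apply, MvPowerSeries.map_C]
      rfl
  · refine (specOverMap_comp _ _).trans ?_
    congr 1
    ext x
    obtain ⟨x, rfl⟩ := Ideal.Quotient.mk_surjective x
    rw [AlgHom.comp_apply, truncationHom_mk, truncationHom_mk, hc]
    congr 1
    ext m
    simp

end Truncation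

/-! ### The cells at closed points, and families of curve singularities. -/

section Points

open RelScheme

variable {k : Type u} [Field k] {N : ℕ}

/-- A lifted basis of the quotient, padded with zeros, is a witness. In this way a bound on colength
becomes a spanning condition, which is open in families. -/
theorem exists_span_sup_eq_top_iff {V : Type*} [AddCommGroup V] [Module k V] {P : Submodule k V}
    [Module.Finite k (V ⧸ P)] {e : ℕ} :
    (∃ u : Fin e → V, Submodule.span k (Set.range u) ⊔ P = ⊤) ↔
      Module.finrank k (V ⧸ P) ≤ e := by
  constructor
  · rintro ⟨u, hu⟩
    have h3 := congr(Submodule.map P.mkQ $hu)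
    rw [Submodule.map_sup, Submodule.mkQ_map_self, sup_bot_eq, Submodule.map_top,
      Submodule.range_mkQ, Submodule.map_span, ← Set.range_comp] at h3
    have h4 := finrank_range_le_card (R := k) (P.mkQ ∘ u)
    rwa [Set.finrank, h3, finrank_top, Fintype.card_fin] at h4
  · intro h
    let b := Module.finBasis k (V ⧸ P)
    choose v hv using fun i => P.mkQ_surjective (b i)
    refine ⟨fun i => if h : (i : ℕ) < Module.finrank k (V ⧸ P) then v ⟨i, h⟩ else 0, ?_⟩
    rw [sup_comm, ← Submodule.comap_map_mkQ, eq_top_iff]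
    refine le_trans ?_ (Submodule.comap_mono (f := P.mkQ) (b.span_eq.symm.le.trans
      (Submodule.span_le.2 ?_)))
    · rw [Submodule.comap_top]
    · rintro _ ⟨i, rfl⟩
      refine ⟨v i, Submodule.subset_span ⟨⟨i, i.2.trans_le h⟩, ?_⟩, hv i⟩
      simp

theorem span_image_mk_eq_top_iff (I : Ideal (PS N k)) (V : Set (PS N k)) :
    Submodule.span k (Ideal.Quotient.mk I '' V) = ⊤ ↔
      Submodule.span k V ⊔ I.restrictScalars k = ⊤ := by
  have h : Submodule.span k (Ideal.Quotient.mk I '' V) =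
      (Submodule.span k V).map (Ideal.Quotient.mkₐ k I).toLinearMap := by
    rw [Submodule.map_span]
    rfl
  have hker : LinearMap.ker (Ideal.Quotient.mkₐ k I).toLinearMap = I.restrictScalars k := by
    ext x
    exact Ideal.Quotient.eq_zero_iff_mem
  have hsurj : Function.Surjective (Ideal.Quotient.mkₐ k I).toLinearMap :=
    Ideal.Quotient.mk_surjective
  rw [h, ← hker, ← Submodule.comap_map_eq]
  constructor
  · intro h
    rw [h, Submodule.comap_top]
  · intro h
    rw [← Submodule.map_comap_eq_of_surjective hsurj (Submodule.map _ _), h, Submodule.map_top,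
      LinearMap.range_eq_top.2 hsurj]

theorem restrictScalars_sup (I J : Ideal (PS N k)) :
    (I ⊔ J).restrictScalars k = I.restrictScalars k ⊔ J.restrictScalars k := by
  ext z
  simp only [Submodule.restrictScalars_mem, Submodule.mem_sup]

theorem exists_span_colengthSet_iff (I : Ideal (PS N k)) (e : ℕ) (ℓ : PS N k) :
    (∃ u, Submodule.span k (colengthSet e ℓ u) ⊔ I.restrictScalars k = ⊤) ↔
      Module.finrank k (PS N k ⧸ (I ⊔ (varIdeal N k ^ (e + 1) ⊔ Ideal.span {ℓ}))) ≤ e := by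
  have h1 := finite_quotient (e + 1) (I ⊔ (varIdeal N k ^ (e + 1) ⊔ Ideal.span {ℓ}))
    (le_sup_left.trans le_sup_right)
  have h2 := Module.Finite.equiv (Submodule.Quotient.restrictScalarsEquiv k
    (I ⊔ (varIdeal N k ^ (e + 1) ⊔ Ideal.span {ℓ}))).symm
  rw [← (Submodule.Quotient.restrictScalarsEquiv k _).finrank_eq, ← exists_span_sup_eq_top_iff]
  refine exists_congr fun u => ?_
  rw [colengthSet, Submodule.span_union, sup_assoc, restrictScalars_sup,
    sup_comm (I.restrictScalars k)]
  have h3 := Submodule.span_eq ((varIdeal N k ^ (e + 1) ⊔ Ideal.span {ℓ}).restrictScalars k)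
  rw [Submodule.coe_restrictScalars] at h3
  rw [h3]

theorem mem_locus_truncation_iff (E : Ideal (PS N k)) (n : ℕ) (V : Set (PS N k))
    (y : (specOver k k).left) : y ∈ (truncation k E n).locus V ↔
      Submodule.span k V ⊔ (E ⊔ varIdeal N k ^ n).restrictScalars k = ⊤ := by
  have hfin := finite_of_span_range (span_range_truncationHom (k := k) E n)
  have h1 := RelScheme.mem_locus_iff (IsPullbackAlong.refl (ofAlg k (truncationHom k E n))) V y
  rw [← span_image_mk_eq_top_iff]
  refine (h1.trans (mem_spanLocus_iff_span (K := k) y)).trans (iff_of_eq ?_)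
  congr 2

theorem mem_cellLocus_truncation_iff {e₀ : ℕ} {e₁ : ℤ} {s : ℕ} {L : Fin s → Fin N → k}
    (E : Ideal (PS N k)) (n : ℕ) (y : (specOver k k).left) :
    y ∈ cellLocus e₀ e₁ L (truncation k E n) ↔ ∃ (i j : Finset (Fin N →₀ ℕ)) (q : Fin s),
      ((i.card : ℤ) = hilbPoly e₀ e₁ ((e₀ : ℤ) - 1) ∧ ∀ a ∈ i, a.degree < e₀) ∧
      (j.card = e₀ ∧ ∀ b ∈ j, b.degree = e₀) ∧
      Submodule.span k (baseSet k e₀ i j) ⊔ (E ⊔ varIdeal N k ^ n).restrictScalars k = ⊤ ∧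
      Module.finrank k (PS N k ⧸ (E ⊔ varIdeal N k ^ n ⊔
        (varIdeal N k ^ (e₀ + 1) ⊔ Ideal.span {linearForm (L q)}))) ≤ e₀ := by
  simp only [cellLocus, Set.mem_iUnion, CellIndex.mem_locus_iff, mem_locus_truncation_iff,
    ← exists_span_colengthSet_iff]
  constructor
  · rintro ⟨σ, h, h'⟩
    exact ⟨σ.i, σ.j, σ.q, ⟨σ.card_i, σ.degree_i⟩, ⟨σ.card_j, σ.degree_j⟩, h, σ.u, h'⟩
  · rintro ⟨i, j, q, hi, hj, h, u, h'⟩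
    exact ⟨⟨i, j, q, u, hi.1, hi.2, hj.1, hj.2⟩, h, h'⟩

theorem isFlatOfLength_truncation_iff (E : Ideal (PS N k)) (n : ℕ) (d : ℤ) :
    (truncation k E n).IsFlatOfLength d ↔
      (Module.finrank k (PS N k ⧸ (E ⊔ varIdeal N k ^ n)) : ℤ) = d := by
  have hfin := finite_of_span_range (span_range_truncationHom (k := k) E n)
  rw [truncation_eq, isFlatOfLength_ofAlg_iff]
  have hr : ∀ p : PrimeSpectrum k, Module.rankAtStalk (PS N k ⧸ (E ⊔ varIdeal N k ^ n)) p =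
      Module.finrank k (PS N k ⧸ (E ⊔ varIdeal N k ^ n)) := fun p =>
    congrFun (Module.rankAtStalk_eq_finrank_of_free (R := k)) p
  refine ⟨fun h => ?_, fun h => ⟨hfin, inferInstance, fun p => ?_⟩⟩
  · rw [← hr ⊥]
    exact h.2.2 ⊥
  · rw [hr, h]

theorem cellSpan_eq {e₀ m : ℕ} (i j : Finset (Fin N →₀ ℕ)) (ℓ : PS N k) :
    cellSpan e₀ (e₀ + 1 + m) i j ℓ =
      Submodule.span k (Set.range (cellFam (monom k i) (monom k j) ℓ (m + 1))) := by
  rw [cellSpan]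
  congr 1
  ext z
  constructor
  · rintro (⟨a, ha, rfl⟩ | ⟨b, hb, r, hr, rfl⟩)
    · exact ⟨Sum.inl ⟨a, ha⟩, rfl⟩
    · exact ⟨Sum.inr (⟨b, hb⟩, ⟨r, by omega⟩), rfl⟩
  · rintro ⟨a | b, rfl⟩
    · exact Or.inl ⟨a.1, a.2, rfl⟩
    · exact Or.inr ⟨b.1.1, b.1.2, b.2, by omega, rfl⟩

theorem cellSpan_le {e₀ m : ℕ} {i j : Finset (Fin N →₀ ℕ)} (hj : ∀ b ∈ j, b.degree = e₀)
    (c : Fin N → k) : cellSpan e₀ (e₀ + 1 + m) i j (linearForm c) ≤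
      Submodule.span k (baseSet k e₀ i j) := by
  rw [cellSpan_eq]
  refine Submodule.span_mono ?_
  rintro _ ⟨a | b, rfl⟩
  · exact Or.inl (Or.inl ⟨a, rfl⟩)
  · by_cases hb : (b.2 : ℕ) = 0
    · exact Or.inl (Or.inr ⟨b.1, by simp [cellFam, hb]⟩)
    · refine Or.inr ?_
      have h1 : linearForm c ^ (b.2 : ℕ) * monom k j b.1 ∈ varIdeal N k ^ ((b.2 : ℕ) + e₀) := by
        rw [pow_add]
        exact Ideal.mul_mem_mul (Ideal.pow_mem_pow (linearForm_mem c) _)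
          (monom_mem (fun b hb => (hj b hb).ge) b.1)
      exact Ideal.pow_le_pow_right (by omega) h1

theorem RelScheme.IsAdmissible.finrank_truncation {p : ℕ → ℤ} {t₀ n : ℕ} {E : Ideal (PS N k)}
    (h : (truncation k E n).IsAdmissible p t₀) {t : ℕ} (h₀ : t₀ ≤ t) (ht : t ≤ n) :
    (Module.finrank k (PS N k ⧸ (E ⊔ varIdeal N k ^ t)) : ℤ) = p t :=
  (isFlatOfLength_truncation_iff E t _).1
    ((truncation_isPullbackAlong_trunc E ht).isFlatOfLength (h.trunc t h₀ ht))

/-- The `k`-points of the open subset of the families that lie in some cell. -/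
theorem inCells_iff_mem_cellLocus {e₀ m : ℕ} {e₁ : ℤ} {s : ℕ} {L : Fin s → Fin N → k}
    {E : Ideal (PS N k)} (hE : varIdeal N k ^ (e₀ + 1 + m) ≤ E)
    (hadm : (truncation k E (e₀ + 1 + m)).IsAdmissible (curveLength e₀ e₁) (e₀ + 1))
    (y : (specOver k k).left) : InCells e₀ e₁ L (e₀ + 1 + m) E ↔
      y ∈ cellLocus e₀ e₁ L (truncation k E (e₀ + 1 + m)) := by
  rw [mem_cellLocus_truncation_iff, sup_eq_left.2 hE, InCells]
  refine exists_congr fun i => exists_congr fun j => exists_congr fun q => ?_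
  rw [sup_assoc]
  refine and_congr_right fun hi => and_congr_right fun hj => and_congr_left fun hc => ?_
  have hfinE := finite_quotient _ E hE
  have hsurj : Function.Surjective (fun x : cellSpan e₀ (e₀ + 1 + m) i j (linearForm (L q)) =>
      Ideal.Quotient.mk E (x : PS N k)) ↔
      Submodule.span k (Ideal.Quotient.mk E '' Set.range
        (cellFam (monom k i) (monom k j) (linearForm (L q)) (m + 1))) = ⊤ := by
    have h1 : Submodule.span k (Ideal.Quotient.mk E '' Set.range
        (cellFam (monom k i) (monom k j) (linearForm (L q)) (m + 1))) =
        (cellSpan e₀ (e₀ + 1 + m) i j (linearForm (L q))).map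
          (Ideal.Quotient.mkₐ k E).toLinearMap := by
      rw [cellSpan_eq, Submodule.map_span]
      rfl
    rw [h1, eq_top_iff]
    constructor
    · intro h z _
      obtain ⟨x, rfl⟩ := h z
      exact ⟨x, x.2, rfl⟩
    · intro h z
      obtain ⟨x, hx, rfl⟩ := h (Submodule.mem_top (x := z))
      exact ⟨⟨x, hx⟩, rfl⟩
  constructor
  · intro h
    have h1 := hsurj.1 h.2
    rw [span_image_mk_eq_top_iff, ← cellSpan_eq] at h1
    rw [eq_top_iff, ← h1]
    exact sup_le_sup_right (cellSpan_le hj.2 (L q)) _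
  · intro h
    obtain ⟨u, hu⟩ := (exists_span_colengthSet_iff E e₀ (linearForm (L q))).2 hc
    let σ : CellIndex e₀ e₁ L := ⟨i, j, q, u, hi.1, hi.2, hj.1, hj.2⟩
    have htop : Submodule.span k (Set.range (Ideal.Quotient.mk E)) = ⊤ := by
      rw [Ideal.Quotient.mk_surjective.range_eq, Submodule.span_univ]
    have h1 : Submodule.span k (Ideal.Quotient.mk E '' Set.range
        (cellFam (monom k i) (monom k j) (linearForm (L q)) (m + 1))) = ⊤ := by
      have h2 := σ.span_cell_eq_top (K := k) (m := m) (Ideal.Quotient.mk E) rfl htop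
        (fun t h₀ ht => by
          rw [← hadm.finrank_truncation h₀ ht, ← finrank_quotient_map,
            ← restrictScalars_map_eq_span _ htop])
        (fun z hz => Ideal.Quotient.eq_zero_iff_mem.2 (hE hz))
        (by
          rintro V (rfl | rfl)
          · exact (span_image_mk_eq_top_iff E _).2 h
          · exact (span_image_mk_eq_top_iff E _).2 hu)
      rwa [σ.range_cell_v] at h2
    have hs := hsurj.2 h1
    refine ⟨?_, hs⟩
    -- The cell has as many generators as the dimension of the target, so surjectivity already
    -- implies bijectivity.
    let f : cellSpan e₀ (e₀ + 1 + m) i j (linearForm (L q)) →ₗ[k] PS N k ⧸ E :=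
      (Ideal.Quotient.mkₐ k E).toLinearMap.comp (Submodule.subtype _)
    have hfin : Module.Finite k (cellSpan e₀ (e₀ + 1 + m) i j (linearForm (L q))) := by
      rw [cellSpan_eq]
      exact Module.Finite.span_of_finite k (Set.finite_range _)
    have hle : Module.finrank k (cellSpan e₀ (e₀ + 1 + m) i j (linearForm (L q))) ≤
        Module.finrank k (PS N k ⧸ E) := by
      have h2 := hadm.finrank_truncation (t := e₀ + 1 + m) (by omega) le_rfl
      rw [sup_eq_left.2 hE] at h2
      have h3 := finrank_range_le_card (R := k)
        (cellFam (monom k i) (monom k j) (linearForm (L q)) (m + 1))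
      rw [Set.finrank, ← cellSpan_eq (e₀ := e₀)] at h3
      refine h3.trans (le_of_eq ?_)
      zify
      rw [h2, ← (σ.cell m).card_eq]
      rfl
    have hf : Function.Surjective f := hs
    have h4 : Module.finrank k (cellSpan e₀ (e₀ + 1 + m) i j (linearForm (L q))) =
        Module.finrank k (PS N k ⧸ E) :=
      le_antisymm hle (LinearMap.finrank_le_finrank_of_surjective hf)
    exact (LinearMap.injective_iff_surjective_of_finrank_eq_finrank h4).2 hf

variable {A : Type u} [CommRing A] [Algebra k A] {e₀ : ℕ} {e₁ : ℤ} {J : Ideal (PS N A)}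

theorem IsFamily.isAdmissible (h : IsFamily k e₀ e₁ J) (m : ℕ) :
    (truncation k J (e₀ + 1 + m)).IsAdmissible (curveLength e₀ e₁) (e₀ + 1) :=
  ⟨isClosedSubscheme_truncation J _, h.flat_trunc _ (by omega), fun t h₀ ht =>
    (truncation_isPullbackAlong_trunc J ht).symm.isFlatOfLength (h.flat_trunc t h₀)⟩

/-- A family of curve singularities lies in the cells. -/
theorem IsFamily.mem_cellLocus [IsAlgClosed k] [Algebra.FiniteType k A] (h : IsFamily k e₀ e₁ J)
    (he : e₀ ≠ 0) (L : Fin (e₀ * (N - 1) + 1) → Fin N → k)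
    (hL : ∀ c : Fin N ↪ Fin (e₀ * (N - 1) + 1), LinearIndependent k fun i => L (c i)) (m : ℕ)
    (x : (specOver k A).left) : x ∈ cellLocus e₀ e₁ L (truncation k J (e₀ + 1 + m)) := by
  have hopen := isOpen_cellLocus (e₀ := e₀) (e₁ := e₁) (L := L)
    (isClosedSubscheme_truncation (k := k) J (e₀ + 1 + m))
  by_contra hx
  -- A nonempty closed complement would contain a closed point, whose residue field is k by the
  -- Nullstellensatz; there the fibre is a curve singularity.
  obtain ⟨I, hI⟩ := (PrimeSpectrum.isClosed_iff_zeroLocus_ideal _).1 hopen.isClosed_compl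
  have hx' : x ∈ PrimeSpectrum.zeroLocus (I : Set A) := hI ▸ hx
  have hItop : I ≠ ⊤ := by
    rintro rfl
    exact (PrimeSpectrum.isPrime x).ne_top (top_le_iff.1 hx')
  obtain ⟨P, hP, hIP⟩ := Ideal.exists_le_maximal I hItop
  obtain ⟨s, hs⟩ : ∃ s : A →ₐ[k] k, RingHom.ker s = P := by
    let _ := Ideal.Quotient.field P
    have := finite_of_finite_type_of_isJacobsonRing k (A ⧸ P)
    have hb := IsAlgClosed.algebraMap_bijective_of_isIntegral (k := k) (K := A ⧸ P)
    let e := AlgEquiv.ofBijective (Algebra.ofId k (A ⧸ P)) hb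
    refine ⟨e.symm.toAlgHom.comp (Ideal.Quotient.mkₐ k P), ?_⟩
    ext a
    rw [RingHom.mem_ker]
    refine (EmbeddingLike.map_eq_zero_iff (f := e.symm)).trans ?_
    exact Ideal.Quotient.eq_zero_iff_mem
  let y : (specOver k k).left := (⊥ : PrimeSpectrum k)
  have hy : (specOverMap s).left y ∉ cellLocus e₀ e₁ L (truncation k J (e₀ + 1 + m)) := by
    intro h1
    have h2 : (specOverMap s).left y ∈ PrimeSpectrum.zeroLocus (I : Set A) := by
      intro a ha
      have h3 : s a = 0 := (RingHom.mem_ker).1 (hs ▸ hIP ha)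
      change s a ∈ (⊥ : Ideal k)
      exact h3
    rw [← hI] at h2
    exact h2 h1
  apply hy
  have hpb := fun n => truncation_map_isPullbackAlong J n s
  rw [(hpb _).mem_cellLocus_iff (isClosedSubscheme_truncation J _), mem_cellLocus_truncation_iff]
  -- Flatness of the truncations yields the Hilbert function of the fibre from e₀ + 1 on, whereas
  -- the Hilbert polynomial alone gives it only for large arguments.
  obtain ⟨i, j, q, hi, hj, h1, h2⟩ := (h.fiber s).1.exists_cell (e₁ := e₁) he
    (fun t ht => (isFlatOfLength_truncation_iff _ t _).1
      ((hpb t).isFlatOfLength (h.flat_trunc t ht))) L hL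
  refine ⟨i, j, q, hi, hj, ?_, ?_⟩
  · rw [restrictScalars_sup, ← sup_assoc, h1, top_sup_eq]
  · have h3 : J.map (MvPowerSeries.map (s : A →+* k)) ⊔ varIdeal N k ^ (e₀ + 1 + m) ⊔
        (varIdeal N k ^ (e₀ + 1) ⊔ Ideal.span {linearForm (L q)}) =
        J.map (MvPowerSeries.map (s : A →+* k)) ⊔
          (varIdeal N k ^ (e₀ + 1) ⊔ Ideal.span {linearForm (L q)}) := by
      rw [sup_assoc, ← sup_assoc (varIdeal N k ^ (e₀ + 1 + m)), sup_eq_right.2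
        (Ideal.pow_le_pow_right (by omega) : varIdeal N k ^ (e₀ + 1 + m) ≤ varIdeal N k ^ (e₀ + 1))]
    rw [h3]
    exact h2

end Points

open RelScheme

/-! ### Hilbert scheme, truncation stratum and the open subscheme of cells. -/

section Moduli

variable {k : Type u} [Field k] {N : ℕ}

/-- With threshold n the only truncation condition is the one for t = n, where the truncation is the
family itself. -/
theorem isHilbertScheme_of_represents {n : ℕ} {p : ℕ → ℤ} {X : Over (Spec (CommRingCat.of k))}
    {T : RelScheme k N n X} (hT : T.Represents fun _ Z => Z.IsAdmissible p n) :
    IsHilbertScheme (p n) T := by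
  refine ⟨hT.prop.closed, hT.prop.flat, fun S Z hZ hZ' => hT.existsUnique S Z ⟨hZ, hZ', ?_⟩⟩
  intro t h₀ ht
  obtain rfl := le_antisymm h₀ ht
  exact (trunc_self Z).isFlatOfLength hZ'

/-- The stratum represents a subfunctor of the Hilbert functor: a family has at most one classifying
morphism to Y, which makes `w` a monomorphism, and it has one exactly when its truncations are flat
of the right lengths. -/
theorem isTruncationStratum_of_represents {e₀ : ℕ} {e₁ : ℤ} {n : ℕ}
    {X Y : Over (Spec (CommRingCat.of k))} {T : RelScheme k N n X} {V : RelScheme k N n Y}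
    (hT : IsHilbertScheme (curveLength e₀ e₁ n) T)
    (hV : V.Represents fun _ Z => Z.IsAdmissible (curveLength e₀ e₁) (e₀ + 1)) {w : Y ⟶ X}
    (hw : V.IsPullbackAlong T w) : IsTruncationStratum e₀ e₁ T w := by
  refine ⟨⟨fun g g' h => ?_⟩, fun S Z f hf => ⟨?_, fun h => ?_⟩⟩
  · have h1 := V.isPullbackAlong_pb g
    refine hV.hom_ext (h1.isAdmissible hV.prop) h1 (IsPullbackAlong.of_comp (f := w) ?_ hw)
    rw [← h]
    exact h1.comp hw
  · rintro ⟨g, rfl⟩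
    exact ((IsPullbackAlong.of_comp hf hw).isAdmissible hV.prop).trunc
  · obtain ⟨g, hg, -⟩ := hV.existsUnique S Z
      ⟨hf.isClosedSubscheme hT.1, hf.isFlatOfLength hT.2.1, h⟩
    exact ⟨g, (hT.2.2 S Z (hf.isClosedSubscheme hT.1) (hf.isFlatOfLength hT.2.1)).unique
      (hg.comp hw) hf⟩

theorem isCellSubscheme_restrι {e₀ m : ℕ} {e₁ : ℤ} {s : ℕ} {L : Fin s → Fin N → k}
    {X Y : Over (Spec (CommRingCat.of k))} {T : RelScheme k N (e₀ + 1 + m) X}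
    {V : RelScheme k N (e₀ + 1 + m) Y} (hV : V.IsAdmissible (curveLength e₀ e₁) (e₀ + 1)) {w : Y ⟶ X}
    (hw : V.IsPullbackAlong T w) {O : Y.left.Opens} (hO : ∀ x, x ∈ O ↔ x ∈ cellLocus e₀ e₁ L V) :
    IsCellSubscheme e₀ e₁ L T w (restrι Y O) := by
  refine ⟨inferInstance, fun E hE x hx => ?_⟩
  have h1 : (truncation k E (e₀ + 1 + m)).IsPullbackAlong V x := IsPullbackAlong.of_comp hx hw
  have h2 := fun y => inCells_iff_mem_cellLocus (L := L) hE (h1.isAdmissible hV) y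
  constructor
  · rintro ⟨y, rfl⟩
    let pt : (specOver k k).left := (⊥ : PrimeSpectrum k)
    rw [h2 pt, ← h1.mem_cellLocus_iff hV.closed, ← hO]
    exact restr_hom_apply_mem O (y.left pt)
  · intro h
    exact exists_lift_restr x O fun y => (hO _).2 ((h1.mem_cellLocus_iff hV.closed y).2 ((h2 y).1 h))

/-- The families that are represented by `Ξ_n`. -/
def IsCellFamily (e₀ : ℕ) (e₁ : ℤ) {s : ℕ} (L : Fin s → Fin N → k) {n : ℕ}
    {S : Over (Spec (CommRingCat.of k))} (Z : RelScheme k N n S) : Prop :=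
  Z.IsAdmissible (curveLength e₀ e₁) (e₀ + 1) ∧ ∀ x : S.left, x ∈ cellLocus e₀ e₁ L Z

theorem exists_moduli (e₀ m : ℕ) (e₁ : ℤ) {s : ℕ} (L : Fin s → Fin N → k) :
    ∃ (Hilb W Ξ : Over (Spec (CommRingCat.of k))) (T : RelScheme k N (e₀ + 1 + m) Hilb)
      (w : W ⟶ Hilb) (j : Ξ ⟶ W) (U : RelScheme k N (e₀ + 1 + m) Ξ),
      IsHilbertScheme (curveLength e₀ e₁ (e₀ + 1 + m)) T ∧ IsTruncationStratum e₀ e₁ T w ∧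
      IsCellSubscheme e₀ e₁ L T w j ∧ U.IsPullbackAlong T (j ≫ w) ∧
      U.Represents fun _ Z => IsCellFamily e₀ e₁ L Z := by
  obtain ⟨X, T, hT⟩ := exists_represents_isAdmissible k N (e₀ + 1 + m) (curveLength e₀ e₁)
    (e₀ + 1 + m)
  obtain ⟨Y, V, hV⟩ := exists_represents_isAdmissible k N (e₀ + 1 + m) (curveLength e₀ e₁) (e₀ + 1)
  have hT' := isHilbertScheme_of_represents hT
  obtain ⟨w, hw, -⟩ := hT'.2.2 Y V hV.prop.closed hV.prop.flat
  let O : Y.left.Opens := ⟨cellLocus e₀ e₁ L V, isOpen_cellLocus hV.prop.closed⟩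
  exact ⟨X, Y, _, T, w, restrι Y O, V.pb (restrι Y O), hT',
    isTruncationStratum_of_represents hT' hV hw,
    isCellSubscheme_restrι hV.prop hw fun x => Iff.rfl,
    (V.isPullbackAlong_pb _).comp hw,
    hV.restrict hV.prop.closed (fun h hZ => h.isAdmissible hZ) (fun Z => cellLocus e₀ e₁ L Z)
      (fun h hZ x => h.mem_cellLocus_iff hZ x) O fun x => Iff.rfl⟩

theorem RelScheme.IsClosedSubscheme.trunc {n : ℕ} {S : Over (Spec (CommRingCat.of k))}
    {Z : RelScheme k N n S} (hZ : Z.IsClosedSubscheme) {t : ℕ} (ht : t ≤ n) :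
    (Z.trunc t ht).IsClosedSubscheme := by
  refine isClosedSubscheme_of_local fun x => ?_
  obtain ⟨B, _, _, j, hj, hx, _⟩ := exists_affine_nhd S x ⊤ trivial
  obtain ⟨Q, _, _, _, _, g, h1, h2⟩ := hZ.exists_ofAlg_along j
  exact ⟨_, j, hj, hx, (((Z.trunc t ht).isPullbackAlong_pb j).unique
    (ofAlg_trunc h2 ht)).isClosedSubscheme (isClosedSubscheme_ofAlg (span_range_truncHom h1 ht))⟩

theorem RelScheme.IsAdmissible.truncate {p : ℕ → ℤ} {t₀ n : ℕ}
    {S : Over (Spec (CommRingCat.of k))} {Z : RelScheme k N n S} (hZ : Z.IsAdmissible p t₀) {t : ℕ}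
    (h₀ : t₀ ≤ t) (ht : t ≤ n) : (Z.trunc t ht).IsAdmissible p t₀ :=
  ⟨hZ.closed.trunc ht, hZ.trunc t h₀ ht, fun r hr hrt =>
    (Z.trunc_trunc hrt ht).isFlatOfLength (hZ.trunc r hr (hrt.trans ht))⟩

theorem IsCellFamily.trunc {e₀ : ℕ} {e₁ : ℤ} {s : ℕ} {L : Fin s → Fin N → k} {n : ℕ}
    {S : Over (Spec (CommRingCat.of k))} {Z : RelScheme k N n S} (hZ : IsCellFamily e₀ e₁ L Z)
    {t : ℕ} (h₀ : e₀ + 1 ≤ t) (ht : t ≤ n) : IsCellFamily e₀ e₁ L (Z.trunc t ht) :=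
  ⟨hZ.1.truncate h₀ ht, fun x => (mem_cellLocus_trunc_iff hZ.1.closed h₀ ht x).2 (hZ.2 x)⟩

theorem IsCellFamily.of_isPullbackAlong {e₀ : ℕ} {e₁ : ℤ} {s : ℕ} {L : Fin s → Fin N → k} {n : ℕ}
    {S S' : Over (Spec (CommRingCat.of k))} {Z : RelScheme k N n S} {Z' : RelScheme k N n S'}
    {f : S' ⟶ S} (h : Z'.IsPullbackAlong Z f) (hZ : IsCellFamily e₀ e₁ L Z) :
    IsCellFamily e₀ e₁ L Z' :=
  ⟨h.isAdmissible hZ.1, fun x => (h.mem_cellLocus_iff hZ.1.closed x).1 (hZ.2 _)⟩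

end Moduli

/-! ### Affineness of the truncation morphisms. -/

section AffineTransition

variable {k : Type u} [Field k] {N e₀ m : ℕ} {e₁ : ℤ} {s : ℕ} {L : Fin s → Fin N → k}

/-- The families that are represented by an open subscheme of the cell. -/
def CellIndex.IsInCell (σ : CellIndex e₀ e₁ L) {n : ℕ} {S : Over (Spec (CommRingCat.of k))}
    (Z : RelScheme k N n S) : Prop :=
  Z.IsAdmissible (curveLength e₀ e₁) (e₀ + 1) ∧ ∀ x : S.left, x ∈ σ.locus Z

theorem CellIndex.isInCell_trunc {σ : CellIndex e₀ e₁ L} {n : ℕ}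
    {S : Over (Spec (CommRingCat.of k))} {Z : RelScheme k N n S} (hZ : σ.IsInCell Z)
    {t : ℕ} (h₀ : e₀ + 1 ≤ t) (ht : t ≤ n) : σ.IsInCell (Z.trunc t ht) :=
  ⟨hZ.1.truncate h₀ ht, fun x => (σ.mem_locus_trunc_iff hZ.1.closed h₀ ht x).2 (hZ.2 x)⟩

/-- An open subscheme `F` of the base of a universal family that represents the families in
a cell. -/
structure CellChart (σ : CellIndex e₀ e₁ L) {n : ℕ} {X F : Over (Spec (CommRingCat.of k))}
    (U : RelScheme k N n X) (V : RelScheme k N n F) (i : F ⟶ X) : Prop where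
  isOpenImmersion : IsOpenImmersion i.left
  range : Set.range i.left = σ.locus U
  isPullbackAlong : V.IsPullbackAlong U i

theorem exists_cellChart (σ : CellIndex e₀ e₁ L) {n : ℕ} {X : Over (Spec (CommRingCat.of k))}
    {P : ∀ S : Over (Spec (CommRingCat.of k)), RelScheme k N n S → Prop}
    {U : RelScheme k N n X} (hU : U.Represents P)
    (hP : ∀ {S S' : Over (Spec (CommRingCat.of k))} {Z : RelScheme k N n S}
      {Z' : RelScheme k N n S'} {f : S' ⟶ S}, Z'.IsPullbackAlong Z f → P S Z → P S' Z')
    (hadm : ∀ S Z, P S Z → Z.IsAdmissible (curveLength e₀ e₁) (e₀ + 1))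
    (hcell : ∀ S Z, σ.IsInCell Z → P S Z) :
    ∃ (F : Over (Spec (CommRingCat.of k))) (V : RelScheme k N n F) (i : F ⟶ X),
      CellChart σ U V i ∧ V.Represents fun _ Z => σ.IsInCell Z := by
  have hcl := (hadm _ _ hU.prop).closed
  let O : X.left.Opens := ⟨σ.locus U, σ.isOpen_locus hcl⟩
  refine ⟨restr X O, U.pb (restrι X O), restrι X O, ⟨inferInstance, range_restrι X O,
    U.isPullbackAlong_pb _⟩, (hU.restrict hcl hP (fun Z => σ.locus Z)
      (fun h hZ x => σ.mem_locus_iff_of_isPullbackAlong h hZ x) O fun x => Iff.rfl).of_iff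
      fun S Z => ⟨fun h => ⟨hadm S Z h.1, h.2⟩, fun h => ⟨hcell S Z h, h.2⟩⟩⟩

theorem CellChart.comp_iso {σ : CellIndex e₀ e₁ L} {n : ℕ}
    {X F F' : Over (Spec (CommRingCat.of k))} {U : RelScheme k N n X} {V : RelScheme k N n F}
    {V' : RelScheme k N n F'} {i : F ⟶ X} (h : CellChart σ U V i) {e : F' ≅ F}
    (he : V'.IsPullbackAlong V e.hom) : CellChart σ U V' (e.hom ≫ i) := by
  have hiso : IsIso e.hom.left := ((Over.forget _).mapIso e).isIso_hom
  have := h.isOpenImmersion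
  refine ⟨?_, ?_, he.comp h.isPullbackAlong⟩
  · rw [Over.comp_left]
    infer_instance
  · rw [← h.range]
    ext x
    constructor
    · rintro ⟨y, rfl⟩
      exact ⟨e.hom.left y, by rw [Over.comp_left, Scheme.Hom.comp_apply]⟩
    · rintro ⟨y, rfl⟩
      obtain ⟨z, rfl⟩ := e.hom.left.surjective y
      exact ⟨z, by rw [Over.comp_left, Scheme.Hom.comp_apply]⟩

/-- The charts of a cell are compatible with truncation. -/
theorem CellChart.isPullback {σ : CellIndex e₀ e₁ L} {n t : ℕ} (h₀ : e₀ + 1 ≤ t) (ht : t ≤ n)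
    {X X' F F' : Over (Spec (CommRingCat.of k))} {U : RelScheme k N t X}
    {U' : RelScheme k N n X'} {V : RelScheme k N t F} {V' : RelScheme k N n F'} {i : F ⟶ X}
    {i' : F' ⟶ X'} (h : CellChart σ U V i) (h' : CellChart σ U' V' i')
    (hU : U.IsClosedSubscheme) (hU' : U'.IsClosedSubscheme) {a : X' ⟶ X}
    (ha : (U'.trunc t ht).IsPullbackAlong U a) {c : F' ⟶ F}
    (hc : (V'.trunc t ht).IsPullbackAlong V c)
    (hext : ∀ f g : F' ⟶ X, (V'.trunc t ht).IsPullbackAlong U f →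
      (V'.trunc t ht).IsPullbackAlong U g → f = g) :
    IsPullback i'.left c.left a.left i.left := by
  have := h.isOpenImmersion
  have := h'.isOpenImmersion
  have hw : c ≫ i = i' ≫ a := hext _ _ (hc.comp h.isPullbackAlong)
    ((h'.isPullbackAlong.trunc t ht).comp ha)
  refine (IsOpenImmersion.isPullback c.left i'.left i.left a.left congr($(hw.symm).left) ?_).flip
  ext x
  have h1 : x ∈ Set.range i'.left ↔ a.left x ∈ Set.range i.left := by
    rw [h.range, h'.range, σ.mem_locus_iff_of_isPullbackAlong ha hU,
      σ.mem_locus_trunc_iff hU' h₀ ht]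
  exact h1.symm

theorem isAffineHom_specOver {A B : Type u} [CommRing A] [Algebra k A] [CommRing B] [Algebra k B]
    (f : specOver k B ⟶ specOver k A) : IsAffineHom f.left := by
  obtain ⟨g, rfl⟩ := specOverMap_surjective f
  exact inferInstanceAs (IsAffineHom (Spec.map (CommRingCat.ofHom g.toRingHom)))

/-- The additional products contain the power m + 1 of the linear form and a monomial of degree e₀,
so they vanish on truncation. Hence the truncation of a family with the longer basis is spanned by
the shorter one. -/
theorem CellIndex.range_cell_succ (σ : CellIndex e₀ e₁ L) (m : ℕ) :
    Set.range (σ.cell (m + 1)).v ⊆ Set.range (σ.cell m).v ∪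
      (varIdeal N k ^ (e₀ + 1 + m) : Ideal (PS N k)) := by
  rw [range_cell_v, range_cell_v]
  rintro _ ⟨a | b, rfl⟩
  · exact Or.inl ⟨Sum.inl a, rfl⟩
  · by_cases hb : (b.2 : ℕ) < m + 1
    · exact Or.inl ⟨Sum.inr (b.1, ⟨b.2, hb⟩), rfl⟩
    · refine Or.inr ?_
      have h1 : linearForm (L σ.q) ^ (b.2 : ℕ) * monom k σ.j b.1 ∈
          varIdeal N k ^ ((b.2 : ℕ) + e₀) := by
        rw [pow_add]
        exact Ideal.mul_mem_mul (Ideal.pow_mem_pow (linearForm_mem _) _)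
          (monom_mem (fun b hb => (σ.degree_j b hb).ge) b.1)
      exact Ideal.pow_le_pow_right (by omega) h1

/-- The truncation morphisms are affine. -/
theorem isAffineHom_of_isPullbackAlong_trunc {X X' : Over (Spec (CommRingCat.of k))}
    {U : RelScheme k N (e₀ + 1 + m) X} {U' : RelScheme k N (e₀ + 1 + (m + 1)) X'}
    (hU : U.Represents fun _ Z => IsCellFamily e₀ e₁ L Z)
    (hU' : U'.Represents fun _ Z => IsCellFamily e₀ e₁ L Z) {a : X' ⟶ X}
    (ha : (U'.trunc (e₀ + 1 + m) (Nat.le_succ _)).IsPullbackAlong U a) : IsAffineHom a.left := by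
  have key : ∀ σ : CellIndex e₀ e₁ L, ∃ (F F' : Over (Spec (CommRingCat.of k))) (i : F ⟶ X)
      (i' : F' ⟶ X') (c : F' ⟶ F), IsOpenImmersion i.left ∧ Set.range i.left = σ.locus U ∧
        IsPullback i'.left c.left a.left i.left ∧ IsAffineHom c.left := by
    intro σ
    -- The affine scheme D represents all families with this basis, so the chart F of X is also an
    -- open subscheme of D, and likewise F' of D'. Thus F' → F is a base change both of `a` and of
    -- the morphism of affine schemes D' → D.
    obtain ⟨D, hD⟩ := (σ.cell m).exists_represents
    obtain ⟨D', hD'⟩ := (σ.cell (m + 1)).exists_represents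
    obtain ⟨F, V, i, hi, hV⟩ := exists_cellChart σ hU IsCellFamily.of_isPullbackAlong
      (fun _ _ h => h.1) fun _ _ h => ⟨h.1, fun x => Set.mem_iUnion.2 ⟨σ, h.2 x⟩⟩
    obtain ⟨F', V', i', hi', hV'⟩ := exists_cellChart σ hU' IsCellFamily.of_isPullbackAlong
      (fun _ _ h => h.1) fun _ _ h => ⟨h.1, fun x => Set.mem_iUnion.2 ⟨σ, h.2 x⟩⟩
    obtain ⟨G, W, l, hl, hW⟩ := exists_cellChart σ hD
      (fun h hZ => ⟨h.isAdmissible hZ.1, fun x => (h.mem_locus_iff hZ.1.closed _ x).1 (hZ.2 _)⟩)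
      (fun _ _ h => h.1) fun _ _ h => ⟨h.1, fun x => σ.locus_subset h.1 (h.2 x)⟩
    obtain ⟨G', W', l', hl', hW'⟩ := exists_cellChart σ hD'
      (fun h hZ => ⟨h.isAdmissible hZ.1, fun x => (h.mem_locus_iff hZ.1.closed _ x).1 (hZ.2 _)⟩)
      (fun _ _ h => h.1) fun _ _ h => ⟨h.1, fun x => σ.locus_subset h.1 (h.2 x)⟩
    obtain ⟨e, he⟩ := hV.exists_iso hW
    obtain ⟨e', he'⟩ := hV'.exists_iso hW'
    have hle : e₀ + 1 + m ≤ e₀ + 1 + (m + 1) := Nat.le_succ _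
    have hVt := CellIndex.isInCell_trunc hV'.prop (by omega) hle
    obtain ⟨c, hc, -⟩ := hV.existsUnique F' _ hVt
    obtain ⟨b, hb, -⟩ := hD.existsUnique _ (D'.trunc (e₀ + 1 + m) hle)
      ⟨hD'.prop.1.truncate (by omega) hle, fun x =>
        (RelScheme.mem_locus_trunc_iff hD'.prop.1.closed hle _ x).2
          (locus_mono (σ.range_cell_succ m) (hD'.prop.2 x))⟩
    have h1 := hi.isPullback (by omega) hle hi' hU.prop.1.closed hU'.prop.1.closed ha hc
      fun f g hf hg => hU.hom_ext ⟨hVt.1, fun x => Set.mem_iUnion.2 ⟨σ, hVt.2 x⟩⟩ hf hg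
    have h2 := (hl.comp_iso he).isPullback (by omega) hle (hl'.comp_iso he') hD.prop.1.closed
      hD'.prop.1.closed hb hc
      fun f g hf hg => hD.hom_ext ⟨hVt.1, fun x => σ.locus_subset hVt.1 (hVt.2 x)⟩ hf hg
    exact ⟨F, F', i, i', c, hi.isOpenImmersion, hi.range, h1,
      MorphismProperty.of_isPullback (P := @IsAffineHom) h2 (isAffineHom_specOver b)⟩
  choose F F' i i' c hi hr hp hc using key
  have := isAffineHom_isZariskiLocalAtTarget
  refine of_isPullback_of_cover @IsAffineHom a.left (fun σ => (i σ).left) hi (fun y => ?_) hp hc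
  obtain ⟨σ, hσ⟩ := Set.mem_iUnion.1 (hU.prop.2 y)
  exact ⟨σ, by rw [hr σ]; exact hσ⟩

end AffineTransition

open RelScheme

/-! ### Sections of the universal families. -/

section ZeroSection

/-- A retraction of an algebra onto the base whose kernel is a given ideal. -/
theorem exists_algHom_of_ideal {B Q : Type*} [CommRing B] [CommRing Q] [Algebra B Q] (I : Ideal Q)
    (hI : ∀ q, ∃ b, q - algebraMap B Q b ∈ I) (v : Q) (hv : ∀ z ∈ I, z * v = 0)
    (hv' : ∀ b : B, b • v = 0 → b = 0) : ∃ ε : Q →ₐ[B] B, ∀ q ∈ I, ε q = 0 := by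
  -- Injectivity is witnessed by `v`: a scalar that lies in I kills `v`, hence is zero.
  have hb : Function.Bijective (Algebra.ofId B (Q ⧸ I)) := by
    constructor
    · rw [injective_iff_map_eq_zero]
      intro b hb
      have h1 : algebraMap B Q b ∈ I := Ideal.Quotient.eq_zero_iff_mem.1 hb
      exact hv' b (by rw [Algebra.smul_def]; exact hv _ h1)
    · intro q
      obtain ⟨q, rfl⟩ := Ideal.Quotient.mk_surjective q
      obtain ⟨b, hb⟩ := hI q
      exact ⟨b, (Ideal.Quotient.eq.2 hb).symm⟩
  refine ⟨(AlgEquiv.ofBijective _ hb).symm.toAlgHom.comp (Ideal.Quotient.mkₐ B I), fun q hq => ?_⟩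
  have h1 : Ideal.Quotient.mkₐ B I q = 0 := Ideal.Quotient.eq_zero_iff_mem.2 hq
  rw [AlgHom.comp_apply, h1, map_zero]

variable {k : Type u} [Field k] {N : ℕ}

theorem constantCoeff_eq_zero_of_mem {n : ℕ} (hn : n ≠ 0) {f : PS N k}
    (hf : f ∈ varIdeal N k ^ n) : MvPowerSeries.constantCoeff f = 0 := by
  rw [← MvPowerSeries.coeff_zero_eq_constantCoeff_apply]
  exact mem_varIdeal_pow_iff.1 hf 0 (by simpa using Nat.pos_of_ne_zero hn)

theorem sub_C_constantCoeff_mem (f : PS N k) :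
    f - algebraMap k (PS N k) (MvPowerSeries.constantCoeff f) ∈ varIdeal N k := by
  rw [← pow_one (varIdeal N k), mem_varIdeal_pow_iff]
  intro m hm
  have h1 : m = 0 := by
    rw [← Finsupp.degree_eq_zero_iff]
    omega
  subst h1
  simp [MvPowerSeries.algebraMap_apply]

/-- The `k`-point of `Spec R_n`. -/
def zeroHom (k : Type u) [Field k] (N : ℕ) {n : ℕ} (hn : n ≠ 0) : TruncRing k N n →ₐ[k] k :=
  Ideal.Quotient.liftₐ _ (AlgHom.mk (MvPowerSeries.constantCoeff (σ := Fin N) (R := k))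
    fun c => by simp [MvPowerSeries.algebraMap_apply])
    fun _ hf => constantCoeff_eq_zero_of_mem hn hf

theorem zeroHom_mk {n : ℕ} (hn : n ≠ 0) (f : PS N k) :
    zeroHom k N hn (Ideal.Quotient.mk _ f) = MvPowerSeries.constantCoeff f := rfl

theorem hom_specOver_self_ext {V : Over (Spec (CommRingCat.of k))} (f g : V ⟶ specOver k k) :
    f = g := by
  have h : (specOver k k).hom = 𝟙 _ := Spec.map_id (CommRingCat.of k)
  have hf := Over.w f
  have hg := Over.w g
  rw [h] at hf hg
  ext1
  exact ((Category.comp_id _).symm.trans hf).trans ((Category.comp_id _).symm.trans hg).symm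

/-- The product of the highest power of the linear form with a monomial of `j`, which exists because
e₀ ≠ 0. For n = e₀ + 1 + m this value of δ is n - 1, so the ideal of variables kills that element in
R_n. -/
theorem CellIndex.exists_δ_eq {e₀ : ℕ} {e₁ : ℤ} {s : ℕ} {L : Fin s → Fin N → k}
    (σ : CellIndex e₀ e₁ L) (he : e₀ ≠ 0) (m : ℕ) : ∃ i, (σ.cell m).δ i = e₀ + m := by
  obtain ⟨b, hb⟩ : σ.j.Nonempty := by
    rw [← Finset.card_ne_zero, σ.card_j]
    exact he
  refine ⟨Fintype.equivFin _ (Sum.inr (⟨b, hb⟩, Fin.last m)), ?_⟩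
  simp [CellIndex.cell]

theorem powIdeal_add (n r t : ℕ) :
    powIdeal k N n (r + t) = powIdeal k N n r * powIdeal k N n t := by
  have h : varIdeal N k ^ (r + t) = varIdeal N k ^ r * varIdeal N k ^ t := pow_add _ _ _
  simp only [powIdeal, ← Ideal.map_mul]
  exact congrArg (Ideal.map _) h

theorem powIdeal_self (n : ℕ) : powIdeal k N n n = ⊥ := Ideal.map_quotient_self _

/-- The retraction that defines the zero section of a family in a cell. -/
theorem exists_retraction {e₀ m : ℕ} {e₁ : ℤ} {s : ℕ} {L : Fin s → Fin N → k}
    (σ : CellIndex e₀ e₁ L) (he : e₀ ≠ 0) {B Q : Type u} [CommRing B] [Algebra k B] [CommRing Q]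
    [Algebra k Q] [Algebra B Q] [IsScalarTower k B Q] {g : TruncRing k N (e₀ + 1 + m) →ₐ[k] Q}
    (hg : (ofAlg B g).IsAdmissible (curveLength e₀ e₁) (e₀ + 1))
    (hs : Submodule.span B (Set.range g) = ⊤)
    (hb : Submodule.span B (psHom g '' Set.range (σ.cell m).v) = ⊤) :
    ∃ ε : Q →ₐ[B] B, ∀ r,
      ε (g r) = algebraMap k B (zeroHom k N (n := e₀ + 1 + m) (by omega) r) := by
  obtain ⟨b, hb⟩ := Cell.exists_basis hg hb
  obtain ⟨i, hi⟩ := σ.exists_δ_eq he m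
  have hsub : ∀ r, g r - algebraMap B Q (algebraMap k B
      (zeroHom k N (n := e₀ + 1 + m) (by omega) r)) ∈ (powIdeal k N (e₀ + 1 + m) 1).map g := by
    intro r
    obtain ⟨f, rfl⟩ := Ideal.Quotient.mk_surjective r
    rw [zeroHom_mk, ← IsScalarTower.algebraMap_apply, ← g.commutes, ← map_sub]
    refine Ideal.mem_map_of_mem g ?_
    rw [powIdeal, pow_one]
    exact Ideal.mem_map_of_mem (Ideal.Quotient.mk _) (sub_C_constantCoeff_mem f)
  suffices h : ∃ ε : Q →ₐ[B] B, ∀ q ∈ (powIdeal k N (e₀ + 1 + m) 1).map g, ε q = 0 by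
    obtain ⟨ε, hε⟩ := h
    refine ⟨ε, fun r => ?_⟩
    have h1 := hε _ (hsub r)
    rw [map_sub, sub_eq_zero, AlgHom.commutes] at h1
    exact h1
  refine exists_algHom_of_ideal _ (fun q => ?_) (b i) (fun z hz => ?_) fun c hc => ?_
  · have hq : q ∈ Submodule.span B (Set.range g) := hs ▸ Submodule.mem_top
    refine Submodule.span_induction (p := fun q _ => ∃ b : B, q - algebraMap B Q b ∈
      (powIdeal k N (e₀ + 1 + m) 1).map g) ?_ ⟨0, by simp⟩ ?_ ?_ hq
    · rintro _ ⟨r, rfl⟩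
      exact ⟨_, hsub r⟩
    · rintro x y _ _ ⟨a, ha⟩ ⟨c, hc⟩
      exact ⟨a + c, by rw [map_add, add_sub_add_comm]; exact add_mem ha hc⟩
    · rintro a x _ ⟨c, hc⟩
      refine ⟨a * c, ?_⟩
      rw [map_mul, Algebra.smul_def, ← mul_sub]
      exact Ideal.mul_mem_left _ _ hc
  · have h1 : (powIdeal k N (e₀ + 1 + m) 1).map g ≤
        LinearMap.ker (LinearMap.toSpanSingleton Q Q (b i)) := by
      rw [Ideal.map_le_iff_le_comap]
      intro a ha
      change g a * b i = 0
      have h2 : a * (σ.cell m).el i ∈ powIdeal k N (e₀ + 1 + m) (1 + (e₀ + m)) := by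
        rw [powIdeal_add]
        exact Ideal.mul_mem_mul ha (Cell.el_mem hi.ge)
      have h3 : powIdeal k N (e₀ + 1 + m) (1 + (e₀ + m)) = ⊥ := by
        rw [show 1 + (e₀ + m) = e₀ + 1 + m by omega, powIdeal_self]
      rw [h3] at h2
      rw [hb i, ← map_mul, (Submodule.mem_bot _).1 h2, map_zero]
    exact h1 hz
  · have h1 := congr(b.repr $hc i)
    simpa using h1

/-- The zero section of a family in the cells. -/
theorem IsCellFamily.exists_section {e₀ m : ℕ} {e₁ : ℤ} {s : ℕ} {L : Fin s → Fin N → k}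
    (he : e₀ ≠ 0) {S : Over (Spec (CommRingCat.of k))} {Z : RelScheme k N (e₀ + 1 + m) S}
    (hZ : IsCellFamily e₀ e₁ L Z) : ∃ z : S ⟶ Z.Z, z ≫ Z.toBase = 𝟙 S := by
  have hn : e₀ + 1 + m ≠ 0 := by omega
  -- Requiring the composite to Spec R_n to factor through its k-point makes local sections unique,
  -- so they glue.
  obtain ⟨z, hz⟩ := CurveModuli.exists_hom_of_local (S := S) (Y := Z.Z)
    (fun j f => f ≫ Z.toBase = j ∧ ∃ t, f ≫ Z.toTrunc = t ≫ specOverMap (zeroHom k N hn))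
    (fun i j f h => ⟨by rw [Category.assoc, h.1], by
      obtain ⟨t, ht⟩ := h.2
      exact ⟨i ≫ t, by rw [Category.assoc, ht, Category.assoc]⟩⟩)
    (fun j f f' h h' => hZ.1.closed.hom_ext (h.1.trans h'.1.symm) (by
      obtain ⟨t, ht⟩ := h.2
      obtain ⟨t', ht'⟩ := h'.2
      rw [ht, ht', hom_specOver_self_ext t t']))
    (fun x => by
      obtain ⟨σ, hσ⟩ := Set.mem_iUnion.1 (hZ.2 x)
      obtain ⟨B, _, _, j, hj, hx, hO⟩ := exists_affine_nhd S x
        ⟨σ.locus Z, σ.isOpen_locus hZ.1.closed⟩ hσ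
      obtain ⟨Q, _, _, _, _, g, h1, h2⟩ := hZ.1.closed.exists_ofAlg_along j
      have hfin := finite_of_span_range h1
      have hadm := h2.isAdmissible hZ.1
      have h3 := (span_eq_top_iff_forall_mem_locus h2 _).2 fun y =>
        σ.locus_subset hZ.1 (hO y)
      obtain ⟨ε, hε⟩ := exists_retraction σ he hadm h1 h3
      obtain ⟨γ, hγ, hγ'⟩ := h2
      refine ⟨_, j, hj, hx, specOverMap (ε.restrictScalars k) ≫ γ, ?_,
        specOverMap (Algebra.ofId k B), ?_⟩
      · rw [Category.assoc, hγ.w, ← Category.assoc, specOverMap_comp]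
        have h4 : (ε.restrictScalars k).comp (IsScalarTower.toAlgHom k B Q) = AlgHom.id k B := by
          ext b
          exact ε.commutes b
        rw [h4, specOverMap_id, Category.id_comp]
      · rw [Category.assoc, hγ', specOverMap_comp, specOverMap_comp]
        congr 1
        ext r
        exact hε r)
  refine ⟨z, hom_ext_of_local fun x => ?_⟩
  obtain ⟨V, j, hj, hx, h, -⟩ := hz x
  exact ⟨V, j, hj, hx, by rw [← Category.assoc, h, Category.comp_id]⟩

end ZeroSection

end

end CurveModuli

/-! ### The inverse systems and their limits. -/

theorem mainTheorem3 {k : Type u} [Field k] [IsAlgClosed k] (N e₀ : ℕ) (e₁ : ℤ)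
    (hp : ∃ I : Ideal (PS N k), IsCurveSingularity I ∧ HasHilbertPolynomial I e₀ e₁)
    (L : Fin (e₀ * (N - 1) + 1) → Fin N → k)
    (hL : ∀ c : Fin N ↪ Fin (e₀ * (N - 1) + 1), LinearIndependent k fun i => L (c i)) :
    ∃ (Hilb W Ξ : ℕ → Over (Spec (CommRingCat.of k)))
      (T : ∀ m, RelScheme k N (e₀ + 1 + m) (Hilb m))
      (w : ∀ m, W m ⟶ Hilb m)
      (j : ∀ m, Ξ m ⟶ W m)
      (U : ∀ m, RelScheme k N (e₀ + 1 + m) (Ξ m))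
      (a : ∀ m, Ξ (m + 1) ⟶ Ξ m)
      (H : Cone (Functor.ofOpSequence a)),
      -- `Hilb_n`, its universal family `T_n`, `W'(n)`, `Ξ_n`, and `U_n = T_n ×_{Hilb_n} Ξ_n`,
      -- for `n = e₀ + 1 + m`
      (∀ m, IsHilbertScheme (hilbPoly e₀ e₁ (((e₀ + 1 + m : ℕ) : ℤ) - 1)) (T m)) ∧
      (∀ m, IsTruncationStratum e₀ e₁ (T m) (w m)) ∧
      (∀ m, IsCellSubscheme e₀ e₁ L (T m) (w m) (j m)) ∧
      (∀ m, (U m).IsPullbackAlong (T m) (j m ≫ w m)) ∧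
      -- `Ξ_{n+1} ⟶ Ξ_n` is the truncation morphism, and `H` is the limit of the `Ξ_n`
      (∀ m, ((U (m + 1)).trunc (e₀ + 1 + m) (Nat.le_succ _)).IsPullbackAlong (U m) (a m)) ∧
      Nonempty (IsLimit H) ∧
      -- the `U_n` form an inverse system over the `Ξ_n`
      (∃ α : ∀ m, (U (m + 1)).Z ⟶ (U m).Z,
        ∀ m, α m ≫ (U m).toBase = (U (m + 1)).toBase ≫ a m) ∧
      -- every such inverse system has a limit, with an induced morphism to `H`
      (∀ α : ∀ m, (U (m + 1)).Z ⟶ (U m).Z,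
        (∀ m, α m ≫ (U m).toBase = (U (m + 1)).toBase ≫ a m) →
        ∃ Z : Cone (Functor.ofOpSequence (X := fun m => (U m).Z) α), Nonempty (IsLimit Z) ∧
          ∃ φ : Z.pt ⟶ H.pt, ∀ m : ℕ, φ ≫ H.π.app (op m) = Z.π.app (op m) ≫ (U m).toBase) ∧
      -- every family is obtained by pullback along a unique morphism to `H`
      (∀ (A : Type u) [CommRing A] [Algebra k A] [Algebra.FiniteType k A] (J : Ideal (PS N A)),
        IsFamily k e₀ e₁ J →
        ∃! σ : specOver k A ⟶ H.pt,
          ∀ m : ℕ, (truncation k J (e₀ + 1 + m)).IsPullbackAlong (U m) (σ ≫ H.π.app (op m))) := by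
  obtain ⟨I, hI, hI'⟩ := hp
  have he : e₀ ≠ 0 := hI'.ne_zero hI
  choose Hilb W Ξ T w j U hT hw hj hUT hU using fun m => exists_moduli e₀ m e₁ L
  have hle : ∀ m, e₀ + 1 + m ≤ e₀ + 1 + (m + 1) := fun m => Nat.le_succ _
  choose a ha _ using fun m => (hU m).existsUnique _ _
    ((hU (m + 1)).prop.trunc (by omega) (hle m))
  have haff : ∀ m, IsAffineHom (a m).left := fun m =>
    isAffineHom_of_isPullbackAlong_trunc (hU m) (hU (m + 1)) (ha m)
  have hlim := hasLimit_ofOpSequence_of_isAffineHom haff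
  let H := limit.cone (Functor.ofOpSequence a)
  have hH : IsLimit H := limit.isLimit _
  refine ⟨Hilb, W, Ξ, T, w, j, U, a, H, hT, hw, hj, hUT, ha, ⟨hH⟩, ?_, fun α hα => ?_,
    fun A _ _ _ J hJ => ?_⟩
  -- Truncation relates U_n to a closed subscheme of U_{n+1}, which is the wrong direction; the
  -- morphism is therefore routed through the base and the zero section.
  · choose z hz using fun m => (hU m).prop.exists_section he
    refine ⟨fun m => (U (m + 1)).toBase ≫ a m ≫ z m, fun m => ?_⟩
    rw [Category.assoc, Category.assoc, hz, Category.comp_id]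
  · have hα' : ∀ m, IsAffineHom (α m).left := fun m => by
      have h1 : IsFinite (U m).toBase.left := (hU m).prop.1.flat.1
      have h2 : IsFinite (U (m + 1)).toBase.left := (hU (m + 1)).prop.1.flat.1
      have h3 := haff m
      -- The composite equals the finite projection followed by the affine transition morphism. The
      -- projection of U_n is finite, so affineness passes to α itself, whichever α was chosen.
      have h4 : IsAffineHom ((α m).left ≫ (U m).toBase.left) := by
        rw [← Over.comp_left, hα, Over.comp_left]
        infer_instance
      exact IsAffineHom.of_comp _ (U m).toBase.left
    have hlim' := hasLimit_ofOpSequence_of_isAffineHom (X := fun m => (U m).Z) hα'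
    exact ⟨limit.cone _, ⟨limit.isLimit _⟩, exists_hom_ofOpSequence hH _ (fun m => (U m).toBase) hα⟩
  · have hcell : ∀ m, IsCellFamily e₀ e₁ L (truncation k J (e₀ + 1 + m)) := fun m =>
      ⟨hJ.isAdmissible m, hJ.mem_cellLocus he L hL m⟩
    choose f hf hf' using fun m => (hU m).existsUnique _ _ (hcell m)
    -- Compatibility with the transition morphisms comes from uniqueness: both morphisms classify
    -- the truncation of the family at the lower level.
    obtain ⟨σ, hσ, hσ'⟩ := existsUnique_lift_ofOpSequence hH f fun m => hf' m _ (by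
      have h1 := (truncation_isPullbackAlong_trunc (k := k) J (hle m)).comp
        (((hf (m + 1)).trunc (e₀ + 1 + m) (hle m)).comp (ha m))
      rwa [Category.id_comp] at h1)
    refine ⟨σ, fun m => ?_, fun τ hτ => hσ' τ fun m => hf' m _ (hτ m)⟩
    exact (congrArg (fun g => (truncation k J (e₀ + 1 + m)).IsPullbackAlong (U m) g) (hσ m)).mpr
      (hf m)
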